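/- Let $n\ge 1$, $\vec\ell=(\ell_1,\dots,\ell_n)\in\mathbb N^n$ (with $\mathbb N\ni 0$), $\chi,\iota\in\mathbb C$ with $\chi\neq0$, and write $\langle\mu\rangle_r=\mu(\mu-1)\cdots(\mu-r+1)$. **Lie algebras.** Let $\mathbb A=\mathbb C[t,t^{-1}][\partial_t]$ be the algebra of differential operators on the circle. $\widehat{gl}(n,\mathbb A)=M_{n\times n}(\mathbb A)\oplus\mathbb C\kappa$ has $\kappa$ central and $$[t^{m_1}\partial_t^{r_1}E_{i_1,j_1},t^{m_2}\partial_t^{r_2}E_{i_2,j_2}]=\delta_{j_1,i_2}t^{m_1}\partial_t^{r_1}t^{m_2}\partial_t^{r_2}E_{i_1,j_2}-\delta_{i_1,j_2}t^{m_2}\partial_t^{r_2}t^{m_1}\partial_t^{r_1}E_{i_2,j_1}+(-1)^{r_1}\delta_{i_1,j_2}\delta_{j_1,i_2}\delta_{r_1+r_2,m_1+m_2}r_1!\,r_2!\tbinom{m_1}{r_1+r_2+1}\kappa .$$ $\widehat{gl}(\vec\ell,\mathbb A)=\sum_{i,j}\mathbb A\,\partial_t^{\ell_j}E_{i,j}+\mathbb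 C\kappa$ is a Lie subalgebra. Let $\mathcal Z=\mathbb Z+\tfrac12$; $\widetilde{gl}(\infty)$ has basis $\mathcal E_{l,k}$ ($l,k\in\mathcal Z$) and a central element $\kappa_0$, with $$[\mathcal E_{l_1,l_2},\mathcal E_{k_1,k_2}]=\delta_{l_2+k_1,0}\mathcal E_{l_1,k_2}-\delta_{k_2+l_1,0}\mathcal E_{k_1,l_2}+\delta_{l_1+k_2,0}\delta_{l_2+k_1,0}\,[H(l_1)H(l_2)-H(k_1)H(k_2)]\,\kappa_0,$$ where $H(l)=1$ for $l>0$ and $H(l)=0$ for $l<0$. **Vertex algebras.** $\mathrm{LM}(U,W)$ is the space of linear maps and $W[z^{-1},z]]$ the space of formal Laurent series. A vertex algebra is a vector space $V$ with a linear map $Y(\cdot,z):V\to\mathrm{LM}(V,V[z^{-1},z]])$, $\partial\in\mathrm{End}\,V$ and $|0\rangle\in V$ such that $Y(|0\rangle,z)=\mathrm{Id}$, $[\partial,Y(v,z)]=\frac{d}{dz}Y(v,z)$, $Y(v,z)|0\rangle=e^{z\partial}v$, and for all $u,v$ there is a positive integer $m$ with $(z_1-z_2)^m[Y(u,z_1),Y(v,z_2)]=0$.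 A module is a vector space $W$ with a linear map $Y_W(\cdot,z):V\to\mathrm{LM}(W,W[z^{-1},z]])$ such that $Y_W(|0\rangle,z)=\mathrm{Id}$, $Y_W(\partial v,z)=\frac d{dz}Y_W(v,z)$, for all $u,v$ there is a positive integer $m$ with $(z_1-z_2)^m[Y_W(u,z_1),Y_W(v,z_2)]=0$, and for all $u,v\in V$, $w\in W$ there is a positive integer $m$ with $(z_0+z_2)^mY_W(u,z_0+z_2)Y_W(v,z_2)w=(z_2+z_0)^mY_W(Y(u,z_0)v,z_2)w$ (powers of sums are expanded in nonnegative powers of the second variable). It is irreducible if it is nonzero and has no proper nonzero subspace preserved by all coefficients of all $Y_W(v,z)$. For $f(z)=\sum_{p\in\mathbb Z}a_pz^p$ put $f(z)^-=\sum_{p\ge0}a_pz^p$ and $f(z)^+=\sum_{p<0}a_pz^p$. **The vacuum module.** $\mathcal V=\mathcal V_\chi(\widehat{gl}(\vec\ell,\mathbb A))$ is the $\widehat{gl}(\vec\ell,\mathbb A)$-module induced from the one-dimensional module $\mathbb C|0\rangle$ of the subalgebra spanned by $\kappa$ and the $t^m\partial_t^rE_{i,j}$ with $m\ge0$, $r\ge\ell_j$,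 on which $\kappa$ acts as $\chi$ and the other elements as $0$. On $\mathcal V$ let $E_{i,j}(r,z)=\sum_{l\in\mathbb Z}t^l\partial_t^rE_{i,j}z^{-l-1}$ for $r\ge\ell_j$. **The module.** Let $\mathcal M$ be an irreducible $\widetilde{gl}(\infty)$-module on which $\kappa_0$ acts as $\chi$, which is weighted, i.e. the direct sum of its weight spaces for $\mathcal T=\sum_l\mathbb C\mathcal E_{l,-l}+\mathbb C\kappa_0$, and which is generated by a subspace that, for some $m\in\mathbb N$, is annihilated by all $\mathcal E_{l_1,-l_2}$ and $\mathcal E_{-l_1,l_2}$ with $l_1,l_2\in\mathcal Z$, $l_1,l_2>m$. For $i,j\in\{1,\dots,n\}$ and $r\ge\ell_j$ define on $\mathcal M$, if $\iota\notin\mathbb Z$, $$E^\iota_{i,j}(r,z)=\sum_{l,k\in\mathbb Z}\langle\iota-k\rangle_r\,\mathcal E_{ln+i-1/2,\,kn-j+1/2}\,z^{-l-k-r-1}-\delta_{i,j}\frac{\langle\iota\rangle_{r+1}}{r+1}\,\kappa_0z^{-r-1},$$ and, if $\iota\in\mathbb Z$, $$\begin{aligned}E^\iota_{i,j}(r,z)=\sum_{l,k=0}^\infty\Big[&\langle-k-1\rangle_r\,\mathcal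 E_{(l-\iota)n+i-1/2,\,(k+\iota+1)n-j+1/2}\,z^{-l-k-\ell_i-r-2}\\&+\langle k+\ell_j\rangle_r\,\mathcal E_{(l-\iota)n+i-1/2,\,(\iota-k)n-j+1/2}\,z^{-l+k+\ell_j-\ell_i-r-1}\\&+\langle k+\ell_j\rangle_r\,\mathcal E_{-(l+\iota+1)n+i-1/2,\,(\iota-k)n-j+1/2}\,z^{l+k+\ell_j-r}\\&+\langle-k-1\rangle_r\,\mathcal E_{-(l+\iota+1)n+i-1/2,\,(k+\iota+1)n-j+1/2}\,z^{l-k-r-1}\Big]-\delta_{i,j}\frac{\langle\iota'\rangle_{r+1}}{r+1}\,\kappa_0z^{-r-1},\end{aligned}$$ where $\iota'=\iota+\ell_i$ if $\iota>0$ and $\iota'=\iota$ if $\iota\le0$. Assume that $E^\iota_{i,j}(r,z)w\in\mathcal M[z^{-1},z]]$ for all $i,j$, all $r\ge\ell_j$ and all $w\in\mathcal M$ (as holds, for instance, if every vector of $\mathcal M$ is annihilated by $\mathcal E_{l,k}$ whenever $l+k$ is sufficiently large). **Theorem.** (a) There is a unique linear map $\partial:\mathcal V\to\mathcal V$ with $\partial|0\rangle=0$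 and $\partial(t^{-m-1}\partial_t^rE_{i,j}\,v)=(m+1)\,t^{-m-2}\partial_t^rE_{i,j}\,v+t^{-m-1}\partial_t^rE_{i,j}\,\partial v$ for all $v\in\mathcal V$, $i,j$, $m\ge0$, $r\ge\ell_j$. (b) There is a unique linear map $Y(\cdot,z):\mathcal V\to\mathrm{LM}(\mathcal V,\mathcal V[z^{-1},z]])$ with $Y(|0\rangle,z)=\mathrm{Id}$ and $Y(uv,z)=Y^-(u,z)Y(v,z)+Y(v,z)Y^+(u,z)$ for all $v\in\mathcal V$ and $u=t^{-m-1}\partial_t^rE_{i,j}$, $m\ge0$, $r\ge\ell_j$, where $Y^\pm(u,z)=\frac1{m!}\frac{d^m}{dz^m}E_{i,j}(r,z)^\pm$. (c) There is a unique linear map $Y^\iota_{\mathcal M}(\cdot,z):\mathcal V\to\mathrm{LM}(\mathcal M,\mathcal M[z^{-1},z]])$ with $Y^\iota_{\mathcal M}(|0\rangle,z)=\mathrm{Id}$ and $Y^\iota_{\mathcal M}(uv,z)=Y^{\iota,-}_{\mathcal M}(u,z)Y^\iota_{\mathcal M}(v,z)+Y^\iota_{\mathcal M}(v,z)Y^{\iota,+}_{\mathcal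 M}(u,z)$ for the same $u,v$, where $Y^{\iota,\pm}_{\mathcal M}(u,z)=\frac1{m!}\frac{d^m}{dz^m}E^\iota_{i,j}(r,z)^\pm$. (d) $(\mathcal V,Y(\cdot,z),\partial,|0\rangle)$ is a vertex algebra, and $(\mathcal M,Y^\iota_{\mathcal M}(\cdot,z))$ is an irreducible module of it. -/

import Mathlib

noncomputable section

/-! ### Falling factorials and bilinear extension -/

/-- The falling factorial `μ (μ - 1) ⋯ (μ - (m - 1))`. -/
def fall (μ : ℂ) (m : ℕ) : ℂ := (descPochhammer ℂ m).eval μ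

/-- Bilinear extension of a function on pairs of basis vectors. -/
def bilin {I P : Type*} [AddCommGroup P] [Module ℂ P] (f : I → I → P) :
    (I →₀ ℂ) →ₗ[ℂ] (I →₀ ℂ) →ₗ[ℂ] P :=
  Finsupp.linearCombination ℂ (fun a => Finsupp.linearCombination ℂ (f a))

theorem bilin_single {I P : Type*} [AddCommGroup P] [Module ℂ P] (f : I → I → P) (a b : I) :
    bilin f (Finsupp.single a 1) (Finsupp.single b 1) = f a b := by
  simp [bilin]

theorem bilin_single_right {I P : Type*} [AddCommGroup P] [Module ℂ P] (f : I → I → P)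
    (u : I →₀ ℂ) (b : I) :
    bilin f u (Finsupp.single b 1) = Finsupp.linearCombination ℂ (fun a => f a b) u := by
  induction u using Finsupp.induction_linear with
  | zero => simp
  | add x y hx hy => simp [hx, hy]
  | single a c => simp [bilin]

theorem bilin_single_left {I P : Type*} [AddCommGroup P] [Module ℂ P] (f : I → I → P)
    (u : I →₀ ℂ) (a : I) :
    bilin f (Finsupp.single a 1) u = Finsupp.linearCombination ℂ (f a) u := by
  simp [bilin]

/-! ### One-dimensional central extensions of associative algebras with a basis -/

/-- An associative algebra with basis `I` and product `mul`, together with a cyclic cocycle `coc`;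
these are the data of a one-dimensional central extension of its commutator Lie algebra. -/
structure CyclicAlgebra (I : Type) where
  mul : I → I → (I →₀ ℂ)
  coc : I → I → ℂ
  assoc : ∀ a b c, bilin mul (mul a b) (Finsupp.single c 1) =
    bilin mul (Finsupp.single a 1) (mul b c)
  skew : ∀ a b, coc a b = -coc b a
  cyclic : ∀ a b c, bilin coc (mul a b) (Finsupp.single c 1) +
    bilin coc (mul b c) (Finsupp.single a 1) + bilin coc (mul c a) (Finsupp.single b 1) = 0

namespace CyclicAlgebra

variable {I : Type} (S : CyclicAlgebra I)

/-- The vector space `A ⊕ ℂ κ`. -/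
def Ext (_S : CyclicAlgebra I) : Type := (I →₀ ℂ) × ℂ

instance : AddCommGroup S.Ext := inferInstanceAs (AddCommGroup ((I →₀ ℂ) × ℂ))
instance : Module ℂ S.Ext := inferInstanceAs (Module ℂ ((I →₀ ℂ) × ℂ))

theorem assoc_all (u v w : I →₀ ℂ) :
    bilin S.mul (bilin S.mul u v) w = bilin S.mul u (bilin S.mul v w) := by
  induction u using Finsupp.induction_linear with
  | zero => simp
  | add x y hx hy => simp [hx, hy]
  | single a r =>
    induction v using Finsupp.induction_linear with
    | zero => simp
    | add x y hx hy => simp [hx, hy]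
    | single b s =>
      induction w using Finsupp.induction_linear with
      | zero => simp
      | add x y hx hy => simp [hx, hy]
      | single c t =>
        rw [← mul_one r, ← mul_one s, ← mul_one t, ← smul_eq_mul, ← smul_eq_mul, ← smul_eq_mul,
          ← Finsupp.smul_single, ← Finsupp.smul_single, ← Finsupp.smul_single]
        simp only [map_smul, LinearMap.smul_apply, bilin_single, S.assoc]

theorem skew_all (u v : I →₀ ℂ) : bilin S.coc u v = -bilin S.coc v u := by
  induction u using Finsupp.induction_linear with
  | zero => simp
  | add x y hx hy => simp [hx, hy]; ring
  | single a r =>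
    induction v using Finsupp.induction_linear with
    | zero => simp
    | add x y hx hy => simp [hx, hy]; ring
    | single b s =>
      rw [← mul_one r, ← mul_one s, ← smul_eq_mul, ← smul_eq_mul,
        ← Finsupp.smul_single, ← Finsupp.smul_single]
      simp only [map_smul, LinearMap.smul_apply, bilin_single, S.skew a b, smul_eq_mul]
      ring

theorem cyclic_all (u v w : I →₀ ℂ) :
    bilin S.coc (bilin S.mul u v) w + bilin S.coc (bilin S.mul v w) u +
      bilin S.coc (bilin S.mul w u) v = 0 := by
  induction u using Finsupp.induction_linear with
  | zero => simp
  | add x y hx hy => simp only [map_add, LinearMap.add_apply]; linear_combination hx + hy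
  | single a r =>
    induction v using Finsupp.induction_linear with
    | zero => simp
    | add x y hx hy => simp only [map_add, LinearMap.add_apply]; linear_combination hx + hy
    | single b s =>
      induction w using Finsupp.induction_linear with
      | zero => simp
      | add x y hx hy => simp only [map_add, LinearMap.add_apply]; linear_combination hx + hy
      | single c t =>
        rw [← mul_one r, ← mul_one s, ← mul_one t, ← smul_eq_mul, ← smul_eq_mul, ← smul_eq_mul,
          ← Finsupp.smul_single, ← Finsupp.smul_single, ← Finsupp.smul_single]
        simp only [map_smul, LinearMap.smul_apply, bilin_single, smul_eq_mul]
        linear_combination (r * s * t) * S.cyclic a b c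

/-- The Lie bracket `[x + μ₁ κ, y + μ₂ κ] = xy - yx + coc(x, y) κ`. -/
instance : Bracket S.Ext S.Ext :=
  ⟨fun x y => ((bilin S.mul x.1 y.1 - bilin S.mul y.1 x.1, bilin S.coc x.1 y.1) :
    (I →₀ ℂ) × ℂ)⟩

theorem bracket_fst (x y : S.Ext) : (⁅x, y⁆ : S.Ext).1 =
    bilin S.mul x.1 y.1 - bilin S.mul y.1 x.1 := rfl
theorem bracket_snd (x y : S.Ext) : (⁅x, y⁆ : S.Ext).2 = bilin S.coc x.1 y.1 := rfl
theorem ext_fst_add (x y : S.Ext) : (x + y).1 = x.1 + y.1 := rfl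
theorem ext_snd_add (x y : S.Ext) : (x + y).2 = x.2 + y.2 := rfl
theorem ext_fst_smul (r : ℂ) (x : S.Ext) : (r • x).1 = r • x.1 := rfl
theorem ext_snd_smul (r : ℂ) (x : S.Ext) : (r • x).2 = r • x.2 := rfl

instance : LieRing S.Ext where
  add_lie x y z := by
    refine Prod.ext ?_ ?_
    · simp only [bracket_fst, ext_fst_add, map_add, LinearMap.add_apply]; abel
    · simp only [bracket_snd, ext_fst_add, ext_snd_add, map_add, LinearMap.add_apply]
  lie_add x y z := by
    refine Prod.ext ?_ ?_
    · simp only [bracket_fst, ext_fst_add, map_add, LinearMap.add_apply]; abel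
    · simp only [bracket_snd, ext_fst_add, ext_snd_add, map_add]
  lie_self x := by
    refine Prod.ext ?_ ?_
    · simp only [bracket_fst, sub_self]; rfl
    · have := S.skew_all x.1 x.1
      simp only [bracket_snd]
      change _ = (0 : ℂ)
      linear_combination this / 2
  leibniz_lie x y z := by
    refine Prod.ext ?_ ?_
    · simp only [bracket_fst, ext_fst_add, map_sub, LinearMap.sub_apply, assoc_all]; abel
    · simp only [bracket_fst, bracket_snd, ext_snd_add, map_sub, LinearMap.sub_apply]
      have h1 := S.cyclic_all x.1 y.1 z.1
      have h2 := S.cyclic_all y.1 x.1 z.1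
      rw [S.skew_all x.1 (bilin S.mul y.1 z.1), S.skew_all x.1 (bilin S.mul z.1 y.1),
        S.skew_all y.1 (bilin S.mul x.1 z.1), S.skew_all y.1 (bilin S.mul z.1 x.1)]
      linear_combination -h1 + h2

instance : LieAlgebra ℂ S.Ext where
  lie_smul t x y := by
    refine Prod.ext ?_ ?_
    · simp only [bracket_fst, ext_fst_smul, map_smul, LinearMap.smul_apply, smul_sub]
    · simp only [bracket_snd, ext_fst_smul, ext_snd_smul, map_smul]

/-- The basis vector of `A` with index `a`. -/
def basisVec (a : I) : S.Ext := ((Finsupp.single a 1, 0) : (I →₀ ℂ) × ℂ)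

/-- The central element `κ`. -/
def central : S.Ext := ((0, 1) : (I →₀ ℂ) × ℂ)

end CyclicAlgebra

/-! ### The Lie algebra of infinite matrices -/

/-- The step function `H` on `ℤ + 1/2`; the integer `p` stands for the half-integer `p + 1/2`. -/
def stepH (p : ℤ) : ℂ := if 0 ≤ p then 1 else 0

/-- The product `E_{l₁,l₂} E_{k₁,k₂} = δ_{l₂+k₁,0} E_{l₁,k₂}`.  The index `(p, q)` of type `ℤ × ℤ`
stands for the pair `(p + 1/2, q + 1/2)` of half-integers, so that the sum of two indices vanishes
when the corresponding integers add up to `-1`. -/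
def matMul (a b : ℤ × ℤ) : ℤ × ℤ →₀ ℂ :=
  if a.2 + b.1 + 1 = 0 then Finsupp.single (a.1, b.2) 1 else 0

/-- The cocycle `δ_{l₁+k₂,0} δ_{l₂+k₁,0} (H(l₁) H(l₂) - H(k₁) H(k₂))`. -/
def matCoc (a b : ℤ × ℤ) : ℂ :=
  if a.1 + b.2 + 1 = 0 ∧ a.2 + b.1 + 1 = 0 then
    stepH a.1 * stepH a.2 - stepH b.1 * stepH b.2 else 0

theorem matCoc_eq (a b : ℤ × ℤ) : matCoc a b =
    if a.1 + b.2 + 1 = 0 ∧ a.2 + b.1 + 1 = 0 then stepH a.1 - stepH b.1 else 0 := by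
  unfold matCoc stepH
  split_ifs <;> first | omega | simp

/-- The data of the central extension of the algebra of infinite matrices with finitely many nonzero
entries. -/
def infMatrix : CyclicAlgebra (ℤ × ℤ) where
  mul := matMul
  coc := matCoc
  assoc a b c := by
    rw [bilin_single_right, bilin_single_left]
    unfold matMul
    split_ifs with h1 h2 <;> simp_all
  skew a b := by
    rw [matCoc_eq, matCoc_eq]
    split_ifs <;> first | omega | simp
  cyclic a b c := by
    rw [bilin_single_right, bilin_single_right, bilin_single_right]
    unfold matMul
    split_ifs <;> simp only [Finsupp.linearCombination_single, map_zero, matCoc_eq, one_smul,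
      add_zero, zero_add] <;> split_ifs <;> first | omega | simp

/-- The Lie algebra spanned by the `E_{l,k}`, `l, k ∈ ℤ + 1/2`, and the central element `κ₀`. -/
abbrev GlInf : Type := infMatrix.Ext

/-- The basis vector `E_{p+1/2, q+1/2}`. -/
def matE (p q : ℤ) : GlInf := infMatrix.basisVec (p, q)

/-- The central element `κ₀`. -/
def kappa0 : GlInf := infMatrix.central

/-! ### Differential operators on the circle -/

theorem fall_zero (x : ℂ) : fall x 0 = 1 := by simp [fall]

theorem fall_succ (x : ℂ) (m : ℕ) : fall x (m + 1) = fall x m * (x - m) :=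
  descPochhammer_succ_eval m x

theorem fall_add (x : ℂ) (a b : ℕ) : fall x (a + b) = fall x a * fall (x - a) b := by
  simp [fall, ← descPochhammer_mul]

theorem fall_succ_left (x : ℂ) (m : ℕ) : fall x (m + 1) = x * fall (x - 1) m := by
  rw [add_comm, fall_add]; simp [fall]

theorem fall_smeval (x : ℂ) (r : ℕ) : fall x r = (descPochhammer ℤ r).smeval x := by
  rw [← Polynomial.aeval_eq_smeval, fall, ← descPochhammer_map (algebraMap ℤ ℂ),
    Polynomial.eval_map_algebraMap]

theorem fall_choose (m : ℤ) (k : ℕ) : fall m k = (k.factorial : ℂ) * (Ring.choose m k : ℤ) := by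
  have h := Ring.descPochhammer_eq_factorial_smul_choose m k
  rw [← Polynomial.aeval_eq_smeval, Polynomial.coe_aeval_eq_eval] at h
  rw [fall, ← descPochhammer_map (Int.castRingHom ℂ), Polynomial.eval_intCast_map]
  simp [h]

theorem fall_nat (m k : ℕ) : fall m k = (k.factorial : ℂ) * (m.choose k : ℂ) := by
  have := fall_choose m k
  rw [Ring.choose_natCast] at this
  simpa using this

theorem fall_vandermonde (x y : ℂ) (r : ℕ) : fall (x + y) r =
    ∑ s ∈ Finset.range (r + 1), (r.choose s : ℂ) * (fall x s * fall y (r - s)) := by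
  have h := Ring.descPochhammer_smeval_add r (Commute.all x y)
  rw [Finset.Nat.sum_antidiagonal_eq_sum_range_succ_mk] at h
  simpa only [fall_smeval] using h

/-- The signed sum of `f` over `0 ≤ x < d` (over `d ≤ x < 0`, with a minus sign, if `d < 0`). -/
def signedSum (d : ℤ) (f : ℤ → ℂ) : ℂ :=
  ∑ x ∈ Finset.Ico 0 d, f x - ∑ x ∈ Finset.Ico d 0, f x

theorem signedSum_zero (f : ℤ → ℂ) : signedSum 0 f = 0 := by simp [signedSum]

theorem signedSum_succ (d : ℤ) (f : ℤ → ℂ) : signedSum (d + 1) f = signedSum d f + f d := by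
  unfold signedSum
  rcases lt_or_ge d 0 with h | h
  · have h1 : Finset.Ico d 0 = insert d (Finset.Ico (d + 1) 0) := by
      ext x; simp only [Finset.mem_Ico, Finset.mem_insert]; omega
    rw [Finset.Ico_eq_empty (by omega : ¬ (0 : ℤ) < d + 1),
      Finset.Ico_eq_empty (by omega : ¬ (0 : ℤ) < d), h1, Finset.sum_insert (by simp)]
    simp
  · have h1 : Finset.Ico 0 (d + 1) = insert d (Finset.Ico 0 d) := by
      ext x; simp only [Finset.mem_Ico, Finset.mem_insert]; omega
    rw [Finset.Ico_eq_empty (by omega : ¬ d + 1 < (0 : ℤ)),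
      Finset.Ico_eq_empty (by omega : ¬ d < (0 : ℤ)), h1, Finset.sum_insert (by simp)]
    simp [add_comm]

/-- A function of `d` is a signed sum as soon as it has the right differences. -/
theorem signedSum_unique (F f : ℤ → ℂ) (h0 : F 0 = 0) (h : ∀ d, F (d + 1) = F d + f d) (d : ℤ) :
    F d = signedSum d f := by
  induction d using Int.induction_on with
  | zero => rw [h0, signedSum_zero]
  | succ i ih => rw [h, signedSum_succ, ih]
  | pred i ih =>
    have h1 := h (-(i : ℤ) - 1)
    have h2 := signedSum_succ (-(i : ℤ) - 1) f
    rw [sub_add_cancel] at h1 h2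
    linear_combination ih - h1 + h2

theorem signedSum_add (d e : ℤ) (f : ℤ → ℂ) :
    signedSum (d + e) f = signedSum d f + signedSum e (fun x => f (x + d)) := by
  have := signedSum_unique (fun e => signedSum (d + e) f - signedSum d f) (fun x => f (x + d))
    (by simp) (fun e => by rw [← add_assoc, signedSum_succ, add_comm e d]; ring) e
  linear_combination this

theorem signedSum_sum {α : Type*} (s : Finset α) (c : α → ℂ) (f : α → ℤ → ℂ) (d : ℤ) :
    ∑ a ∈ s, c a * signedSum d (f a) = signedSum d (fun x => ∑ a ∈ s, c a * f a x) := by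
  refine signedSum_unique (fun d => ∑ a ∈ s, c a * signedSum d (f a)) _ ?_ ?_ d
  · simp [signedSum_zero]
  · intro d
    simp only [signedSum_succ, mul_add, Finset.sum_add_distrib]

theorem fall_zero_succ (m : ℕ) : fall 0 (m + 1) = 0 := by rw [fall_succ_left]; simp

theorem fall_diff (x : ℂ) (m : ℕ) : fall (x + 1) (m + 1) = fall x (m + 1) + (m + 1) * fall x m := by
  rw [fall_succ_left, add_sub_cancel_right, fall_succ]; ring

theorem signedSum_fall (r₁ : ℕ) : ∀ (r₂ : ℕ) (d : ℤ),
    ((r₁ + r₂ + 1).factorial : ℂ) * signedSum d (fun x => fall x r₂ * fall (x - d : ℤ) r₁) =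
      (-1) ^ r₁ * r₁.factorial * r₂.factorial * fall (d + r₁ : ℤ) (r₁ + r₂ + 1) := by
  induction r₁ with
  | zero =>
    intro r₂ d
    have := signedSum_unique (fun d => fall d (r₂ + 1) / (r₂ + 1)) (fun x => fall x r₂)
      (by simp [fall_zero_succ]) (fun d => by
        have : ((r₂ : ℂ) + 1) ≠ 0 := by exact_mod_cast Nat.succ_ne_zero r₂
        push_cast
        rw [fall_diff]; field_simp) d
    simp only [fall_zero, mul_one, ← this, zero_add, Nat.factorial_succ, Nat.factorial_zero]
    have : ((r₂ : ℂ) + 1) ≠ 0 := by exact_mod_cast Nat.succ_ne_zero r₂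
    push_cast
    field_simp
    simp
  | succ r ih =>
    intro r₂ d
    have hr : ((r₂ : ℂ) + 1) ≠ 0 := by exact_mod_cast Nat.succ_ne_zero r₂
    have key : signedSum d (fun x => fall x r₂ * fall (x - d : ℤ) (r + 1)) =
        -((r + 1) / (r₂ + 1)) *
          signedSum (d + 1) (fun x => fall x (r₂ + 1) * fall (x - (d + 1) : ℤ) r) := by
      have h := signedSum_unique
        (fun e => fall e (r₂ + 1) * fall (e - d - 1 : ℤ) (r + 1) / (r₂ + 1) -
          (r + 1) / (r₂ + 1) * signedSum e (fun x => fall x (r₂ + 1) * fall (x - (d + 1) : ℤ) r))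
        (fun x => fall x r₂ * fall (x - d : ℤ) (r + 1)) (by simp [fall_zero_succ, signedSum_zero])
        (fun e => by
          simp only [signedSum_succ]
          have e1 : ((e - d : ℤ) : ℂ) = (e - d - 1 : ℤ) + 1 := by push_cast; ring
          rw [show e + 1 - d - 1 = e - d by ring, show e - (d + 1) = e - d - 1 by ring, e1,
            fall_diff]
          push_cast
          rw [fall_diff]
          field_simp
          ring) (d + 1)
      have h2 := signedSum_succ d (fun x => fall x r₂ * fall (x - d : ℤ) (r + 1))
      simp only [sub_self, Int.cast_zero, fall_zero_succ, mul_zero, add_zero,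
        show d + 1 - d - 1 = 0 by ring, zero_div, zero_sub] at h h2
      rw [← h2, ← h]; ring
    rw [key]
    have := ih (r₂ + 1) (d + 1)
    rw [show r + (r₂ + 1) + 1 = r + 1 + r₂ + 1 by ring] at this
    rw [show d + 1 + (r : ℤ) = d + ((r + 1 : ℕ) : ℤ) by push_cast; ring] at this
    generalize fall _ (r + 1 + r₂ + 1) = Y at this ⊢
    generalize signedSum (d + 1) _ = X at this ⊢
    rw [mul_left_comm, this]
    simp only [Nat.factorial_succ r, Nat.factorial_succ r₂]
    push_cast
    field_simp
    ring

/-- An index `(i, j, m, r)` of a basis vector `t^m ∂_t^r E_{i,j}` of the algebra of `n × n` matrices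
of differential operators on the circle (`i`, `j` count from `0`). -/
structure DiffIdx (n : ℕ) where
  row : Fin n
  col : Fin n
  deg : ℤ
  ord : ℕ

/-- The product `t^{m₁} ∂^{r₁} E_{i₁,j₁} · t^{m₂} ∂^{r₂} E_{i₂,j₂} =
δ_{j₁,i₂} ∑_s (r₁ choose s) m₂ (m₂ - 1) ⋯ (m₂ - s + 1) t^{m₁+m₂-s} ∂^{r₁+r₂-s} E_{i₁,j₂}`. -/
def diffMul {n : ℕ} (a b : DiffIdx n) : DiffIdx n →₀ ℂ :=
  if a.col = b.row then
    ∑ s ∈ Finset.range (a.ord + 1), Finsupp.single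
      ⟨a.row, b.col, a.deg + b.deg - s, a.ord + b.ord - s⟩ ((a.ord.choose s : ℂ) * fall b.deg s)
  else 0

/-- The cocycle `(-1)^{r₁} δ_{i₁,j₂} δ_{j₁,i₂} δ_{r₁+r₂,m₁+m₂} r₁! r₂! (m₁ choose r₁+r₂+1)`. -/
def diffCoc {n : ℕ} (a b : DiffIdx n) : ℂ :=
  if a.row = b.col ∧ a.col = b.row ∧ (a.ord : ℤ) + b.ord = a.deg + b.deg then
    (-1) ^ a.ord * a.ord.factorial * b.ord.factorial * (Ring.choose a.deg (a.ord + b.ord + 1) : ℤ)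
  else 0

theorem diffCoc_eq {n : ℕ} (a b : DiffIdx n) : diffCoc a b =
    if a.row = b.col ∧ a.col = b.row ∧ (a.ord : ℤ) + b.ord = a.deg + b.deg then
      signedSum (a.deg - a.ord) (fun x => fall x b.ord * fall (x - (a.deg - a.ord) : ℤ) a.ord)
    else 0 := by
  unfold diffCoc
  split_ifs with h
  · have h1 := signedSum_fall a.ord b.ord (a.deg - a.ord)
    have h0 : (((a.ord + b.ord + 1).factorial : ℕ) : ℂ) ≠ 0 := by
      exact_mod_cast Nat.factorial_ne_zero _
    rw [sub_add_cancel, fall_choose] at h1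
    refine mul_left_cancel₀ h0 ?_
    rw [h1]; ring
  · rfl

/-- The action on Laurent polynomials: `t^m ∂^r E_{i,j}` sends `t^x e_j` to
`x (x - 1) ⋯ (x - r + 1) t^{x+m-r} e_i`. -/
def diffSymbol {n : ℕ} (i j : Fin n) (d x : ℤ) (a : DiffIdx n) : ℂ :=
  if a.row = i ∧ a.col = j ∧ a.deg - a.ord = d then fall x a.ord else 0

theorem diffSymbol_inj {n : ℕ} (u : DiffIdx n →₀ ℂ)
    (h : ∀ i j d x, Finsupp.linearCombination ℂ (diffSymbol i j d x) u = 0) : u = 0 := by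
  classical
  have key : ∀ (r : ℕ) (i j : Fin n) (d : ℤ), u ⟨i, j, d + r, r⟩ = 0 := by
    intro r
    induction r using Nat.strong_induction_on with
    | _ r ih =>
      intro i j d
      have h1 := h i j d r
      rw [Finsupp.linearCombination_apply, Finsupp.sum,
        Finset.sum_eq_single (⟨i, j, d + r, r⟩ : DiffIdx n)] at h1
      · have h2 : fall (r : ℂ) r ≠ 0 := by
          rw [fall_nat]
          simp [Nat.factorial_ne_zero]
        simpa [diffSymbol, h2] using h1
      · rintro ⟨i', j', m, s⟩ _ hne
        simp only [diffSymbol, smul_eq_mul]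
        split_ifs with hc
        · obtain ⟨rfl, rfl, rfl⟩ := hc
          rcases lt_trichotomy s r with hs | hs | hs
          · have := ih s hs i' j' (m - s)
            rw [sub_add_cancel] at this
            rw [this, zero_mul]
          · subst hs; simp at hne
          · rw [Int.cast_natCast, fall_nat, Nat.choose_eq_zero_of_lt hs]; simp
        · simp
      · intro hn
        rw [Finsupp.notMem_support_iff.mp hn, zero_smul]
  ext ⟨i, j, m, r⟩
  have := key r i j (m - r)
  rwa [sub_add_cancel] at this

/-- Composition of falling factorials in the product of two differential operators. -/
theorem fall_leibniz (x y : ℂ) (r₁ r₂ : ℕ) :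
    ∑ s ∈ Finset.range (r₁ + 1), (r₁.choose s : ℂ) * fall y s * fall x (r₁ + r₂ - s) =
      fall x r₂ * fall (x + (y - r₂)) r₁ := by
  rw [show x + (y - r₂) = y + (x - r₂) by ring, fall_vandermonde, Finset.mul_sum]
  refine Finset.sum_congr rfl fun s hs => ?_
  have : s ≤ r₁ := by simpa [Nat.lt_succ_iff] using hs
  rw [show r₁ + r₂ - s = r₂ + (r₁ - s) by omega, fall_add]
  ring

theorem diffSymbol_mul {n : ℕ} (i j : Fin n) (d x : ℤ) (a b : DiffIdx n) :
    Finsupp.linearCombination ℂ (diffSymbol i j d x) (diffMul a b) =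
      if a.col = b.row ∧ a.row = i ∧ b.col = j ∧ a.deg - a.ord + (b.deg - b.ord) = d then
        fall x b.ord * fall (x + (b.deg - b.ord)) a.ord else 0 := by
  unfold diffMul
  split_ifs with h1 h2 h2
  · rw [map_sum, ← fall_leibniz]
    refine Finset.sum_congr rfl fun s hs => ?_
    have : s ≤ a.ord := by simpa [Nat.lt_succ_iff] using hs
    rw [Finsupp.linearCombination_single, diffSymbol, if_pos, smul_eq_mul]
    refine ⟨h2.2.1, h2.2.2.1, ?_⟩
    simp only
    omega
  · rw [map_sum]
    refine Finset.sum_eq_zero fun s hs => ?_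
    have : s ≤ a.ord := by simpa [Nat.lt_succ_iff] using hs
    rw [Finsupp.linearCombination_single, diffSymbol, if_neg, smul_zero]
    rintro ⟨h3, h4, h5⟩
    refine h2 ⟨h1, h3, h4, ?_⟩
    simp only at h5
    omega
  · exact absurd h2.1 h1
  · simp

theorem diffMul_assoc {n : ℕ} (a b c : DiffIdx n) :
    bilin diffMul (diffMul a b) (Finsupp.single c 1) =
      bilin diffMul (Finsupp.single a 1) (diffMul b c) := by
  rw [bilin_single_right, bilin_single_left, ← sub_eq_zero]
  refine diffSymbol_inj _ fun i j d x => ?_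
  rw [map_sub, sub_eq_zero, Finsupp.apply_linearCombination, Finsupp.apply_linearCombination]
  have f1 : (⇑(Finsupp.linearCombination ℂ (diffSymbol i j d x)) ∘ fun a => diffMul a c) =
    fun a => _ := funext fun a => diffSymbol_mul i j d x a c
  have f2 : (⇑(Finsupp.linearCombination ℂ (diffSymbol i j d x)) ∘ diffMul a) =
    fun b => _ := funext fun b => diffSymbol_mul i j d x a b
  rw [f1, f2]
  unfold diffMul
  split_ifs with h1 h2 h2
  · simp only [map_sum, Finsupp.linearCombination_single]
    simp only [smul_eq_mul]
    by_cases hc : a.row = i ∧ c.col = j ∧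
      a.deg - a.ord + (b.deg - b.ord) + (c.deg - c.ord) = d
    · have e1 : ∀ s ∈ Finset.range (a.ord + 1), (a.ord.choose s : ℂ) * fall b.deg s *
          (if b.col = c.row ∧ a.row = i ∧ c.col = j ∧
            a.deg + b.deg - s - ((a.ord + b.ord - s : ℕ) : ℤ) + (c.deg - c.ord) = d then
          fall x c.ord * fall (x + (c.deg - c.ord)) (a.ord + b.ord - s) else 0) =
          fall x c.ord * ((a.ord.choose s : ℂ) * fall b.deg s *
            fall (x + (c.deg - c.ord)) (a.ord + b.ord - s)) := by
        intro s hs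
        have : s ≤ a.ord := by simpa [Nat.lt_succ_iff] using hs
        rw [if_pos ⟨h2, hc.1, hc.2.1, by omega⟩]
        ring
      have e2 : ∀ s ∈ Finset.range (b.ord + 1), (b.ord.choose s : ℂ) * fall c.deg s *
          (if a.col = b.row ∧ a.row = i ∧ c.col = j ∧
            a.deg - a.ord + (b.deg + c.deg - s - ((b.ord + c.ord - s : ℕ) : ℤ)) = d then
          fall x (b.ord + c.ord - s) *
            fall (x + (((b.deg + c.deg - s : ℤ) : ℂ) - ((b.ord + c.ord - s : ℕ) : ℂ))) a.ord
          else 0) =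
          ((b.ord.choose s : ℂ) * fall c.deg s * fall x (b.ord + c.ord - s)) *
            fall (x + (c.deg - c.ord) + (b.deg - b.ord)) a.ord := by
        intro s hs
        have : s ≤ b.ord := by simpa [Nat.lt_succ_iff] using hs
        rw [if_pos ⟨h1, hc.1, hc.2.1, by omega⟩, Nat.cast_sub (by omega)]
        push_cast
        rw [show (x : ℂ) + (b.deg + c.deg - s - (b.ord + c.ord - s)) =
          x + (c.deg - c.ord) + (b.deg - b.ord) by ring]
        ring
      rw [Finset.sum_congr rfl e1, Finset.sum_congr rfl e2, ← Finset.mul_sum, ← Finset.sum_mul,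
        fall_leibniz, fall_leibniz]
      ring
    · rw [Finset.sum_eq_zero, Finset.sum_eq_zero]
      · intro s hs
        have : s ≤ b.ord := by simpa [Nat.lt_succ_iff] using hs
        rw [if_neg, mul_zero]
        rintro ⟨-, h3, h4, h5⟩
        exact hc ⟨h3, h4, by omega⟩
      · intro s hs
        have : s ≤ a.ord := by simpa [Nat.lt_succ_iff] using hs
        rw [if_neg, mul_zero]
        rintro ⟨-, h3, h4, h5⟩
        exact hc ⟨h3, h4, by omega⟩
  · simp only [map_sum, Finsupp.linearCombination_single, map_zero, h2, false_and, if_false,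
      smul_zero, Finset.sum_const_zero]
  · simp only [map_sum, Finsupp.linearCombination_single, map_zero, h1, false_and, if_false,
      smul_zero, Finset.sum_const_zero]
  · simp

theorem diffCoc_skew {n : ℕ} (a b : DiffIdx n) : diffCoc a b = -diffCoc b a := by
  rw [diffCoc_eq, diffCoc_eq]
  by_cases h : a.row = b.col ∧ a.col = b.row ∧ (a.ord : ℤ) + b.ord = a.deg + b.deg
  · rw [if_pos h, if_pos ⟨h.2.1.symm, h.1.symm, by omega⟩]
    have h1 := signedSum_add (a.deg - a.ord) (b.deg - b.ord)
      (fun x => fall x b.ord * fall (x - (a.deg - a.ord) : ℤ) a.ord)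
    rw [show (a.deg - a.ord) + (b.deg - b.ord) = 0 by omega, signedSum_zero] at h1
    have h2 : (fun x : ℤ => fall ((x + (a.deg - a.ord) : ℤ) : ℂ) b.ord *
        fall ((x + (a.deg - a.ord) - (a.deg - a.ord) : ℤ) : ℂ) a.ord) =
        (fun x : ℤ => fall x a.ord * fall (x - (b.deg - b.ord) : ℤ) b.ord) := by
      funext x
      rw [add_sub_cancel_right, show x + (a.deg - a.ord) = x - (b.deg - b.ord) by omega, mul_comm]
    rw [h2] at h1
    linear_combination -h1
  · rw [if_neg h, if_neg, neg_zero]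
    rintro ⟨h1, h2, h3⟩
    exact h ⟨h2.symm, h1.symm, by omega⟩

theorem diffCoc_mul {n : ℕ} (a b c : DiffIdx n) :
    bilin diffCoc (diffMul a b) (Finsupp.single c 1) =
      if a.col = b.row ∧ b.col = c.row ∧ c.col = a.row ∧
        a.deg - a.ord + (b.deg - b.ord) + (c.deg - c.ord) = 0 then
        signedSum (a.deg - a.ord + (b.deg - b.ord)) (fun x => fall x c.ord *
          (fall (x + (c.deg - c.ord) : ℤ) b.ord *
            fall (x + (c.deg - c.ord) + (b.deg - b.ord) : ℤ) a.ord))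
      else 0 := by
  rw [bilin_single_right]
  unfold diffMul
  split_ifs with h1 h2 h2
  · simp only [map_sum, Finsupp.linearCombination_single, diffCoc_eq, smul_eq_mul]
    have e1 : ∀ s ∈ Finset.range (a.ord + 1), (a.ord.choose s : ℂ) * fall b.deg s *
        (if a.row = c.col ∧ b.col = c.row ∧
          ((a.ord + b.ord - s : ℕ) : ℤ) + c.ord = a.deg + b.deg - s + c.deg then
          signedSum (a.deg + b.deg - s - ((a.ord + b.ord - s : ℕ) : ℤ)) (fun x => fall x c.ord *
            fall (x - (a.deg + b.deg - s - ((a.ord + b.ord - s : ℕ) : ℤ)) : ℤ)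
              (a.ord + b.ord - s)) else 0) =
        (a.ord.choose s : ℂ) * fall b.deg s *
          signedSum (a.deg - a.ord + (b.deg - b.ord)) (fun x => fall x c.ord *
            fall (x + (c.deg - c.ord) : ℤ) (a.ord + b.ord - s)) := by
      intro s hs
      have : s ≤ a.ord := by simpa [Nat.lt_succ_iff] using hs
      rw [if_pos ⟨h2.2.2.1.symm, h2.2.1, by omega⟩,
        show a.deg + b.deg - s - ((a.ord + b.ord - s : ℕ) : ℤ) =
          a.deg - a.ord + (b.deg - b.ord) by omega]
      congr 2
      funext x
      rw [show x - (a.deg - a.ord + (b.deg - b.ord)) = x + (c.deg - c.ord) by omega]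
    rw [Finset.sum_congr rfl e1, signedSum_sum]
    congr 1
    funext x
    have := fall_leibniz (x + (c.deg - c.ord) : ℤ) b.deg a.ord b.ord
    push_cast at this ⊢
    rw [← this, Finset.mul_sum]
    exact Finset.sum_congr rfl fun s _ => by ring
  · simp only [map_sum, Finsupp.linearCombination_single, diffCoc_eq, smul_eq_mul]
    refine Finset.sum_eq_zero fun s hs => ?_
    have : s ≤ a.ord := by simpa [Nat.lt_succ_iff] using hs
    rw [if_neg, mul_zero]
    rintro ⟨h3, h4, h5⟩
    exact h2 ⟨h1, h4, h3.symm, by omega⟩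
  · exact absurd h2.1 h1
  · simp

/-- The data of the central extension of the algebra of `n × n` matrices of differential operators
on the circle. -/
def diffMatrix (n : ℕ) : CyclicAlgebra (DiffIdx n) where
  mul := diffMul
  coc := diffCoc
  assoc := diffMul_assoc
  skew := diffCoc_skew
  cyclic a b c := by
    rw [diffCoc_mul, diffCoc_mul, diffCoc_mul]
    by_cases h : a.col = b.row ∧ b.col = c.row ∧ c.col = a.row ∧
        a.deg - a.ord + (b.deg - b.ord) + (c.deg - c.ord) = 0
    · obtain ⟨h1, h2, h3, h4⟩ := h
      rw [if_pos ⟨h1, h2, h3, h4⟩, if_pos ⟨h2, h3, h1, by omega⟩, if_pos ⟨h3, h1, h2, by omega⟩]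
      set α := a.deg - a.ord
      set β := b.deg - b.ord
      set γ := c.deg - c.ord
      set g : ℤ → ℂ := fun x => fall x c.ord *
        (fall (x + γ : ℤ) b.ord * fall (x + γ + β : ℤ) a.ord) with hg
      have e2 : (fun x : ℤ => fall x a.ord *
          (fall (x + α : ℤ) c.ord * fall (x + α + γ : ℤ) b.ord)) = fun x => g (x + α) := by
        funext x
        rw [hg]
        simp only
        rw [show x + α + γ + β = x by omega]
        ring
      have e3 : (fun x : ℤ => fall x b.ord *
          (fall (x + β : ℤ) a.ord * fall (x + β + α : ℤ) c.ord)) = fun x => g (x + (α + β)) := by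
        funext x
        rw [hg]
        simp only
        rw [show x + (α + β) + γ = x by omega, show x + (α + β) = x + β + α by ring]
        ring
      have s1 := signedSum_add α (β + γ) g
      have s2 := signedSum_add (α + β) (γ + α) g
      rw [show α + (β + γ) = 0 by omega, signedSum_zero] at s1
      rw [show α + β + (γ + α) = α by omega] at s2
      rw [e2, e3]
      linear_combination -s1 - s2
    · rw [if_neg h, if_neg, if_neg]
      · simp
      · rintro ⟨h1, h2, h3, h4⟩
        exact h ⟨h2, h3, h1, by omega⟩
      · rintro ⟨h1, h2, h3, h4⟩
        exact h ⟨h3, h1, h2, by omega⟩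

/-- The Lie algebra of `n × n` matrices of differential operators on the circle, centrally extended
by `κ`. -/
abbrev GlHat (n : ℕ) : Type := (diffMatrix n).Ext

theorem bilin_mem {I P : Type*} [AddCommGroup P] [Module ℂ P] (f : I → I → P) (S : Set I)
    (N : Submodule ℂ P) (h : ∀ a ∈ S, ∀ b ∈ S, f a b ∈ N) (u v : I →₀ ℂ)
    (hu : u ∈ Finsupp.supported ℂ ℂ S) (hv : v ∈ Finsupp.supported ℂ ℂ S) : bilin f u v ∈ N := by
  rw [Finsupp.mem_supported] at hu hv
  rw [bilin, Finsupp.linearCombination_apply, Finsupp.sum, LinearMap.sum_apply]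
  refine N.sum_mem fun a ha => ?_
  rw [LinearMap.smul_apply, Finsupp.linearCombination_apply, Finsupp.sum]
  exact N.smul_mem _ (N.sum_mem fun b hb => N.smul_mem _ (h a (hu ha) b (hv hb)))

theorem diffMul_mem {n : ℕ} (ℓ : Fin n → ℕ) (a b : DiffIdx n) (hb : ℓ b.col ≤ b.ord) :
    diffMul a b ∈ Finsupp.supported ℂ ℂ {a : DiffIdx n | ℓ a.col ≤ a.ord} := by
  unfold diffMul
  split_ifs with h
  · refine Submodule.sum_mem _ fun s hs => Finsupp.single_mem_supported _ _ ?_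
    have : s ≤ a.ord := by simpa [Nat.lt_succ_iff] using hs
    simp only [Set.mem_ofPred_eq]
    omega
  · exact Submodule.zero_mem _

/-- The Lie subalgebra `∑_{i,j} 𝔸 ∂_t^{ℓ_j} E_{i,j} + ℂ κ`: it consists of the elements in whose
expansion `t^m ∂_t^r E_{i,j}` occurs only for `r ≥ ℓ_j`. -/
def GlSub {n : ℕ} (ℓ : Fin n → ℕ) : LieSubalgebra ℂ (GlHat n) where
  carrier := {x | x.1 ∈ Finsupp.supported ℂ ℂ {a : DiffIdx n | ℓ a.col ≤ a.ord}}
  zero_mem' := (Finsupp.supported ℂ ℂ {a : DiffIdx n | ℓ a.col ≤ a.ord}).zero_mem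
  add_mem' hx hy :=
    (Finsupp.supported ℂ ℂ {a : DiffIdx n | ℓ a.col ≤ a.ord}).add_mem hx hy
  smul_mem' c _ hx :=
    (Finsupp.supported ℂ ℂ {a : DiffIdx n | ℓ a.col ≤ a.ord}).smul_mem c hx
  lie_mem' hx hy := Submodule.sub_mem _
    (bilin_mem _ _ _ (fun a _ b hb => diffMul_mem ℓ a b hb) _ _ hx hy)
    (bilin_mem _ _ _ (fun a _ b hb => diffMul_mem ℓ a b hb) _ _ hy hx)

/-- The element `t^m ∂_t^{ℓ_j + s} E_{i,j}`. -/
def diffE {n : ℕ} (ℓ : Fin n → ℕ) (i j : Fin n) (m : ℤ) (s : ℕ) : GlSub ℓ :=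
  ⟨(diffMatrix n).basisVec ⟨i, j, m, ℓ j + s⟩, by
    change Finsupp.single (⟨i, j, m, ℓ j + s⟩ : DiffIdx n) (1 : ℂ) ∈
      Finsupp.supported ℂ ℂ {a : DiffIdx n | ℓ a.col ≤ a.ord}
    exact Finsupp.single_mem_supported ℂ 1 (Nat.le_add_right (ℓ j) s)⟩

/-- The central element `κ`. -/
def kappa {n : ℕ} (ℓ : Fin n → ℕ) : GlSub ℓ :=
  ⟨(diffMatrix n).central, by
    change (0 : DiffIdx n →₀ ℂ) ∈ Finsupp.supported ℂ ℂ {a : DiffIdx n | ℓ a.col ≤ a.ord}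
    exact Submodule.zero_mem _⟩

/-! ### The vacuum module -/

/-- The universal enveloping algebra of `GlSub ℓ`. -/
abbrev UGl {n : ℕ} (ℓ : Fin n → ℕ) : Type := UniversalEnvelopingAlgebra ℂ (GlSub ℓ)

/-- The left ideal generated by the `t^m ∂_t^r E_{i,j}` with `m ≥ 0` and by `κ - χ`. -/
def vacuumIdeal {n : ℕ} (ℓ : Fin n → ℕ) (χ : ℂ) : Submodule (UGl ℓ) (UGl ℓ) :=
  Submodule.span (UGl ℓ)
    ({u | ∃ (i j : Fin n) (m s : ℕ), u = UniversalEnvelopingAlgebra.ι ℂ (diffE ℓ i j m s)} ∪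
      {UniversalEnvelopingAlgebra.ι ℂ (kappa ℓ) - algebraMap ℂ (UGl ℓ) χ})

/-- The vacuum module of level `χ`, i.e. the module induced from the one-dimensional module of the
subalgebra spanned by `κ` and the `t^m ∂_t^r E_{i,j}` with `m ≥ 0` on which `κ` acts as `χ` and the
`t^m ∂_t^r E_{i,j}` act as zero. -/
abbrev Vacuum {n : ℕ} (ℓ : Fin n → ℕ) (χ : ℂ) : Type := UGl ℓ ⧸ vacuumIdeal ℓ χ

/-- The vacuum vector. -/
def vac {n : ℕ} (ℓ : Fin n → ℕ) (χ : ℂ) : Vacuum ℓ χ := Submodule.Quotient.mk 1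

/-- The action of the Lie algebra on the vacuum module. -/
def act {n : ℕ} {ℓ : Fin n → ℕ} {χ : ℂ} (x : GlSub ℓ) (v : Vacuum ℓ χ) : Vacuum ℓ χ :=
  UniversalEnvelopingAlgebra.ι ℂ x • v

/-! ### Vertex algebras and their modules -/

/-- Locality `(z₁ - z₂)^m a(z₁) b(z₂) = (z₁ - z₂)^m b(z₂) a(z₁)` for some positive `m`, where `a p`
is the coefficient of `z^p` in `a(z)`. -/
def IsLocal {W : Type*} [AddCommGroup W] [Module ℂ W] (a b : ℤ → W →ₗ[ℂ] W) : Prop :=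
  ∃ m : ℕ, 0 < m ∧ ∀ (p q : ℤ) (w : W),
    ∑ k ∈ Finset.range (m + 1), ((-1 : ℤ) ^ k * (m.choose k : ℤ)) • a (p - (m - k)) (b (q - k) w) =
    ∑ k ∈ Finset.range (m + 1), ((-1 : ℤ) ^ k * (m.choose k : ℤ)) • b (q - k) (a (p - (m - k)) w)

/-- `(V, Y(·, z), ∂, |0⟩)` is a vertex algebra.  Here `HVertexOperator ℤ ℂ V V` is the space of
linear maps from `V` to the formal Laurent series with coefficients in `V`, and `(Y v).coeff p` is
the coefficient of `z^p` in `Y(v, z)`. -/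
structure IsVertexAlgebra {V : Type*} [AddCommGroup V] [Module ℂ V]
    (Y : V →ₗ[ℂ] HVertexOperator ℤ ℂ V V) (T : V →ₗ[ℂ] V) (one : V) : Prop where
  /-- `Y(|0⟩, z) = Id` -/
  vacuum : ∀ (p : ℤ) (w : V), (Y one).coeff p w = if p = 0 then w else 0
  /-- `[∂, Y(v, z)] = d/dz Y(v, z)` -/
  translation : ∀ (v : V) (p : ℤ) (w : V),
    T ((Y v).coeff p w) - (Y v).coeff p (T w) = (p + 1) • (Y v).coeff (p + 1) w
  /-- `Y(v, z)|0⟩ = e^{z∂} v`, nonnegative powers of `z` -/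
  creation : ∀ (v : V) (p : ℕ), (Y v).coeff p one = ((p.factorial : ℂ)⁻¹) • (T ^ p) v
  /-- `Y(v, z)|0⟩ = e^{z∂} v`, negative powers of `z` -/
  creation_neg : ∀ (v : V) (p : ℤ), p < 0 → (Y v).coeff p one = 0
  locality : ∀ u v : V, IsLocal (Y u).coeff (Y v).coeff

/-- `(W, Y_W(·, z))` is a module of the vertex algebra `(V, Y(·, z), ∂, |0⟩)`. -/
structure IsVertexModule {V : Type*} [AddCommGroup V] [Module ℂ V]
    (Y : V →ₗ[ℂ] HVertexOperator ℤ ℂ V V) (T : V →ₗ[ℂ] V) (one : V)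
    {W : Type*} [AddCommGroup W] [Module ℂ W] (YW : V →ₗ[ℂ] HVertexOperator ℤ ℂ W W) :
    Prop where
  /-- `Y_W(|0⟩, z) = Id` -/
  vacuum : ∀ (p : ℤ) (w : W), (YW one).coeff p w = if p = 0 then w else 0
  /-- `Y_W(∂v, z) = d/dz Y_W(v, z)` -/
  translation : ∀ (v : V) (p : ℤ) (w : W),
    (YW (T v)).coeff p w = (p + 1) • (YW v).coeff (p + 1) w
  locality : ∀ u v : V, IsLocal (YW u).coeff (YW v).coeff
  /-- `(z₀ + z₂)^m Y_W(u, z₀ + z₂) Y_W(v, z₂) w = (z₂ + z₀)^m Y_W(Y(u, z₀)v, z₂) w`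
  for some positive `m`, binomials being expanded in nonnegative powers of the second variable;
  the identity compares the coefficients of `z₀^p z₂^q` -/
  associativity : ∀ (u v : V) (w : W), ∃ m : ℕ, 0 < m ∧ ∀ p q : ℤ,
    ∑ᶠ k : ℕ, (Ring.choose (p + k) k) • (YW u).coeff (p + k - m) ((YW v).coeff (q - k) w) =
    ∑ k ∈ Finset.range (m + 1),
      (m.choose k) • (YW ((Y u).coeff (p - k) v)).coeff (q - (m - k)) w

/-- A module of a vertex algebra is irreducible: it is nonzero, and its only submodules (subspaces
preserved by all coefficients of all `Y_W(v, z)`) are zero and the whole module. -/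
def IsIrreducibleVertexModule {V W : Type*} [AddCommGroup V] [Module ℂ V] [AddCommGroup W]
    [Module ℂ W] (YW : V →ₗ[ℂ] HVertexOperator ℤ ℂ W W) : Prop :=
  Nontrivial W ∧ ∀ N : Submodule ℂ W,
    (∀ (v : V) (p : ℤ), ∀ w ∈ N, (YW v).coeff p w ∈ N) → N = ⊥ ∨ N = ⊤

/-! ### Normally ordered products and the structure maps -/

/-- The series `(1/m!) d^m/dz^m a(z)`; `a p` is the coefficient of `z^p` in `a(z)`. -/
def dividedDeriv {W : Type*} [AddCommGroup W] (m : ℕ) (a : ℤ → W → W) : ℤ → W → W :=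
  fun p w => (Ring.choose (p + m) m) • a (p + m) w

/-- The normally ordered product `a(z)^- b(z) + b(z) a(z)^+`, where `a(z)^-` and `a(z)^+` are the
parts of `a(z)` with nonnegative and with negative powers of `z`.  The sums are finite if `a(z)w`
and `b(z)w` have finitely many negative powers of `z` for every `w`. -/
def normalOrder {W : Type*} [AddCommGroup W] [Module ℂ W] (a : ℤ → W → W) (b : ℤ → W →ₗ[ℂ] W) :
    ℤ → W → W :=
  fun p w => (∑ᶠ k : ℕ, a k (b (p - k) w)) + ∑ᶠ k : ℕ, b (p + k + 1) (a (-k - 1) w)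

/-- The linear maps `𝒱 → LM(W, W[z⁻¹, z]])` with `Y(|0⟩, z) = Id` and
`Y(uv, z) = Y^-(u, z) Y(v, z) + Y(v, z) Y^+(u, z)` for `u = t^{-m-1} ∂_t^r E_{i,j}`, `m ≥ 0`,
`r = ℓ_j + s`, where `Y^±(u, z) = (1/m!) d^m/dz^m E_{i,j}(r, z)^±` is formed from a given family
`E i j s` of series `E_{i,j}(r, z)`. -/
def IsInductiveMap {n : ℕ} {ℓ : Fin n → ℕ} {χ : ℂ} {W : Type*} [AddCommGroup W] [Module ℂ W]
    (E : Fin n → Fin n → ℕ → ℤ → W → W) (Y : Vacuum ℓ χ →ₗ[ℂ] HVertexOperator ℤ ℂ W W) : Prop :=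
  (∀ (p : ℤ) (w : W), (Y (vac ℓ χ)).coeff p w = if p = 0 then w else 0) ∧
  ∀ (i j : Fin n) (s m : ℕ) (v : Vacuum ℓ χ) (p : ℤ) (w : W),
    (Y (act (diffE ℓ i j (-m - 1) s) v)).coeff p w =
      normalOrder (dividedDeriv m (E i j s)) (Y v).coeff p w

/-- The series `E_{i,j}(r, z) = ∑_l t^l ∂_t^r E_{i,j} z^{-l-1}`, `r = ℓ_j + s`, acting on the vacuum
module. -/
def vacuumField {n : ℕ} (ℓ : Fin n → ℕ) (χ : ℂ) (i j : Fin n) (s : ℕ) :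
    ℤ → Vacuum ℓ χ → Vacuum ℓ χ :=
  fun p v => act (diffE ℓ i j (-p - 1) s) v

/-- The operator `∂` on the vacuum module: `∂|0⟩ = 0`, and `∂` is a derivation with respect to
`∂(t^{-m-1} ∂_t^r E_{i,j}) = (m+1) t^{-m-2} ∂_t^r E_{i,j}`, `m ≥ 0`. -/
def IsTranslation {n : ℕ} {ℓ : Fin n → ℕ} {χ : ℂ} (T : Vacuum ℓ χ →ₗ[ℂ] Vacuum ℓ χ) : Prop :=
  T (vac ℓ χ) = 0 ∧
  ∀ (i j : Fin n) (m s : ℕ) (v : Vacuum ℓ χ),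
    T (act (diffE ℓ i j (-m - 1) s) v) =
      (m + 1) • act (diffE ℓ i j (-m - 2) s) v + act (diffE ℓ i j (-m - 1) s) (T v)

/-! ### Weighted modules of the Lie algebra of infinite matrices -/

section Modules

variable (M : Type*) [AddCommGroup M] [Module ℂ M] [LieRingModule GlInf M] [LieModule ℂ GlInf M]

/-- The toral Cartan subalgebra spanned by `κ₀` and the `E_{l,-l}`, `l ∈ ℤ + 1/2`. -/
def cartan : Submodule ℂ GlInf :=
  Submodule.span ℂ (Set.range (fun p : ℤ => matE p (-p - 1)) ∪ {kappa0})

/-- The weight space of a linear function on the toral Cartan subalgebra. -/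
def weightSpace (ν : Module.Dual ℂ cartan) : Submodule ℂ M where
  carrier := {w | ∀ h : cartan, ⁅(h : GlInf), w⁆ = ν h • w}
  zero_mem' h := by simp
  add_mem' hx hy h := by rw [lie_add, hx h, hy h, smul_add]
  smul_mem' c x hx h := by rw [lie_smul, hx h, smul_comm]

open scoped Classical in
/-- The module is the direct sum of its weight spaces. -/
def IsWeighted : Prop := DirectSum.IsInternal (fun ν => weightSpace M ν)

/-- The subspace spanned by the `E_{l₁,-l₂}` and `E_{-l₁,l₂}` with `l₁, l₂ ∈ ℤ + 1/2`,
`l₁, l₂ > m`. -/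
def glOuter (m : ℕ) : Submodule ℂ GlInf :=
  Submodule.span ℂ {x | ∃ p q : ℤ, (m : ℤ) ≤ p ∧ (m : ℤ) ≤ q ∧
    (x = matE p (-q - 1) ∨ x = matE (-p - 1) q)}

/-- The module is generated by a subspace annihilated by `glOuter m` for some `m`. -/
def IsFinitelyPlaced : Prop :=
  ∃ (m : ℕ) (M₀ : Submodule ℂ M), LieSubmodule.lieSpan ℂ GlInf (M₀ : Set M) = ⊤ ∧
    ∀ x ∈ glOuter m, ∀ w ∈ M₀, ⁅x, w⁆ = 0

end Modules

/-- The basis vector `E_{ln+i-1/2, kn-j+1/2}` with `i`, `j` counted from `1`; since elements of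
`Fin n` count from `0`, this is `E_{ln+i+1/2, kn-j-1/2}` in terms of elements of `Fin n`. -/
def blockE {n : ℕ} (i j : Fin n) (l k : ℤ) : GlInf :=
  matE (l * n + (i : ℕ)) (k * n - (j : ℕ) - 1)

/-- `r! ℑ_{0,r}`, where `∑_r ℑ_{0,r} y^r z^{-r-1} = -y⁻¹ ((1 + y/z)^ι - 1)`; thus
`ℑ_{0,r} = -(ι choose r+1)`. -/
def anomaly (ι : ℂ) (r : ℕ) : ℂ := -(fall ι (r + 1) / (r + 1))

section Fields

variable {M : Type*} [AddCommGroup M] [LieRingModule GlInf M]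

/-- The coefficient of `z^p` in `∑_{l,k ∈ ℤ} ⟨ι-k⟩_r E_{ln+i-1/2,kn-j+1/2} z^{-l-k-r-1} +
r! ℑ_{0,r} δ_{i,j} κ₀ z^{-r-1}`, applied to `w`. -/
def fieldGeneric [Module ℂ M] {n : ℕ} (ι : ℂ) (i j : Fin n) (r : ℕ) (p : ℤ) (w : M) : M :=
  (∑ᶠ x : ℤ × ℤ, if -x.1 - x.2 - r - 1 = p then
    fall (ι - x.2) r • ⁅blockE i j x.1 x.2, w⁆ else 0) +
  if i = j ∧ p = -r - 1 then anomaly ι r • ⁅kappa0, w⁆ else 0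

/-- The coefficient of `z^p`, applied to `w`, in the series
`∑_{l,k ≥ 0} [⟨-k-1⟩_r E_{(l-ι)n+i-1/2,(k+ι+1)n-j+1/2} z^{-l-k-ℓ_i-r-2}
+ ⟨k+ℓ_j⟩_r E_{(l-ι)n+i-1/2,(ι-k)n-j+1/2} z^{-l+k+ℓ_j-ℓ_i-r-1}
+ ⟨k+ℓ_j⟩_r E_{-(l+ι+1)n+i-1/2,(ι-k)n-j+1/2} z^{l+k+ℓ_j-r}
+ ⟨-k-1⟩_r E_{-(l+ι+1)n+i-1/2,(k+ι+1)n-j+1/2} z^{l-k-r-1}] + δ_{i,j} c κ₀ z^{-r-1}`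
for an integer `ι`, with `c = -⟨ι+ℓ_i⟩_{r+1}/(r+1)` if `ι > 0` and `c = -⟨ι⟩_{r+1}/(r+1)` if
`ι ≤ 0`. -/
def fieldInteger [Module ℂ M] {n : ℕ} (ℓ : Fin n → ℕ) (ι : ℤ) (i j : Fin n) (r : ℕ) (p : ℤ)
    (w : M) : M :=
  (∑ᶠ x : ℕ × ℕ, if -(x.1 : ℤ) - x.2 - ℓ i - r - 2 = p then
    fall (-x.2 - 1) r • ⁅blockE i j (x.1 - ι) (x.2 + ι + 1), w⁆ else 0) +
  (∑ᶠ x : ℕ × ℕ, if -(x.1 : ℤ) + x.2 + ℓ j - ℓ i - r - 1 = p then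
    fall (x.2 + ℓ j) r • ⁅blockE i j (x.1 - ι) (ι - x.2), w⁆ else 0) +
  (∑ᶠ x : ℕ × ℕ, if (x.1 : ℤ) + x.2 + ℓ j - r = p then
    fall (x.2 + ℓ j) r • ⁅blockE i j (-(x.1 + ι + 1)) (ι - x.2), w⁆ else 0) +
  (∑ᶠ x : ℕ × ℕ, if (x.1 : ℤ) - x.2 - r - 1 = p then
    fall (-x.2 - 1) r • ⁅blockE i j (-(x.1 + ι + 1)) (x.2 + ι + 1), w⁆ else 0) +
  if i = j ∧ p = -r - 1 then
    (if 0 < ι then anomaly (ι + ℓ i) r else anomaly ι r) • ⁅kappa0, w⁆ else 0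

open scoped Classical in
/-- The series `E^ι_{i,j}(r, z)` on `M`, where `r = ℓ_j + s`. -/
def moduleField (M : Type*) [AddCommGroup M] [LieRingModule GlInf M] [Module ℂ M] {n : ℕ}
    (ℓ : Fin n → ℕ) (ι : ℂ) (i j : Fin n) (s : ℕ) : ℤ → M → M :=
  fun p w => if h : ∃ a : ℤ, (a : ℂ) = ι then fieldInteger ℓ h.choose i j (ℓ j + s) p w
    else fieldGeneric ι i j (ℓ j + s) p w

end Fields

end

/-!
The idea is to work with fields, i.e. families of endomorphisms `c p` of a space `W` such that
`∑ c p z^p w` is a Laurent series for every `w`, and with their products `a_(k) c`, `k ∈ ℤ`.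

**State-field correspondence.** Let a representation of the Lie algebra on `W` be given whose generating
series `E_{i,j}(r, z)` are fields. The operators of taking products `c ↦ E_{i,j}(r, z)_(m) c` satisfy
the same commutation relations as the modes `t^m ∂_t^r E_{i,j}` themselves (`Fld.nprod_comm`,
`IsRestricted.isRep_nprod`), so the space of all fields is again a representation, in which the
field `1` is a vacuum vector. The universal property of the induced module yields a linear map
from the vacuum module to the fields (`exists_fieldMap`). Since `a_(-m-1) c` is the normally ordered
product of the divided derivative of `a` with `c` (`Fld.normalOrder_dividedDeriv`), this map is the one
described by the recursion; uniqueness holds because the vacuum vector generates the vacuum module by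
the negative modes (`vacuum_eq_top`). For the vacuum module itself this gives `Y`. The operator `∂` comes
from the derivation `[∂_t, ·]` of the Lie algebra, again by the universal property.

**Vertex algebra and module.** The generating fields are mutually local because of the shape of the
commutation relations, and Dong's lemma (`Fld.Local.nprod`) propagates locality to all fields of the
image. The map to the fields on `W` sends the products of `Y` to the products of fields
(`IsFieldMap.mode`); together with the formal identity `Fld.assoc_relation` this is associativity.

**The representation on `M`.** A differential operator acts on the vectors `t^(ι + x) e_j` by a band
matrix. For an integer `ι` the vectors annihilated by `∂_t^{ℓ_j}` have to be divided out. After a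
numbering of the remaining vectors by the integers (a `Labelling`) differential operators become
infinite band matrices; these act on `M`, because the far away matrix units annihilate any given
vector (`IsFinitelyPlaced.unitOp_eq_zero`). The cocycle of infinite matrices pulls back to the cocycle of
differential operators up to a coboundary: its values are sums of differences of the polynomial
`primitive`, which telescope (`Labelling.sum_matrix_cocycle`), and the coboundary is compensated by the
scalar terms of the series `E^ι_{i,j}(r, z)` (`Labelling.isRep_op`).

**Irreducibility.** On a given vector only finitely many matrix units of an operator
`t^(m+s) ∂_t^(ℓ_j+s) E_{i,j}` contribute, and their coefficients are falling factorials at different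
points. By interpolation a subspace preserved by these operators for all `s` is preserved by each matrix
unit (`Labelling.unitOp_mem`), hence it is a submodule of the irreducible module `M`.
-/

noncomputable section

open Finset

section Fields

/-! ### Binomial coefficients and signs -/

theorem choose_mul_choose_comm (m : ℤ) (i j : ℕ) :
    Ring.choose m i * Ring.choose (m - i) j = Ring.choose m j * Ring.choose (m - j) i := by
  have h1 := Ring.choose_smul_choose m (Nat.le_add_right i j)
  have h2 := Ring.choose_smul_choose m (Nat.le_add_left j i)
  rw [Nat.add_sub_cancel_left] at h1
  rw [Nat.add_sub_cancel] at h2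
  rw [← h1, ← h2, Nat.choose_symm_add]

theorem choose_mul_natChoose (m : ℤ) (i j : ℕ) :
    Ring.choose m (i + j) * Ring.choose ((i + j : ℕ) : ℤ) j =
      Ring.choose m j * Ring.choose (m - j) i := by
  have h2 := Ring.choose_smul_choose m (Nat.le_add_left j i)
  rw [Nat.add_sub_cancel] at h2
  rw [← h2, Ring.choose_natCast, nsmul_eq_mul, mul_comm]

/-- Vandermonde's identity for integers. -/
theorem choose_vandermonde (m n : ℤ) (q : ℕ) :
    ∑ x ∈ antidiagonal q, Ring.choose m x.1 * Ring.choose n x.2 = Ring.choose (m + n) q :=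
  (Ring.add_choose_eq q (Commute.all m n)).symm

/-- A weight `f` of order `j` describes a dependence on two mode numbers `m`, `n` which is
compatible with the re-expansion of modes around a second point. -/
structure IsModeWeight (f : ℤ → ℤ → ℤ) (j : ℕ) : Prop where
  left : ∀ (m n : ℤ) (q : ℕ), ∑ x ∈ antidiagonal q,
    Ring.choose m x.1 * Ring.choose n x.2 * f (m - x.1) (n - x.2) =
      f m n * Ring.choose (m + n - j) q
  right : ∀ (m n : ℤ) (q : ℕ), ∑ x ∈ antidiagonal (q + j),
    Ring.choose m x.1 * Ring.choose n x.2 * f x.1 x.2 = f m n * Ring.choose (m + n - j) q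
  small : ∀ i i' : ℕ, i + i' < j → f i i' = 0

theorem sum_antidiagonal_add {A : Type*} [AddCommMonoid A] (q j : ℕ) (f : ℕ × ℕ → A)
    (h : ∀ x, x.1 < j → f x = 0) :
    ∑ x ∈ antidiagonal (q + j), f x = ∑ x ∈ antidiagonal q, f (x.1 + j, x.2) := by
  symm
  refine Finset.sum_of_injOn (fun x : ℕ × ℕ => (x.1 + j, x.2)) ?_ ?_ ?_ ?_
  · rintro ⟨a, b⟩ - ⟨c, d⟩ - h
    simpa using h
  · rintro ⟨a, b⟩ h
    simp only [mem_coe, HasAntidiagonal.mem_antidiagonal] at h ⊢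
    omega
  · rintro ⟨a, b⟩ h1 h2
    refine h _ ?_
    by_contra h3
    refine h2 ⟨(a - j, b), ?_, ?_⟩
    · simp at h1 h3 ⊢; omega
    · simp at h3 ⊢; omega
  · intro x _; rfl

theorem isModeWeight_choose (j : ℕ) : IsModeWeight (fun m _ => Ring.choose m j) j where
  left m n q := by
    rw [show m + n - (j : ℤ) = (m - j) + n by ring, ← choose_vandermonde, mul_sum]
    refine sum_congr rfl fun x _ => ?_
    linear_combination Ring.choose n x.2 * choose_mul_choose_comm m x.1 j
  right m n q := by
    rw [show m + n - (j : ℤ) = (m - j) + n by ring, ← choose_vandermonde, mul_sum,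
      sum_antidiagonal_add]
    · refine sum_congr rfl fun x _ => ?_
      linear_combination Ring.choose n x.2 * choose_mul_natChoose m x.1 j
    · intro x hx
      simp [Ring.choose_natCast, Nat.choose_eq_zero_of_lt hx]
  small i i' h := by
    simp [Ring.choose_natCast, Nat.choose_eq_zero_of_lt (show i < j by omega)]

theorem IsModeWeight.swap {f : ℤ → ℤ → ℤ} {j : ℕ} (h : IsModeWeight f j) :
    IsModeWeight (fun m n => f n m) j where
  left m n q := by
    rw [add_comm m n, ← h.left n m q, ← Nat.sum_antidiagonal_swap]
    exact sum_congr rfl fun x _ => by simp only [Prod.fst_swap, Prod.snd_swap]; ring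
  right m n q := by
    rw [add_comm m n, ← h.right n m q, ← Nat.sum_antidiagonal_swap]
    exact sum_congr rfl fun x _ => by simp only [Prod.fst_swap, Prod.snd_swap]; ring
  small i i' hi := h.small i' i (by omega)

/-- The sign `(-1)^k` for an integer `k`, with values in `ℤ` so that it multiplies `Ring.choose`. -/
def sgn (k : ℤ) : ℤ := (k.negOnePow : ℤ)

theorem sgn_add (k l : ℤ) : sgn (k + l) = sgn k * sgn l := by simp [sgn, Int.negOnePow_add]

theorem sgn_mul_self (k : ℤ) : sgn k * sgn k = 1 := by
  rw [← sgn_add, sgn, Int.negOnePow_even _ ⟨k, rfl⟩]; rfl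

theorem sgn_natCast (k : ℕ) : sgn k = (-1) ^ k := by
  induction k with
  | zero => simp [sgn]
  | succ k ih => rw [Nat.cast_succ, sgn_add, ih, pow_succ]; rfl

theorem sgn_add_natCast (k : ℤ) (j : ℕ) : sgn (k + j) = sgn (k - j) := by
  rw [show k + (j : ℤ) = (k - j) + (j + j) by ring, sgn_add, sgn_add, sgn_mul_self, mul_one]

theorem sgn_sub_one (k : ℤ) : sgn (k - 1) = -sgn k := by
  simp [sgn, Int.negOnePow_sub]

/-! ### Sums of locally finite families of endomorphisms -/

variable {W : Type*} [AddCommGroup W] [Module ℂ W]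

/-- The sum of a family of endomorphisms of which only finitely many act nontrivially on any given
vector. -/
def locSum {α : Type*} (f : α → Module.End ℂ W) (hf : ∀ w, {x | f x w ≠ 0}.Finite) :
    Module.End ℂ W where
  toFun w := ∑ᶠ x, f x w
  map_add' u v := by
    simp only [map_add]
    exact finsum_add_distrib (hf u) (hf v)
  map_smul' c v := by
    simp only [map_smul, RingHom.id_apply]
    exact (smul_finsum' c (hf v)).symm

theorem locSum_apply {α : Type*} (f : α → Module.End ℂ W) (hf) (w : W) :
    locSum f hf w = ∑ᶠ x, f x w := rfl

theorem locSum_eq_sum {α : Type*} (f : α → Module.End ℂ W) (hf) (w : W) (s : Finset α)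
    (hs : ∀ x ∉ s, f x w = 0) : locSum f hf w = ∑ x ∈ s, f x w :=
  finsum_eq_sum_of_support_subset _ fun x hx => by_contra fun h => hx (hs x h)

omit [Module ℂ W] in
theorem finite_of_eventually {f : ℕ → W} (h : ∃ N, ∀ i ≥ N, f i = 0) : {x | f x ≠ 0}.Finite := by
  obtain ⟨N, hN⟩ := h
  exact (Set.finite_lt_nat N).subset fun i hi => by
    by_contra h
    exact hi (hN i (not_lt.mp h))

/-- A double sum over a rectangle, regrouped along the antidiagonals; `Q` only has to be large
enough to cover the rectangle. -/
theorem sum_range_prod_eq_antidiagonal {A : Type*} [AddCommMonoid A] (f : ℕ → ℕ → A) (N N' Q : ℕ)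
    (h : ∀ i i', N ≤ i ∨ N' ≤ i' → f i i' = 0) (hQ : N + N' ≤ Q) :
    ∑ i ∈ range N, ∑ i' ∈ range N', f i i' = ∑ q ∈ range Q, ∑ x ∈ antidiagonal q, f x.1 x.2 := by
  rw [← sum_product', sum_sigma']
  refine sum_of_injOn (fun x : ℕ × ℕ => (⟨x.1 + x.2, x⟩ : Σ _ : ℕ, ℕ × ℕ)) ?_ ?_ ?_ ?_
  · intro x _ y _ h
    simpa using congrArg Sigma.snd h
  · rintro ⟨a, b⟩ h
    simp only [mem_coe, mem_product, mem_range, mem_sigma, HasAntidiagonal.mem_antidiagonal,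
      and_true] at h ⊢
    omega
  · rintro ⟨q, a, b⟩ h1 h2
    refine h _ _ ?_
    by_contra h3
    simp only at h3
    refine h2 ⟨(a, b), ?_, ?_⟩
    · simp only [mem_coe, mem_product, mem_range]
      omega
    · simp only [mem_sigma, HasAntidiagonal.mem_antidiagonal] at h1
      simp only [h1.2]
  · intro x _; rfl

/-! ### Fields and their products -/

variable (W) in
/-- The space of fields on `W`: families `c` of endomorphisms, `c p` being the coefficient of `z^p`,
such that `c(z) w` is a Laurent series for every `w`. -/
def fieldSubmodule : Submodule ℂ (ℤ → Module.End ℂ W) where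
  carrier := {c | ∀ w, ∃ N : ℤ, ∀ p < N, c p w = 0}
  zero_mem' w := ⟨0, fun _ _ => rfl⟩
  add_mem' {a b} ha hb w := by
    obtain ⟨N, hN⟩ := ha w
    obtain ⟨N', hN'⟩ := hb w
    refine ⟨min N N', fun p hp => ?_⟩
    rw [Pi.add_apply, LinearMap.add_apply, hN p (by omega), hN' p (by omega), add_zero]
  smul_mem' r a ha w := by
    obtain ⟨N, hN⟩ := ha w
    exact ⟨N, fun p hp => by rw [Pi.smul_apply, LinearMap.smul_apply, hN p hp, smul_zero]⟩

variable (W) in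
/-- The type of fields on `W`. -/
abbrev Fld : Type _ := fieldSubmodule W

instance : FunLike (Fld W) ℤ (Module.End ℂ W) := ⟨Subtype.val, Subtype.val_injective⟩

namespace Fld

/-- The field with given coefficients. -/
def ofCoeff (c : ℤ → Module.End ℂ W) (h : ∀ w, ∃ N : ℤ, ∀ p < N, c p w = 0) : Fld W := ⟨c, h⟩

theorem ofCoeff_apply (c : ℤ → Module.End ℂ W) (h) (p : ℤ) : ofCoeff c h p = c p := rfl
theorem add_apply (a b : Fld W) (p : ℤ) : (a + b) p = a p + b p := rfl
theorem sub_apply (a b : Fld W) (p : ℤ) : (a - b) p = a p - b p := rfl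
theorem neg_apply (a : Fld W) (p : ℤ) : (-a) p = -a p := rfl
theorem smul_apply (r : ℂ) (a : Fld W) (p : ℤ) : (r • a) p = r • a p := rfl
theorem zsmul_apply (r : ℤ) (a : Fld W) (p : ℤ) : (r • a) p = r • a p := rfl
theorem zero_apply (p : ℤ) : (0 : Fld W) p = 0 := rfl
theorem sum_apply {α : Type*} (s : Finset α) (f : α → Fld W) (p : ℤ) :
    (∑ x ∈ s, f x) p = ∑ x ∈ s, f x p := by
  change (∑ x ∈ s, f x).1 p = _
  rw [AddSubmonoidClass.coe_finsetSum, Finset.sum_apply]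
  rfl

theorem ext_apply {a b : Fld W} (h : ∀ p w, a p w = b p w) : a = b :=
  DFunLike.ext _ _ fun p => LinearMap.ext (h p)

theorem trunc (c : Fld W) (w : W) : ∃ N : ℤ, ∀ p < N, c p w = 0 := c.2 w

/-- `c_{p - i} w` vanishes for large `i`. -/
theorem trunc_sub (c : Fld W) (p : ℤ) (w : W) : ∃ N : ℕ, ∀ i : ℕ, N ≤ i → c (p - i) w = 0 := by
  obtain ⟨N, hN⟩ := c.trunc w
  exact ⟨(p - N).toNat + 1, fun i hi => hN _ (by omega)⟩

/-- The mode `c_(k)`, i.e. the coefficient of `z^(-k-1)`. -/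
def mode (c : Fld W) (k : ℤ) : Module.End ℂ W := c (-k - 1)

theorem trunc_mode (c : Fld W) (w : W) : ∃ N : ℕ, ∀ i : ℕ, N ≤ i → c.mode i w = 0 := by
  obtain ⟨N, hN⟩ := c.trunc_sub (-1) w
  exact ⟨N, fun i hi => by rw [mode, ← hN i hi]; congr 2; ring⟩

theorem trunc_family {α : Type*} (s : Finset α) (P : α → ℕ → Prop)
    (hm : ∀ x N N', N ≤ N' → P x N → P x N')
    (h : ∀ x, ∃ N, P x N) : ∃ N, ∀ x ∈ s, P x N := by
  choose N hN using h
  exact ⟨s.sup N, fun x hx => hm x _ _ (le_sup hx) (hN x)⟩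

/-- The field `1`. -/
def one : Fld W := ofCoeff (fun p => if p = 0 then LinearMap.id else 0) fun w =>
  ⟨0, fun p hp => by simp only [if_neg hp.ne, LinearMap.zero_apply]⟩

theorem one_apply (p : ℤ) : (one : Fld W) p = if p = 0 then LinearMap.id else 0 := rfl

/-- Left multiplication of a field `c(z)` by the residue in `t` of `(t - z)^k a(t)`, with
`(t - z)^k` expanded in nonnegative powers of `z`. -/
def lmul (a : Fld W) (k : ℤ) (c : Fld W) : Fld W :=
  ofCoeff (fun p => locSum
    (fun i : ℕ => ((-1) ^ i * Ring.choose k i) • (a.mode (k - i) ∘ₗ c (p - i)))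
    (fun w => finite_of_eventually <| by
      obtain ⟨N, hN⟩ := c.trunc_sub p w
      exact ⟨N, fun i hi => by simp [hN i hi]⟩)) fun w => by
    obtain ⟨N, hN⟩ := c.trunc w
    refine ⟨N, fun p hp => ?_⟩
    rw [locSum_eq_sum _ _ _ ∅, sum_empty]
    intro i _
    simp [hN (p - i) (by omega)]

theorem lmul_apply (a : Fld W) (k : ℤ) (c : Fld W) (p : ℤ) (w : W) (N : ℕ)
    (hN : ∀ i : ℕ, N ≤ i → c (p - i) w = 0) : lmul a k c p w =
      ∑ i ∈ range N, ((-1) ^ i * Ring.choose k i) • a.mode (k - i) (c (p - i) w) := by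
  rw [lmul, ofCoeff_apply, locSum_eq_sum _ _ _ (range N)]
  · rfl
  · intro i hi
    simp [hN i (by simpa using hi)]

/-- Right multiplication of a field `c(z)` by the residue in `t` of `(t - z)^k a(t)`, with
`(t - z)^k` expanded in nonnegative powers of `t`. -/
def rmul (a : Fld W) (k : ℤ) (c : Fld W) : Fld W :=
  ofCoeff (fun p => locSum
    (fun i : ℕ => (sgn (k + i) * Ring.choose k i) • (c (p - k + i) ∘ₗ a.mode i))
    (fun w => finite_of_eventually <| by
      obtain ⟨N, hN⟩ := a.trunc_mode w
      exact ⟨N, fun i hi => by simp [hN i hi]⟩)) fun w => by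
    obtain ⟨N, hN⟩ := a.trunc_mode w
    choose f hf using fun i => c.trunc (a.mode i w)
    obtain ⟨b, hb⟩ := ((range N).image fun i : ℕ => f i + k - i).bddBelow
    refine ⟨b, fun p hp => ?_⟩
    rw [locSum_eq_sum _ _ _ (range N) (fun i hi => by simp [hN i (by simpa using hi)])]
    refine sum_eq_zero fun i hi => ?_
    have := hb (mem_coe.2 (mem_image_of_mem _ hi))
    simp [hf i (p - k + i) (by omega)]

theorem rmul_apply (a : Fld W) (k : ℤ) (c : Fld W) (p : ℤ) (w : W) (N : ℕ)
    (hN : ∀ i : ℕ, N ≤ i → a.mode i w = 0) : rmul a k c p w =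
      ∑ i ∈ range N, (sgn (k + i) * Ring.choose k i) • c (p - k + i) (a.mode i w) := by
  rw [rmul, ofCoeff_apply, locSum_eq_sum _ _ _ (range N)]
  · rfl
  · intro i hi
    simp [hN i (by simpa using hi)]

/-- The `k`-th product `a_(k) c` of fields: `(a_(k) c)(z)` is the residue in `t` of
`(t - z)^k a(t) c(z) - (t - z)^k c(z) a(t)`, with the expansions of `lmul` and `rmul`. It is bundled as a linear
operator in `c`, because these operators will represent the Lie algebra on fields. -/
def nprod (a : Fld W) (k : ℤ) : Fld W →ₗ[ℂ] Fld W where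
  toFun c := lmul a k c - rmul a k c
  map_add' c d := by
    refine ext_apply fun p w => ?_
    obtain ⟨N₁, hN₁⟩ := c.trunc_sub p w
    obtain ⟨N₂, hN₂⟩ := d.trunc_sub p w
    obtain ⟨N, hN₁', hN₂'⟩ : ∃ N, N₁ ≤ N ∧ N₂ ≤ N := ⟨_, le_max_left _ _, le_max_right _ _⟩
    have hN : ∀ i : ℕ, N ≤ i → c (p - i) w = 0 := fun i hi => hN₁ i (hN₁'.trans hi)
    have hM : ∀ i : ℕ, N ≤ i → d (p - i) w = 0 := fun i hi => hN₂ i (hN₂'.trans hi)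
    obtain ⟨N', hN'⟩ := a.trunc_mode w
    simp only [add_apply, sub_apply, LinearMap.sub_apply, LinearMap.add_apply]
    rw [lmul_apply a k c p w N hN, lmul_apply a k d p w N hM,
      lmul_apply a k _ p w N fun i hi => by
        rw [add_apply, LinearMap.add_apply, hN i hi, hM i hi, add_zero],
      rmul_apply a k c p w N' hN', rmul_apply a k d p w N' hN', rmul_apply a k _ p w N' hN']
    simp only [add_apply, LinearMap.add_apply, map_add, smul_add, sum_add_distrib]
    abel
  map_smul' r c := by
    refine ext_apply fun p w => ?_
    obtain ⟨N, hN⟩ := c.trunc_sub p w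
    obtain ⟨N', hN'⟩ := a.trunc_mode w
    simp only [smul_apply, sub_apply, LinearMap.sub_apply, LinearMap.smul_apply, RingHom.id_apply]
    rw [lmul_apply a k c p w N hN,
      lmul_apply a k _ p w N fun i hi => by
        rw [smul_apply, LinearMap.smul_apply, hN i hi, smul_zero],
      rmul_apply a k c p w N' hN', rmul_apply a k _ p w N' hN']
    simp only [smul_apply, LinearMap.smul_apply, map_smul, smul_sub, smul_sum, smul_comm r]

theorem nprod_eq (a : Fld W) (k : ℤ) (c : Fld W) : nprod a k c = lmul a k c - rmul a k c := rfl

/-- The coefficients of `a_(k) c` as finite sums. -/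
theorem nprod_apply (a : Fld W) (k : ℤ) (c : Fld W) (p : ℤ) (w : W) (N N' : ℕ)
    (hN : ∀ i : ℕ, N ≤ i → c (p - i) w = 0) (hN' : ∀ i : ℕ, N' ≤ i → a.mode i w = 0) :
    nprod a k c p w =
      ∑ i ∈ range N, ((-1) ^ i * Ring.choose k i) • a.mode (k - i) (c (p - i) w) -
      ∑ i ∈ range N', (sgn (k + i) * Ring.choose k i) • c (p - k + i) (a.mode i w) := by
  rw [nprod_eq, sub_apply, LinearMap.sub_apply, lmul_apply a k c p w N hN,
    rmul_apply a k c p w N' hN']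

/-! ### The commutator formula for products of fields -/

/-- Left and right multiplications commute, whether or not the fields themselves do. -/
theorem lmul_rmul_comm (a b : Fld W) (k l : ℤ) (c : Fld W) :
    lmul a k (rmul b l c) = rmul b l (lmul a k c) := by
  refine ext_apply fun p w => ?_
  obtain ⟨N', hN'⟩ := b.trunc_mode w
  obtain ⟨N, hN⟩ := trunc_family (range N') (fun i' N => ∀ i : ℕ, N ≤ i →
      c (p - l + i' - i) (b.mode i' w) = 0) (fun _ _ _ h h' i hi => h' i (h.trans hi))
      (fun i' => c.trunc_sub _ _)
  rw [rmul_apply b l _ p w N' hN', lmul_apply a k _ p w N]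
  · have h1 : ∀ i' ∈ range N', (lmul a k c (p - l + i')) (b.mode i' w) = _ := fun i' hi' =>
      lmul_apply a k c _ _ N (hN i' hi')
    rw [sum_congr (s₁ := range N') rfl fun i' hi' => by rw [h1 i' hi']]
    have h2 : ∀ i, (rmul b l c (p - i)) w = _ := fun i => rmul_apply b l c _ _ N' hN'
    simp only [h2, map_sum, smul_sum, map_zsmul]
    rw [sum_comm]
    refine sum_congr rfl fun i' _ => sum_congr rfl fun i _ => ?_
    rw [smul_comm, show p - i - l + i' = p - l + i' - i by ring]
  · intro i hi
    rw [rmul_apply b l c _ _ N' hN']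
    refine sum_eq_zero fun i' hi' => ?_
    rw [show p - i - l + i' = p - l + i' - i by ring, hN i' hi' i hi, smul_zero]

theorem lmul_lmul (a b : Fld W) (k l : ℤ) (c : Fld W) (p : ℤ) (w : W) (N Q : ℕ)
    (hN : ∀ i : ℕ, N ≤ i → c (p - i) w = 0) (hQ : N + N ≤ Q) : lmul a k (lmul b l c) p w =
      ∑ q ∈ range Q, (-1 : ℤ) ^ q • ∑ x ∈ antidiagonal q,
        (Ring.choose k x.1 * Ring.choose l x.2) •
          a.mode (k - x.1) (b.mode (l - x.2) (c (p - q) w)) := by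
  have hN2 : ∀ i i' : ℕ, N ≤ i + i' → c (p - i - i') w = 0 := fun i i' h => by
    rw [← hN _ h]; congr 2; push_cast; ring
  have h1 : ∀ i : ℕ, lmul b l c (p - i) w = _ := fun i =>
    lmul_apply b l c (p - i) w N fun i' hi' => hN2 _ _ (by omega)
  rw [lmul_apply a k _ p w N]
  · simp only [h1, map_sum, smul_sum, map_zsmul, smul_smul]
    rw [sum_range_prod_eq_antidiagonal _ N N Q _ hQ]
    · refine sum_congr rfl fun q _ => sum_congr rfl fun x hx => ?_
      rw [HasAntidiagonal.mem_antidiagonal] at hx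
      rw [← hx, pow_add]
      push_cast
      rw [sub_sub]
      congr 1
      ring
    · intro i i' h
      rw [hN2 i i' (by omega), map_zero, map_zero, smul_zero]
  · intro i hi
    rw [h1]
    refine sum_eq_zero fun i' _ => ?_
    rw [hN2 i i' (by omega), map_zero, smul_zero]

theorem rmul_rmul (a b : Fld W) (k l : ℤ) (c : Fld W) (p : ℤ) (w : W) (N N' Q : ℕ)
    (hN : ∀ i : ℕ, N ≤ i → a.mode i w = 0)
    (hN' : ∀ i < N, ∀ i' : ℕ, N' ≤ i' → b.mode i' (a.mode i w) = 0)
    (hQ : N + N' ≤ Q) : rmul a k (rmul b l c) p w =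
      ∑ q ∈ range Q, sgn (k + l + q) • ∑ x ∈ antidiagonal q,
        (Ring.choose k x.1 * Ring.choose l x.2) •
          c (p - (k + l) + q) (b.mode x.2 (a.mode x.1 w)) := by
  have h1 : ∀ i ∈ range N, (rmul b l c (p - k + i)) (a.mode i w) = _ := fun i hi =>
    rmul_apply b l c _ _ N' (hN' i (by simpa using hi))
  rw [rmul_apply a k _ p w N hN, sum_congr rfl fun i hi => by rw [h1 i hi]]
  simp only [smul_sum, smul_smul]
  rw [sum_range_prod_eq_antidiagonal _ N N' Q _ hQ]
  · refine sum_congr rfl fun q _ => sum_congr rfl fun x hx => ?_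
    rw [HasAntidiagonal.mem_antidiagonal] at hx
    rw [← hx]
    push_cast
    rw [show p - k + x.1 - l + (x.2 : ℤ) = p - (k + l) + (x.1 + x.2) by ring]
    congr 1
    simp only [sgn_add]
    ring
  · intro i i' h
    by_cases hi : i < N
    · rw [hN' i hi i' (by omega), map_zero, smul_zero]
    · rw [hN i (by omega), map_zero, map_zero, smul_zero]

/-- The commutator formula: if the commutators of the modes of two fields are combinations of modes
of other fields with coefficients given by mode weights, the same formula holds for the operators
of taking products with these fields. -/
theorem nprod_comm {τ : Type*} (s : Finset τ) (a b : Fld W) (d : τ → Fld W) (f : τ → ℤ → ℤ → ℤ)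
    (j : τ → ℕ) (hf : ∀ t, IsModeWeight (f t) (j t))
    (h : ∀ m n w, a.mode m (b.mode n w) - b.mode n (a.mode m w) =
      ∑ t ∈ s, f t m n • (d t).mode (m + n - j t) w) (k l : ℤ) (c : Fld W) :
    nprod a k (nprod b l c) - nprod b l (nprod a k c) =
      ∑ t ∈ s, f t k l • nprod (d t) (k + l - j t) c := by
  have hL : lmul a k (lmul b l c) - lmul b l (lmul a k c) =
      ∑ t ∈ s, f t k l • lmul (d t) (k + l - j t) c := by
    refine ext_apply fun p w => ?_
    obtain ⟨N, hN⟩ := c.trunc_sub p w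
    have hN2 : ∀ i : ℕ, N + N ≤ i → c (p - i) w = 0 := fun i hi => hN i (by omega)
    simp only [sub_apply, LinearMap.sub_apply, sum_apply, zsmul_apply, LinearMap.sum_apply,
      LinearMap.smul_apply]
    rw [lmul_lmul a b k l c p w N _ hN le_rfl, lmul_lmul b a l k c p w N _ hN le_rfl]
    simp only [fun t => lmul_apply (d t) (k + l - j t) c p w (N + N) hN2, smul_sum]
    rw [sum_comm, ← sum_sub_distrib]
    refine sum_congr rfl fun q _ => ?_
    rw [← Nat.sum_antidiagonal_swap (n := q), ← sum_sub_distrib]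
    simp only [Prod.fst_swap, Prod.snd_swap]
    have h1 : ∀ x ∈ antidiagonal q, ((-1 : ℤ) ^ q • (Ring.choose k x.2 * Ring.choose l x.1) •
        a.mode (k - x.2) (b.mode (l - x.1) (c (p - q) w)) -
        (-1 : ℤ) ^ q • (Ring.choose l x.1 * Ring.choose k x.2) •
        b.mode (l - x.1) (a.mode (k - x.2) (c (p - q) w))) =
        ∑ t ∈ s, ((-1 : ℤ) ^ q * (Ring.choose k x.2 * Ring.choose l x.1 *
          f t (k - x.2) (l - x.1))) • (d t).mode (k + l - j t - q) (c (p - q) w) := by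
      intro x hx
      rw [HasAntidiagonal.mem_antidiagonal] at hx
      rw [mul_comm (Ring.choose l x.1), ← smul_sub, ← smul_sub, h, smul_sum, smul_sum]
      refine sum_congr rfl fun t _ => ?_
      rw [smul_smul, smul_smul, ← hx]
      push_cast
      rw [show k - x.2 + (l - (x.1 : ℤ)) - j t = k + l - j t - (x.1 + x.2) by ring]
      congr 1
      ring
    rw [sum_congr rfl h1, sum_comm]
    refine sum_congr rfl fun t _ => ?_
    rw [← sum_smul, ← mul_sum, smul_smul, mul_left_comm, ← (hf t).left k l q,
      ← Nat.sum_antidiagonal_swap (n := q)]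
    rfl
  have hR : rmul a k (rmul b l c) - rmul b l (rmul a k c) =
      -∑ t ∈ s, f t k l • rmul (d t) (k + l - j t) c := by
    refine ext_apply fun p w => ?_
    obtain ⟨Na, hNa⟩ := a.trunc_mode w
    obtain ⟨Nb, hNb⟩ := b.trunc_mode w
    obtain ⟨N, hN⟩ : ∃ N, ∀ i : ℕ, N ≤ i → a.mode i w = 0 ∧ b.mode i w = 0 :=
      ⟨max Na Nb, fun i hi => ⟨hNa i ((le_max_left _ _).trans hi),
        hNb i ((le_max_right _ _).trans hi)⟩⟩
    obtain ⟨N₁, hN₁⟩ := trunc_family (range N) (fun i N => ∀ i' : ℕ, N ≤ i' →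
      b.mode i' (a.mode i w) = 0) (fun _ _ _ h h' i hi => h' i (h.trans hi))
      (fun i => b.trunc_mode _)
    obtain ⟨N₂, hN₂⟩ := trunc_family (range N) (fun i N => ∀ i' : ℕ, N ≤ i' →
      a.mode i' (b.mode i w) = 0) (fun _ _ _ h h' i hi => h' i (h.trans hi))
      (fun i => a.trunc_mode _)
    obtain ⟨N₃, hN₃⟩ := trunc_family s (fun t N => ∀ i' : ℕ, N ≤ i' →
      (d t).mode i' w = 0) (fun _ _ _ h h' i hi => h' i (h.trans hi))
      (fun t => (d t).trunc_mode _)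
    set Q := (N + max N₁ N₂) + (N₃ + s.sup j) with hQ
    have hQt : ∀ t ∈ s, Q = j t + (Q - j t) ∧ N₃ ≤ Q - j t := fun t ht => by
      have := le_sup (f := j) ht
      omega
    simp only [sub_apply, LinearMap.sub_apply, neg_apply, LinearMap.neg_apply, sum_apply,
      zsmul_apply, LinearMap.sum_apply, LinearMap.smul_apply]
    rw [rmul_rmul a b k l c p w N (max N₁ N₂) Q (fun i hi => (hN i hi).1)
        (fun i hi i' hi' => hN₁ i (mem_range.2 hi) i' ((le_max_left _ _).trans hi')) (by omega),
      rmul_rmul b a l k c p w N (max N₁ N₂) Q (fun i hi => (hN i hi).2)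
        (fun i hi i' hi' => hN₂ i (mem_range.2 hi) i' ((le_max_right _ _).trans hi')) (by omega),
      sum_congr (s₁ := s) rfl fun t ht => by rw [rmul_apply (d t) (k + l - j t) c p w (Q - j t)
        fun i hi => hN₃ t ht i ((hQt t ht).2.trans hi)]]
    have h1 : ∀ q : ℕ, sgn (k + l + q) • ∑ x ∈ antidiagonal q,
        (Ring.choose k x.1 * Ring.choose l x.2) •
          c (p - (k + l) + q) (b.mode x.2 (a.mode x.1 w)) -
        sgn (l + k + q) • ∑ x ∈ antidiagonal q, (Ring.choose l x.1 * Ring.choose k x.2) •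
          c (p - (l + k) + q) (a.mode x.2 (b.mode x.1 w)) =
        -∑ t ∈ s, (sgn (k + l + q) * ∑ x ∈ antidiagonal q,
          Ring.choose k x.1 * Ring.choose l x.2 * f t x.1 x.2) •
            c (p - (k + l) + q) ((d t).mode (q - j t) w) := by
      intro q
      rw [← Nat.sum_antidiagonal_swap (n := q) (f := fun x => (Ring.choose l x.1 *
        Ring.choose k x.2) • c (p - (l + k) + q) (a.mode x.2 (b.mode x.1 w)))]
      simp only [Prod.fst_swap, Prod.snd_swap]
      rw [add_comm l k, ← smul_sub, ← sum_sub_distrib]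
      simp only [mul_smul, sum_smul]
      rw [← smul_sum, ← smul_neg, sum_comm, ← sum_neg_distrib]
      congr 1
      refine sum_congr rfl fun x hx => ?_
      rw [HasAntidiagonal.mem_antidiagonal] at hx
      rw [smul_comm (Ring.choose l x.2), ← smul_sub, ← smul_sub, ← map_sub,
        ← neg_sub (a.mode x.1 (b.mode x.2 w)), h, map_neg,
        map_sum, smul_neg, smul_neg, smul_sum, smul_sum]
      congr 1
      refine sum_congr rfl fun t _ => ?_
      rw [map_zsmul, ← hx]
      push_cast
      rfl
    rw [← sum_sub_distrib, sum_congr rfl fun q _ => h1 q, sum_neg_distrib, sum_comm]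
    congr 1
    refine sum_congr rfl fun t ht => ?_
    rw [(hQt t ht).1, sum_range_add, ← (hQt t ht).1, sum_eq_zero, zero_add, smul_sum]
    · refine sum_congr rfl fun q _ => ?_
      rw [add_comm (j t) q, (hf t).right k l q, smul_smul]
      push_cast
      rw [show (q : ℤ) + j t - j t = q by ring,
        show p - (k + l) + ((q : ℤ) + j t) = p - (k + l - j t) + q by ring,
        show k + l + ((q : ℤ) + j t) = k + l + q + j t by ring, sgn_add_natCast,
        show k + l + (q : ℤ) - j t = k + l - j t + q by ring]
      congr 1
      ring
    · intro q hq
      rw [sum_eq_zero, mul_zero, zero_smul]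
      intro x hx
      rw [HasAntidiagonal.mem_antidiagonal] at hx
      rw [(hf t).small x.1 x.2 (by rw [hx]; exact mem_range.1 hq), mul_zero]
  -- a left and a right multiplication commute, so only the two pure terms contribute
  have e : nprod a k (nprod b l c) - nprod b l (nprod a k c) =
      (lmul a k (lmul b l c) - lmul b l (lmul a k c)) +
        (rmul a k (rmul b l c) - rmul b l (rmul a k c)) := by
    rw [nprod_eq b l c, nprod_eq a k c, map_sub, map_sub, nprod_eq, nprod_eq, nprod_eq, nprod_eq,
      lmul_rmul_comm a b, lmul_rmul_comm b a]
    abel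
  rw [e, hL, hR, ← sub_eq_add_neg, ← sum_sub_distrib]
  simp only [nprod_eq, smul_sub]

/-! ### Derivatives of fields -/

/-- The derivative `d/dz c(z)`. -/
def deriv (c : Fld W) : Fld W :=
  ofCoeff (fun p => (p + 1) • c (p + 1)) fun w => by
    obtain ⟨N, hN⟩ := c.trunc w
    exact ⟨N - 1, fun p hp => by rw [LinearMap.smul_apply, hN _ (by omega), smul_zero]⟩

theorem deriv_apply (c : Fld W) (p : ℤ) (w : W) : deriv c p w = (p + 1) • c (p + 1) w := rfl

theorem succ_mul_choose (n : ℤ) (i : ℕ) :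
    ((i : ℤ) + 1) * Ring.choose n (i + 1) = n * Ring.choose (n - 1) i := by
  have := choose_mul_natChoose n i 1
  simp only [Ring.choose_one_right] at this
  push_cast at this
  linarith

theorem sub_mul_choose (n : ℤ) (i : ℕ) :
    (n - i) * Ring.choose n i = n * Ring.choose (n - 1) i := by
  have := choose_mul_choose_comm n i 1
  simp only [Ring.choose_one_right] at this
  push_cast at this
  linarith

theorem deriv_nprod (a : Fld W) (n : ℤ) (c : Fld W) :
    deriv (nprod a n c) = nprod a n (deriv c) - n • nprod a (n - 1) c := by
  refine ext_apply fun p w => ?_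
  obtain ⟨N, hN⟩ := c.trunc_sub (p + 1) w
  obtain ⟨N', hN'⟩ := a.trunc_mode w
  have hN1 : ∀ i : ℕ, N ≤ i → c (p - i) w = 0 := fun i hi => by
    rw [← hN (i + 1) (by omega)]; congr 2; push_cast; ring
  rw [deriv_apply, sub_apply, zsmul_apply, LinearMap.sub_apply, LinearMap.smul_apply,
    nprod_apply a n c (p + 1) w (N + 1) N' (fun i hi => hN i (by omega)) hN',
    nprod_apply a n (deriv c) p w (N + 1) N' (fun i hi => by
      rw [deriv_apply, show p - (i : ℤ) + 1 = p + 1 - i by ring, hN i (by omega), smul_zero]) hN',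
    nprod_apply a (n - 1) c p w N N' hN1 hN']
  have h1 : (p + 1) • ∑ i ∈ range (N + 1), ((-1) ^ i * Ring.choose n i) •
      a.mode (n - i) (c (p + 1 - i) w) - ∑ i ∈ range (N + 1), ((-1) ^ i * Ring.choose n i) •
      a.mode (n - i) (deriv c (p - i) w) = -(n • ∑ i ∈ range N,
        ((-1) ^ i * Ring.choose (n - 1) i) • a.mode (n - 1 - i) (c (p - i) w)) := by
    rw [smul_sum, ← sum_sub_distrib, sum_range_succ', smul_sum, ← sum_neg_distrib]
    simp only [deriv_apply, map_zsmul, smul_smul, ← sub_smul, Nat.cast_zero, sub_zero]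
    rw [show ((p + 1) * ((-1) ^ 0 * Ring.choose n 0) - (-1) ^ 0 * Ring.choose n 0 * (p + 1)) = 0 by
      ring, zero_smul, add_zero]
    refine sum_congr rfl fun i _ => ?_
    push_cast
    rw [show n - ((i : ℤ) + 1) = n - 1 - i by ring, show p + 1 - ((i : ℤ) + 1) = p - i by ring,
      show p - ((i : ℤ) + 1) + 1 = p - i by ring, ← sub_smul, ← neg_smul]
    congr 1
    linear_combination -(-1 : ℤ) ^ i * succ_mul_choose n i
  have h2 : (p + 1) • ∑ i ∈ range N', (sgn (n + i) * Ring.choose n i) •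
      c (p + 1 - n + i) (a.mode i w) - ∑ i ∈ range N', (sgn (n + i) * Ring.choose n i) •
      deriv c (p - n + i) (a.mode i w) = -(n • ∑ i ∈ range N',
        (sgn (n - 1 + i) * Ring.choose (n - 1) i) • c (p - (n - 1) + i) (a.mode i w)) := by
    rw [smul_sum, ← sum_sub_distrib, smul_sum, ← sum_neg_distrib]
    refine sum_congr rfl fun i _ => ?_
    rw [deriv_apply, show p + 1 - n + (i : ℤ) = p - (n - 1) + i by ring,
      show p - n + (i : ℤ) + 1 = p - (n - 1) + i by ring, smul_smul, smul_smul, smul_smul,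
      ← sub_smul, ← neg_smul]
    congr 1
    rw [show n - 1 + (i : ℤ) = n + i - 1 by ring, sgn_sub_one]
    linear_combination sgn (n + i) * sub_mul_choose n i
  rw [smul_sub, smul_sub]
  rw [sub_eq_iff_eq_add.1 h1, sub_eq_iff_eq_add.1 h2]
  abel

/-- The field satisfies `[T, c(z)] = d/dz c(z)`. -/
def IsTransl (T : Module.End ℂ W) (c : Fld W) : Prop :=
  ∀ p w, T (c p w) - c p (T w) = (p + 1) • c (p + 1) w

theorem isTransl_one (T : Module.End ℂ W) : IsTransl T one := by
  intro p w
  simp only [one_apply]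
  split_ifs with h h1 h1
  · omega
  · simp
  · simp [h1]
  · simp

theorem IsTransl.mode {T : Module.End ℂ W} {a : Fld W} (h : IsTransl T a) (m : ℤ) (w : W) :
    T (a.mode m w) = a.mode m (T w) - m • a.mode (m - 1) w := by
  have := h (-m - 1) w
  rw [show -m - 1 + 1 = -m by ring, neg_smul] at this
  rw [Fld.mode, Fld.mode, show -(m - 1) - 1 = -m by ring, sub_eq_iff_eq_add.1 this]
  abel

theorem IsTransl.nprod {T : Module.End ℂ W} {a c : Fld W} (ha : IsTransl T a) (hc : IsTransl T c)
    (n : ℤ) : IsTransl T (nprod a n c) := by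
  intro p w
  rw [← deriv_apply, deriv_nprod, sub_apply, zsmul_apply, LinearMap.sub_apply,
    LinearMap.smul_apply]
  obtain ⟨N, hN⟩ := c.trunc_sub (p + 1) w
  obtain ⟨N₁, hN₁⟩ := c.trunc_sub p (T w)
  obtain ⟨N', hN'⟩ := a.trunc_mode w
  obtain ⟨N₂, hN₂⟩ := a.trunc_mode (T w)
  set Q := N + 1 + N₁
  set Q' := N' + N₂
  have hN1 : ∀ i : ℕ, Q ≤ i → c (p - i) w = 0 := fun i hi => by
    rw [← hN (i + 1) (by omega)]; congr 2; push_cast; ring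
  have hQ' : ∀ i : ℕ, Q' ≤ i → a.mode i w = 0 := fun i hi => hN' i (by omega)
  rw [nprod_apply a n c p w Q (Q' + 1) hN1 fun i hi => hN' i (by omega),
    nprod_apply a n c p (T w) Q (Q' + 1) (fun i hi => hN₁ i (by omega))
      fun i hi => hN₂ i (by omega),
    nprod_apply a n (deriv c) p w Q (Q' + 1) (fun i hi => by
      rw [deriv_apply, show p - (i : ℤ) + 1 = p + 1 - i by ring, hN i (by omega), smul_zero])
      fun i hi => hN' i (by omega),
    nprod_apply a (n - 1) c p w Q Q' hN1 hQ']
  have hcT : ∀ p w, T (c p w) = c p (T w) + deriv c p w := fun p w => by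
    rw [deriv_apply, ← hc p w]; abel
  simp only [map_sub, map_sum, map_zsmul, hcT, ha.mode, map_add, smul_add, smul_sub,
    sum_add_distrib, sum_sub_distrib]
  have h1 : ∑ i ∈ range Q, ((-1) ^ i * Ring.choose n i) • (n - i) •
      a.mode (n - i - 1) (c (p - i) w) =
      n • ∑ i ∈ range Q, ((-1) ^ i * Ring.choose (n - 1) i) • a.mode (n - 1 - i) (c (p - i) w) := by
    rw [smul_sum]
    refine sum_congr rfl fun i _ => ?_
    rw [show n - (i : ℤ) - 1 = n - 1 - i by ring, smul_smul, smul_smul]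
    congr 1
    linear_combination (-1 : ℤ) ^ i * sub_mul_choose n i
  have h2 : ∑ i ∈ range (Q' + 1), (sgn (n + i) * Ring.choose n i) • (i : ℤ) •
      c (p - n + i) (a.mode (i - 1) w) =
      n • ∑ i ∈ range Q', (sgn (n - 1 + i) * Ring.choose (n - 1) i) •
        c (p - (n - 1) + i) (a.mode i w) := by
    rw [sum_range_succ', smul_sum]
    simp only [Nat.cast_zero, zero_smul, smul_zero, add_zero]
    refine sum_congr rfl fun i _ => ?_
    push_cast
    rw [show p - n + ((i : ℤ) + 1) = p - (n - 1) + i by ring, add_sub_cancel_right, smul_smul,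
      smul_smul]
    congr 1
    rw [show n + ((i : ℤ) + 1) = n - 1 + i + (1 + 1) by ring, sgn_add, sgn_add 1 1, sgn_mul_self]
    linear_combination sgn (n - 1 + i) * succ_mul_choose n i
  rw [h1, h2]
  abel

/-! ### Associativity -/

theorem fwdDiff_ringChoose (i : ℕ) (x : ℤ) :
    Ring.choose (x + 1) (i + 1) - Ring.choose x (i + 1) = Ring.choose x i := by
  rw [Ring.choose_succ_succ]; ring

/-- A binomial coefficient of lower degree is annihilated by an iterated difference. -/
theorem alternating_sum_choose (m : ℕ) : ∀ (i : ℕ), i < m → ∀ x : ℤ,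
    ∑ k ∈ range (m + 1), ((-1 : ℤ) ^ k * m.choose k) * Ring.choose (x + k) i = 0 := by
  have key : ∀ (m i : ℕ), i < m → (fwdDiff (1 : ℤ))^[m] (fun x : ℤ => Ring.choose x i) = 0 := by
    intro m
    induction m with
    | zero => intro i hi; omega
    | succ m ih =>
      intro i hi
      rw [Function.iterate_succ_apply]
      cases i with
      | zero =>
        have : fwdDiff (1 : ℤ) (fun x : ℤ => Ring.choose x 0) = 0 := by
          funext x; simp [fwdDiff]
        rw [this]
        clear ih this hi
        induction m with
        | zero => rfl
        | succ m ih => rw [Function.iterate_succ_apply', ih]; funext x; simp [fwdDiff]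
      | succ i =>
        rw [← ih i (by omega)]
        congr 1
        funext x
        exact fwdDiff_ringChoose i x
  intro i hi x
  have h := congrFun (key m i hi) x
  rw [fwdDiff_iter_eq_sum_shift] at h
  have h2 := congrArg (fun y => (-1 : ℤ) ^ m * y) h
  simp only [Pi.zero_apply, mul_zero, mul_sum] at h2
  rw [← h2]
  refine sum_congr rfl fun k hk => ?_
  have hk' : k ≤ m := by simpa [Nat.lt_succ_iff] using hk
  obtain ⟨e, rfl⟩ := Nat.exists_eq_add_of_le hk'
  simp only [Nat.add_sub_cancel_left, smul_eq_mul, nsmul_eq_mul, mul_one, pow_add]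
  have : ((-1 : ℤ) ^ e) * (-1) ^ e = 1 := by rw [← mul_pow]; simp
  linear_combination (-(-1 : ℤ) ^ k * ((k + e).choose k) * Ring.choose (x + k) i) * this

/-- The associativity relation between the compositions and the products of two fields, in terms of
the coefficients of `z₀^p z₂^q`. It needs no locality; `m` only depends on `A` and `w`. -/
theorem assoc_relation (A B : Fld W) (w : W) (m : ℕ) (hm : ∀ p < -(m : ℤ), A p w = 0) (p q : ℤ) :
    ∑ᶠ k : ℕ, Ring.choose (p + k) k • A (p + k - m) (B (q - k) w) =
      ∑ k ∈ range (m + 1), m.choose k • nprod A (k - p - 1) B (q - (m - k)) w := by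
  -- Only finitely many modes `A_(i) w`, `i < m`, survive on the right; their total coefficient is
  -- an alternating sum of a polynomial of degree `i < m`, hence zero. The remaining terms are
  -- collected along antidiagonals by Vandermonde's identity.
  obtain ⟨N, hN⟩ := B.trunc_sub q w
  have hA : ∀ i : ℕ, m ≤ i → A.mode i w = 0 := fun i hi => hm _ (by omega)
  rw [← sum_range_reflect, finsum_eq_sum_of_support_subset (s := range (m + 1 + N))]
  swap
  · intro k hk
    by_contra h
    refine hk ?_
    simp only [coe_range, Set.mem_Iio, not_lt] at h
    simp only
    rw [hN k (by omega), map_zero, smul_zero]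
  have h1 : ∀ k ∈ range (m + 1), m.choose (m + 1 - 1 - k) •
      nprod A ((m + 1 - 1 - k : ℕ) - p - 1) B (q - (m - (m + 1 - 1 - k : ℕ))) w =
      ∑ i ∈ range N, (Ring.choose (m : ℤ) k * Ring.choose (p - m + (k + i)) i) •
        A (p + (k + i) - m) (B (q - (k + i)) w) -
      ∑ i ∈ range m, (sgn (m - p - 1 + i) * ((-1) ^ k * m.choose k *
        Ring.choose (-p - 1 + (m - k : ℕ)) i)) • B (q - m + p + 1 + i) (A.mode i w) := by
    intro k hk
    have hk' : k ≤ m := by simpa [Nat.lt_succ_iff] using hk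
    rw [nprod_apply A _ B _ w N m (fun i hi => by
      rw [← hN (i + k) (by omega)]; congr 2; omega) hA, smul_sub, smul_sum, smul_sum,
      Nat.add_sub_cancel, Nat.choose_symm hk']
    congr 1
    · refine sum_congr rfl fun i _ => ?_
      rw [mode, ← natCast_zsmul, smul_smul, Nat.cast_sub hk',
        show -((m : ℤ) - k - p - 1 - i) - 1 = p + (k + i) - m by ring,
        show q - ((m : ℤ) - (m - k)) - i = q - (k + i) by ring]
      congr 1
      have := Ring.choose_neg (p + 1 - m + k) i
      rw [show -(p + 1 - (m : ℤ) + k) = m - k - p - 1 by ring] at this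
      rw [this, Ring.choose_natCast]
      rw [show p + 1 - (m : ℤ) + k + i - 1 = p - m + (k + i) by ring, Units.smul_def, smul_eq_mul]
      have e : ((-1 : ℤ) ^ i) * (-1) ^ i = 1 := by rw [← mul_pow]; simp
      have e2 : ((Int.negOnePow i : ℤˣ) : ℤ) = (-1) ^ i := sgn_natCast i
      rw [e2]
      linear_combination ((m.choose k : ℤ) * Ring.choose (p - m + (k + i)) i) * e
    · refine sum_congr rfl fun i _ => ?_
      rw [← natCast_zsmul, smul_smul, Nat.cast_sub hk',
        show q - ((m : ℤ) - (m - k)) - (m - k - p - 1) + i = q - m + p + 1 + i by ring]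
      congr 1
      rw [show (m : ℤ) - k - p - 1 + i = m - p - 1 + i - k by ring, ← sgn_add_natCast, sgn_add,
        sgn_natCast k, show (m : ℤ) - k - p - 1 = -p - 1 + (m - k) by ring]
      ring
  rw [sum_congr rfl h1, sum_sub_distrib, sum_comm (s := range (m + 1)) (t := range m),
    sum_eq_zero (s := range m), sub_zero]
  · rw [sum_range_prod_eq_antidiagonal (fun k i => (Ring.choose (m : ℤ) k *
      Ring.choose (p - m + (k + i)) i) • A (p + (k + i) - m) (B (q - (k + i)) w)) (m + 1) N
      (m + 1 + N) _ le_rfl]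
    · refine sum_congr rfl fun t _ => ?_
      have h2 : ∀ x ∈ antidiagonal t, (Ring.choose (m : ℤ) x.1 *
          Ring.choose (p - m + (x.1 + x.2)) x.2) • A (p + (x.1 + x.2) - m)
            (B (q - (x.1 + x.2)) w) =
          (Ring.choose (m : ℤ) x.1 * Ring.choose (p - m + t) x.2) •
            A (p + t - m) (B (q - t) w) := by
        intro x hx
        rw [HasAntidiagonal.mem_antidiagonal] at hx
        rw [← hx]
        push_cast
        rfl
      rw [sum_congr rfl h2, ← sum_smul, choose_vandermonde]
      congr 2
      ring
    · rintro k i (h | h)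
      · rw [Ring.choose_natCast, Nat.choose_eq_zero_of_lt (by omega)]
        simp
      · rw [show q - ((k : ℤ) + i) = q - (k + i : ℕ) by push_cast; ring, hN (k + i) (by omega),
          map_zero, smul_zero]
  · intro i hi
    have := alternating_sum_choose m i (mem_range.1 hi) (-p - 1)
    rw [← sum_smul, ← mul_sum, ← sum_range_reflect]
    have h3 : ∑ k ∈ range (m + 1), (-1 : ℤ) ^ (m + 1 - 1 - k) * (m.choose (m + 1 - 1 - k)) *
        Ring.choose (-p - 1 + (m - (m + 1 - 1 - k) : ℕ)) i = (-1) ^ m *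
        ∑ k ∈ range (m + 1), ((-1 : ℤ) ^ k * m.choose k) * Ring.choose (-p - 1 + k) i := by
      rw [mul_sum]
      refine sum_congr rfl fun k hk => ?_
      have hk' : k ≤ m := by simpa [Nat.lt_succ_iff] using hk
      rw [Nat.add_sub_cancel, Nat.choose_symm hk', Nat.sub_sub_self hk']
      have : (-1 : ℤ) ^ (m - k) = (-1) ^ m * (-1) ^ k := by
        obtain ⟨e, rfl⟩ := Nat.exists_eq_add_of_le hk'
        have e1 : ((-1 : ℤ) ^ k) * (-1) ^ k = 1 := by rw [← mul_pow]; simp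
        rw [Nat.add_sub_cancel_left, pow_add]
        linear_combination -(-1 : ℤ) ^ e * e1
      rw [this]
      ring
    rw [h3, this, mul_zero, mul_zero, zero_smul]

end Fld

/-! ### Two-variable distributions and locality -/

/-- Multiplication by `z₁ - z₂` on families of coefficients of `z₁^p z₂^q`. -/
def mulDiff : Module.End ℂ (ℤ → ℤ → W) where
  toFun F p q := F (p - 1) q - F p (q - 1)
  map_add' F G := by funext p q; simp only [Pi.add_apply]; abel
  map_smul' r F := by funext p q; simp only [Pi.smul_apply, smul_sub, RingHom.id_apply]

theorem mulDiff_apply (F : ℤ → ℤ → W) (p q : ℤ) : mulDiff F p q = F (p - 1) q - F p (q - 1) := rfl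

theorem mulDiff_pow_succ (N : ℕ) (F : ℤ → ℤ → W) :
    (mulDiff ^ (N + 1)) F = (mulDiff ^ N) (mulDiff F) := by
  rw [pow_succ, Module.End.mul_apply]

theorem mulDiff_pow_eq_zero {N N' : ℕ} {F : ℤ → ℤ → W} (h : (mulDiff ^ N) F = 0) (hN : N ≤ N') :
    (mulDiff ^ N') F = 0 := by
  obtain ⟨e, rfl⟩ := Nat.exists_eq_add_of_le' hN
  rw [pow_add, Module.End.mul_apply, h, map_zero]

theorem mulDiff_pow_apply (N : ℕ) : ∀ (F : ℤ → ℤ → W) (p q : ℤ), (mulDiff ^ N) F p q =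
    ∑ k ∈ range (N + 1), ((-1 : ℤ) ^ k * (N.choose k : ℤ)) • F (p - (N - k)) (q - k) := by
  induction N with
  | zero => intro F p q; simp
  | succ N ih =>
    intro F p q
    rw [mulDiff_pow_succ, ih]
    simp only [mulDiff_apply, smul_sub]
    rw [sum_sub_distrib, sum_range_succ' _ (N + 1)]
    have e : ∑ k ∈ range (N + 1), ((-1 : ℤ) ^ k * (N.choose k : ℤ)) • F (p - (N - k) - 1) (q - k) =
        ∑ k ∈ range (N + 1), ((-1 : ℤ) ^ (k + 1) * (N.choose (k + 1) : ℤ)) •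
          F (p - ((N + 1 : ℕ) - (k + 1 : ℕ))) (q - (k + 1 : ℕ)) +
        ((-1 : ℤ) ^ 0 * ((N + 1).choose 0 : ℤ)) •
          F (p - ((N + 1 : ℕ) - (0 : ℕ))) (q - (0 : ℕ)) := by
      rw [sum_range_succ', sum_range_succ]
      rw [Nat.choose_eq_zero_of_lt (Nat.lt_succ_self N)]
      simp only [Nat.choose_zero_right, Nat.cast_zero, mul_zero, zero_smul, add_zero, pow_zero]
      push_cast
      congr 1
      · refine sum_congr rfl fun k _ => ?_
        rw [show p - ((N : ℤ) - (k + 1)) - 1 = p - (N + 1 - (k + 1)) by ring]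
      · rw [show p - ((N : ℤ) - 0) - 1 = p - (N + 1 - 0) by ring]
    rw [e, add_sub_right_comm, ← sum_sub_distrib]
    congr 1
    refine sum_congr rfl fun k _ => ?_
    rw [Nat.choose_succ_succ]
    push_cast
    rw [show p - ((N : ℤ) + 1 - (k + 1)) = p - (N - k) by ring,
      show q - (k : ℤ) - 1 = q - (k + 1) by ring, ← sub_smul]
    congr 1
    ring

theorem mulDiff_pow_comp (φ : W →ₗ[ℂ] W) (N : ℕ) : ∀ (F : ℤ → ℤ → W),
    (mulDiff ^ N) (fun p q => φ (F p q)) = fun p q => φ ((mulDiff ^ N) F p q) := by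
  induction N with
  | zero => intro F; rfl
  | succ N ih =>
    intro F
    rw [mulDiff_pow_succ, mulDiff_pow_succ, ← ih]
    congr 1
    funext p q
    simp only [mulDiff_apply, map_sub]

theorem mulDiff_pow_swap (N : ℕ) : ∀ (F : ℤ → ℤ → W),
    (mulDiff ^ N) (fun p q => F q p) = (-1 : ℤ) ^ N • fun p q => (mulDiff ^ N) F q p := by
  induction N with
  | zero => intro F; simp
  | succ N ih =>
    intro F
    rw [mulDiff_pow_succ, mulDiff_pow_succ,
      show mulDiff (fun p q => F q p) = fun p q => (-mulDiff F) q p by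
      funext p q; simp only [Pi.neg_apply, mulDiff_apply]; abel, ih, map_neg, pow_succ, mul_smul]
    congr 1
    funext p q
    simp

/-- Newton's interpolation formula: a family annihilated by a power of `z₁ - z₂` is determined by
its first few coefficients in `z₁`. -/
theorem newton_formula (N : ℕ) : ∀ (F : ℤ → ℤ → W), (mulDiff ^ N) F = 0 → ∀ m q : ℤ,
    F (-m - 1) q = ∑ j ∈ range N, Ring.choose m j • (mulDiff ^ j) F (-1) (q - m + j) := by
  induction N with
  | zero => intro F hF m q; rw [pow_zero] at hF; change F = 0 at hF; simp [hF]
  | succ N ih =>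
    intro F hF
    rw [mulDiff_pow_succ] at hF
    have ih := ih _ hF
    -- the difference `H` of the two sides is constant along the diagonals and vanishes for `m = 0`
    set H : ℤ → ℤ → W := fun m q => F (-m - 1) q -
      ∑ j ∈ range (N + 1), Ring.choose m j • (mulDiff ^ j) F (-1) (q - m + j) with hH
    have h0 : ∀ q, H 0 q = 0 := by
      intro q
      simp only [hH]
      rw [sum_range_succ', sum_eq_zero]
      · simp
      · intro j _
        rw [Ring.choose_zero_succ, zero_smul]
    have hs : ∀ m q, H (m + 1) (q + 1) = H m q := by
      intro m q
      have h1 := ih m (q + 1)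
      rw [mulDiff_apply, add_sub_cancel_right, show -m - 1 - 1 = -(m + 1) - 1 by ring,
        sub_eq_iff_eq_add] at h1
      simp only [hH, h1, sum_range_succ' _ N, ← mulDiff_pow_succ]
      simp only [Ring.choose_zero_right, pow_zero, one_smul, Nat.cast_zero, add_zero]
      have e : ∀ j : ℕ, Ring.choose (m + 1) (j + 1) = Ring.choose m j + Ring.choose m (j + 1) :=
        fun j => Ring.choose_succ_succ m j
      simp only [e, add_smul, sum_add_distrib]
      push_cast
      simp only [show q + 1 - (m + 1) = q - m by ring,
        show ∀ j : ℤ, q + 1 - m + j = q - m + (j + 1) from fun j => by ring]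
      abel
    have hz : ∀ m q, H m q = 0 := by
      intro m
      induction m with
      | zero => exact h0
      | succ i hi => intro q; rw [← sub_add_cancel q 1, hs, hi]
      | pred i hi => intro q; rw [← hs, sub_add_cancel, hi]
    intro m q
    exact sub_eq_zero.1 (hz m q)

namespace Fld

/-- The commutators of the coefficients of two fields, applied to a vector. -/
def bracketFun (a b : Fld W) (w : W) : ℤ → ℤ → W := fun p q => a p (b q w) - b q (a p w)

/-- Locality of two fields. -/
def Local (a b : Fld W) : Prop := ∃ N : ℕ, ∀ w, (mulDiff ^ N) (bracketFun a b w) = 0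

theorem Local.symm {a b : Fld W} (h : Local a b) : Local b a := by
  obtain ⟨N, hN⟩ := h
  refine ⟨N, fun w => ?_⟩
  have e : bracketFun b a w = fun p q => (-bracketFun a b w) q p := by
    funext p q; simp only [bracketFun, Pi.neg_apply]; abel
  rw [e, mulDiff_pow_swap, map_neg, hN]
  funext p q
  simp

theorem local_one (a : Fld W) : Local one a := by
  refine ⟨0, fun w => ?_⟩
  funext p q
  rw [pow_zero, Module.End.one_apply, bracketFun, one_apply]
  split_ifs <;> simp

theorem Local.isLocal {a b : Fld W} (h : Local a b) : IsLocal (fun p => a p) (fun p => b p) := by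
  obtain ⟨N, hN⟩ := h
  refine ⟨N + 1, N.succ_pos, fun p q w => ?_⟩
  have := congrFun (congrFun (mulDiff_pow_eq_zero (hN w) N.le_succ) p) q
  rw [mulDiff_pow_apply] at this
  simp only [bracketFun, smul_sub, sum_sub_distrib, Pi.zero_apply] at this
  exact sub_eq_zero.1 this

omit [Module ℂ W] in
theorem sum_range_extend (n N : ℕ) (f : ℕ → W) (h : ∀ i, n ≤ i → f i = 0) :
    ∑ i ∈ range (n + N), f i = ∑ i ∈ range n, f i := by
  rw [sum_range_add, sum_eq_zero (s := range N) fun i _ => h _ (by omega), add_zero]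

/-- Products with nonnegative index in terms of commutators. -/
theorem nprod_natCast_apply (a c : Fld W) (j : ℕ) (q : ℤ) (w : W) :
    nprod a j c q w = (mulDiff ^ j) (bracketFun a c w) (-1) q := by
  obtain ⟨N, hN⟩ := c.trunc_sub q w
  obtain ⟨N', hN'⟩ := a.trunc_mode w
  have hz : ∀ i : ℕ, j < i → Ring.choose (j : ℤ) i = 0 := fun i hi => by
    rw [Ring.choose_natCast, Nat.choose_eq_zero_of_lt hi, Nat.cast_zero]
  rw [nprod_apply a j c q w (j + 1 + N) (j + 1 + N') (fun i hi => hN i (by omega))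
    (fun i hi => hN' i (by omega)),
    sum_range_extend (j + 1) N _ fun i hi => by rw [hz _ (by omega), mul_zero, zero_smul],
    sum_range_extend (j + 1) N' _ fun i hi => by rw [hz _ (by omega), mul_zero, zero_smul],
    ← sum_range_reflect (fun i : ℕ => (sgn (j + i) * _) • _),
    ← sum_sub_distrib, mulDiff_pow_apply]
  refine sum_congr rfl fun i hi => ?_
  have hi' : i ≤ j := by simpa [Nat.lt_succ_iff] using hi
  rw [bracketFun, smul_sub, Ring.choose_natCast, Ring.choose_natCast, Nat.add_sub_cancel,
    Nat.choose_symm hi', mode, mode, Nat.cast_sub hi', show (j : ℤ) + (j - i) = j + j - i by ring,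
    ← sgn_add_natCast, sgn_add, sgn_add, sgn_mul_self, one_mul, sgn_natCast]
  rw [show -((j : ℤ) - i) - 1 = -1 - (j - i) by ring, show q - (j : ℤ) + (j - i) = q - i by ring]

/-- The commutator formula for the modes of local fields. -/
theorem Local.comm_modes {a c : Fld W} (h : Local a c) : ∃ N : ℕ, ∀ N' ≥ N, ∀ (m n : ℤ) (w : W),
    a.mode m (c.mode n w) - c.mode n (a.mode m w) =
      ∑ j ∈ range N', Ring.choose m j • (nprod a j c).mode (m + n - j) w := by
  obtain ⟨N, hN⟩ := h
  refine ⟨N, fun N' hN' m n w => ?_⟩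
  have := newton_formula N' _ (mulDiff_pow_eq_zero (hN w) hN') m (-n - 1)
  rw [bracketFun] at this
  rw [mode, mode, this]
  refine sum_congr rfl fun j _ => ?_
  rw [mode, nprod_natCast_apply, show -n - 1 - m + (j : ℤ) = -(m + n - j) - 1 by ring]

/-- The commutator formula for the operators of taking products with local fields. -/
theorem Local.comm_nprod {a c : Fld W} (h : Local a c) :
    ∃ N : ℕ, ∀ N' ≥ N, ∀ (k l : ℤ) (d : Fld W),
    nprod a k (nprod c l d) - nprod c l (nprod a k d) =
      ∑ j ∈ range N', Ring.choose k j • nprod (nprod a j c) (k + l - j) d := by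
  obtain ⟨N, hN⟩ := h.comm_modes
  exact ⟨N, fun N' hN' k l d => nprod_comm (range N') a c (fun j => nprod a j c)
    (fun j m _ => Ring.choose m j) (fun j => j) isModeWeight_choose (hN N' hN') k l d⟩

end Fld

/-! ### Dong's lemma -/

/-- Multiplication by `z₁ - z₂` on families of coefficients of `z₁^p z₂^q z₃^r`. -/
def diff₁₂ : Module.End ℂ (ℤ → ℤ → ℤ → W) where
  toFun G p q r := G (p - 1) q r - G p (q - 1) r
  map_add' F G := by funext p q r; simp only [Pi.add_apply]; abel
  map_smul' r F := by funext p q r; simp only [Pi.smul_apply, smul_sub, RingHom.id_apply]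

/-- Multiplication by `z₁ - z₃` on families of coefficients of `z₁^p z₂^q z₃^r`. -/
def diff₁₃ : Module.End ℂ (ℤ → ℤ → ℤ → W) where
  toFun G p q r := G (p - 1) q r - G p q (r - 1)
  map_add' F G := by funext p q r; simp only [Pi.add_apply]; abel
  map_smul' r F := by funext p q r; simp only [Pi.smul_apply, smul_sub, RingHom.id_apply]

/-- Multiplication by `z₂ - z₃` on families of coefficients of `z₁^p z₂^q z₃^r`. -/
def diff₂₃ : Module.End ℂ (ℤ → ℤ → ℤ → W) where
  toFun G p q r := G p (q - 1) r - G p q (r - 1)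
  map_add' F G := by funext p q r; simp only [Pi.add_apply]; abel
  map_smul' r F := by funext p q r; simp only [Pi.smul_apply, smul_sub, RingHom.id_apply]

theorem diff₁₂_apply (G : ℤ → ℤ → ℤ → W) (p q r : ℤ) :
    diff₁₂ G p q r = G (p - 1) q r - G p (q - 1) r := rfl
theorem diff₁₃_apply (G : ℤ → ℤ → ℤ → W) (p q r : ℤ) :
    diff₁₃ G p q r = G (p - 1) q r - G p q (r - 1) := rfl
theorem diff₂₃_apply (G : ℤ → ℤ → ℤ → W) (p q r : ℤ) :
    diff₂₃ G p q r = G p (q - 1) r - G p q (r - 1) := rfl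

theorem commute_diff₁₂_diff₁₃ : Commute (diff₁₂ : Module.End ℂ (ℤ → ℤ → ℤ → W)) diff₁₃ := by
  refine LinearMap.ext fun G => ?_
  funext p q r
  simp only [Module.End.mul_apply, diff₁₂_apply, diff₁₃_apply]
  abel

theorem commute_diff₁₂_diff₂₃ : Commute (diff₁₂ : Module.End ℂ (ℤ → ℤ → ℤ → W)) diff₂₃ := by
  refine LinearMap.ext fun G => ?_
  funext p q r
  simp only [Module.End.mul_apply, diff₁₂_apply, diff₂₃_apply]
  abel

theorem commute_diff₁₃_diff₂₃ : Commute (diff₁₃ : Module.End ℂ (ℤ → ℤ → ℤ → W)) diff₂₃ := by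
  refine LinearMap.ext fun G => ?_
  funext p q r
  simp only [Module.End.mul_apply, diff₁₃_apply, diff₂₃_apply]
  abel

theorem diff₁₂_pow_apply (N : ℕ) : ∀ (G : ℤ → ℤ → ℤ → W) (p q r : ℤ),
    (diff₁₂ ^ N) G p q r = (mulDiff ^ N) (fun p q => G p q r) p q := by
  induction N with
  | zero => intro G p q r; rfl
  | succ N ih =>
    intro G p q r
    rw [pow_succ, Module.End.mul_apply, ih, mulDiff_pow_succ]
    rfl

theorem diff₁₃_pow_apply (N : ℕ) : ∀ (G : ℤ → ℤ → ℤ → W) (p q r : ℤ),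
    (diff₁₃ ^ N) G p q r = (mulDiff ^ N) (fun p r => G p q r) p r := by
  induction N with
  | zero => intro G p q r; rfl
  | succ N ih =>
    intro G p q r
    rw [pow_succ, Module.End.mul_apply, ih, mulDiff_pow_succ]
    rfl

theorem diff₂₃_pow_apply (N : ℕ) : ∀ (G : ℤ → ℤ → ℤ → W) (p q r : ℤ),
    (diff₂₃ ^ N) G p q r = (mulDiff ^ N) (fun q r => G p q r) q r := by
  induction N with
  | zero => intro G p q r; rfl
  | succ N ih =>
    intro G p q r
    rw [pow_succ, Module.End.mul_apply, ih, mulDiff_pow_succ]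
    rfl

/-- Families for which the residue in `z₁` of a product with `(z₁ - z₂)^n`, expanded in nonnegative
powers of `z₂`, exists. -/
def leftSummable : Submodule ℂ (ℤ → ℤ → ℤ → W) where
  carrier := {G | ∀ q r, ∃ N : ℤ, ∀ q' ≤ q - N, ∀ p, G p q' r = 0}
  zero_mem' _ _ := ⟨0, fun _ _ _ => rfl⟩
  add_mem' {F G} hF hG q r := by
    obtain ⟨N, hN⟩ := hF q r
    obtain ⟨N', hN'⟩ := hG q r
    exact ⟨max N N', fun q' hq p => by
      rw [Pi.add_apply, Pi.add_apply, Pi.add_apply, hN q' (by omega), hN' q' (by omega), add_zero]⟩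
  smul_mem' c G hG q r := by
    obtain ⟨N, hN⟩ := hG q r
    exact ⟨N, fun q' hq p => by
      rw [Pi.smul_apply, Pi.smul_apply, Pi.smul_apply, hN q' hq, smul_zero]⟩

/-- Families for which the residue in `z₁` of a product with `(z₁ - z₂)^n`, expanded in nonnegative
powers of `z₁`, exists. -/
def rightSummable : Submodule ℂ (ℤ → ℤ → ℤ → W) where
  carrier := {G | ∀ p r, ∃ N : ℤ, ∀ p' ≤ p - N, ∀ q, G p' q r = 0}
  zero_mem' _ _ := ⟨0, fun _ _ _ => rfl⟩
  add_mem' {F G} hF hG q r := by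
    obtain ⟨N, hN⟩ := hF q r
    obtain ⟨N', hN'⟩ := hG q r
    exact ⟨max N N', fun q' hq p => by
      rw [Pi.add_apply, Pi.add_apply, Pi.add_apply, hN q' (by omega), hN' q' (by omega), add_zero]⟩
  smul_mem' c G hG q r := by
    obtain ⟨N, hN⟩ := hG q r
    exact ⟨N, fun q' hq p => by
      rw [Pi.smul_apply, Pi.smul_apply, Pi.smul_apply, hN q' hq, smul_zero]⟩

theorem leftSummable_diff₁₂ {G : ℤ → ℤ → ℤ → W} (h : G ∈ leftSummable) :
    diff₁₂ G ∈ leftSummable := by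
  intro q r
  obtain ⟨N, hN⟩ := h q r
  exact ⟨max N 0, fun q' hq p => by
    rw [diff₁₂_apply, hN q' (by omega), hN (q' - 1) (by omega), sub_zero]⟩

theorem leftSummable_diff₁₃ {G : ℤ → ℤ → ℤ → W} (h : G ∈ leftSummable) :
    diff₁₃ G ∈ leftSummable := by
  intro q r
  obtain ⟨N, hN⟩ := h q r
  obtain ⟨N', hN'⟩ := h q (r - 1)
  exact ⟨max N N', fun q' hq p => by
    rw [diff₁₃_apply, hN q' (by omega), hN' q' (by omega), sub_zero]⟩

theorem leftSummable_diff₂₃ {G : ℤ → ℤ → ℤ → W} (h : G ∈ leftSummable) :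
    diff₂₃ G ∈ leftSummable := by
  intro q r
  obtain ⟨N, hN⟩ := h q r
  obtain ⟨N', hN'⟩ := h q (r - 1)
  exact ⟨max (max N N') 0, fun q' hq p => by
    rw [diff₂₃_apply, hN (q' - 1) (by omega), hN' q' (by omega), sub_zero]⟩

theorem rightSummable_diff₁₂ {G : ℤ → ℤ → ℤ → W} (h : G ∈ rightSummable) :
    diff₁₂ G ∈ rightSummable := by
  intro q r
  obtain ⟨N, hN⟩ := h q r
  exact ⟨max N 0, fun q' hq p => by
    rw [diff₁₂_apply, hN q' (by omega), hN (q' - 1) (by omega), sub_zero]⟩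

theorem rightSummable_diff₁₃ {G : ℤ → ℤ → ℤ → W} (h : G ∈ rightSummable) :
    diff₁₃ G ∈ rightSummable := by
  intro q r
  obtain ⟨N, hN⟩ := h q r
  obtain ⟨N', hN'⟩ := h q (r - 1)
  exact ⟨max (max N N') 0, fun q' hq p => by
    rw [diff₁₃_apply, hN (q' - 1) (by omega), hN' q' (by omega), sub_zero]⟩

theorem rightSummable_diff₂₃ {G : ℤ → ℤ → ℤ → W} (h : G ∈ rightSummable) :
    diff₂₃ G ∈ rightSummable := by
  intro q r
  obtain ⟨N, hN⟩ := h q r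
  obtain ⟨N', hN'⟩ := h q (r - 1)
  exact ⟨max N N', fun q' hq p => by
    rw [diff₂₃_apply, hN q' (by omega), hN' q' (by omega), sub_zero]⟩

theorem pow_mem_of_mem {S : Submodule ℂ (ℤ → ℤ → ℤ → W)} {D : Module.End ℂ (ℤ → ℤ → ℤ → W)}
    (hD : ∀ {G}, G ∈ S → D G ∈ S) (N : ℕ) {G : ℤ → ℤ → ℤ → W} (hG : G ∈ S) : (D ^ N) G ∈ S := by
  induction N with
  | zero => exact hG
  | succ N ih => rw [pow_succ', Module.End.mul_apply]; exact hD ih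

/-- The residue in `z₁` of `(z₁ - z₂)^n G`, expanded in nonnegative powers of `z₂`. -/
def leftRes (n : ℤ) (G : ℤ → ℤ → ℤ → W) : ℤ → ℤ → W := fun q r =>
  ∑ᶠ i : ℕ, ((-1) ^ i * Ring.choose n i) • G (i - n - 1) (q - i) r

/-- The residue in `z₁` of `(z₁ - z₂)^n G`, expanded in nonnegative powers of `z₁`. -/
def rightRes (n : ℤ) (G : ℤ → ℤ → ℤ → W) : ℤ → ℤ → W := fun q r =>
  ∑ᶠ i : ℕ, (sgn (n + i) * Ring.choose n i) • G (-i - 1) (q - n + i) r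

omit [Module ℂ W] in
theorem finsum_nat_eq_sum {f : ℕ → W} (N : ℕ) (h : ∀ i, N ≤ i → f i = 0) :
    ∑ᶠ i, f i = ∑ i ∈ range N, f i :=
  finsum_eq_sum_of_support_subset _ fun i hi => by
    by_contra hc
    exact hi (h i (by simpa using hc))

omit [Module ℂ W] in
theorem leftRes_apply (n : ℤ) (G : ℤ → ℤ → ℤ → W) (q r : ℤ) (N : ℕ)
    (h : ∀ i : ℕ, N ≤ i → ∀ p, G p (q - i) r = 0) :
    leftRes n G q r =
      ∑ i ∈ range N, ((-1) ^ i * Ring.choose n i) • G (i - n - 1) (q - i) r :=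
  finsum_nat_eq_sum N fun i hi => by rw [h i hi, smul_zero]

omit [Module ℂ W] in
theorem rightRes_apply (n : ℤ) (G : ℤ → ℤ → ℤ → W) (q r : ℤ) (N : ℕ)
    (h : ∀ i : ℕ, N ≤ i → ∀ q, G (-i - 1) q r = 0) :
    rightRes n G q r =
      ∑ i ∈ range N, (sgn (n + i) * Ring.choose n i) • G (-i - 1) (q - n + i) r :=
  finsum_nat_eq_sum N fun i hi => by rw [h i hi, smul_zero]

theorem leftSummable.bound {G : ℤ → ℤ → ℤ → W} (h : G ∈ leftSummable) (q r : ℤ) :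
    ∃ N : ℕ, ∀ q' ≤ q - N, ∀ p, G p q' r = 0 := by
  obtain ⟨N, hN⟩ := h q r
  exact ⟨N.toNat, fun q' hq => hN q' (by omega)⟩

theorem rightSummable.bound {G : ℤ → ℤ → ℤ → W} (h : G ∈ rightSummable) (r : ℤ) :
    ∃ N : ℕ, ∀ p' ≤ -(N : ℤ), ∀ q, G p' q r = 0 := by
  obtain ⟨N, hN⟩ := h 0 r
  exact ⟨N.toNat, fun q' hq => hN q' (by omega)⟩

theorem leftRes_diff₁₂ (n : ℤ) {G : ℤ → ℤ → ℤ → W} (h : G ∈ leftSummable) :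
    leftRes n (diff₁₂ G) = leftRes (n + 1) G := by
  funext q r
  obtain ⟨N, hN⟩ := leftSummable.bound h q r
  rw [leftRes_apply n _ q r N fun i hi p => by
      rw [diff₁₂_apply, hN _ (by omega), hN _ (by omega), sub_zero],
    leftRes_apply (n + 1) _ q r (N + 1) fun i hi p => hN _ (by omega) _]
  simp only [diff₁₂_apply, smul_sub, sum_sub_distrib]
  have e : ∀ i : ℕ, Ring.choose (n + 1) (i + 1) = Ring.choose n i + Ring.choose n (i + 1) :=
    fun i => Ring.choose_succ_succ n i
  rw [sum_range_succ' _ N]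
  simp only [e, mul_add, add_smul, sum_add_distrib]
  have h1 : ∑ i ∈ range N, ((-1) ^ i * Ring.choose n i) • G (i - n - 1 - 1) (q - i) r =
      ∑ i ∈ range N, ((-1) ^ (i + 1) * Ring.choose n (i + 1)) •
        G ((i + 1 : ℕ) - (n + 1) - 1) (q - (i + 1 : ℕ)) r +
      ((-1) ^ 0 * Ring.choose (n + 1) 0) • G ((0 : ℕ) - (n + 1) - 1) (q - (0 : ℕ)) r := by
    have := sum_range_succ' (fun i : ℕ => ((-1) ^ i * Ring.choose n i) •
      G (i - n - 1 - 1) (q - i) r) N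
    rw [sum_range_succ, hN (q - N) le_rfl, smul_zero, add_zero] at this
    rw [this]
    simp only [Ring.choose_zero_right, show ∀ j : ℤ, j - (n + 1) - 1 = j - n - 1 - 1 from
      fun j => by ring]
  rw [h1, sub_eq_add_neg, ← sum_neg_distrib]
  have h2 : ∑ i ∈ range N, -(((-1) ^ i * Ring.choose n i) • G (i - n - 1) (q - i - 1) r) =
      ∑ i ∈ range N, ((-1) ^ (i + 1) * Ring.choose n i) •
        G ((i + 1 : ℕ) - (n + 1) - 1) (q - (i + 1 : ℕ)) r := by
    refine sum_congr rfl fun i _ => ?_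
    push_cast
    rw [← neg_smul, show (i : ℤ) + 1 - (n + 1) - 1 = i - n - 1 by ring,
      show q - ((i : ℤ) + 1) = q - i - 1 by ring]
    congr 1
    ring
  rw [h2]
  abel

theorem rightRes_diff₁₂ (n : ℤ) {G : ℤ → ℤ → ℤ → W} (h : G ∈ rightSummable) :
    rightRes n (diff₁₂ G) = rightRes (n + 1) G := by
  funext q r
  obtain ⟨N, hN⟩ := rightSummable.bound h r
  rw [rightRes_apply n _ q r N fun i hi p => by
      rw [diff₁₂_apply, hN _ (by omega), hN _ (by omega), sub_zero],
    rightRes_apply (n + 1) _ q r (N + 1) fun i hi p => hN _ (by omega) _]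
  simp only [diff₁₂_apply, smul_sub, sum_sub_distrib]
  have e : ∀ i : ℕ, Ring.choose (n + 1) (i + 1) = Ring.choose n i + Ring.choose n (i + 1) :=
    fun i => Ring.choose_succ_succ n i
  rw [sum_range_succ' _ N]
  simp only [e, mul_add, add_smul, sum_add_distrib]
  have h1 : -∑ i ∈ range N, (sgn (n + i) * Ring.choose n i) • G (-i - 1) (q - n + i - 1) r =
      ∑ i ∈ range N, (sgn (n + 1 + (i + 1 : ℕ)) * Ring.choose n (i + 1)) •
        G (-(i + 1 : ℕ) - 1) (q - (n + 1) + (i + 1 : ℕ)) r +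
      (sgn (n + 1 + (0 : ℕ)) * Ring.choose (n + 1) 0) •
        G (-(0 : ℕ) - 1) (q - (n + 1) + (0 : ℕ)) r := by
    have := sum_range_succ' (fun i : ℕ => (sgn (n + i) * Ring.choose n i) •
      G (-i - 1) (q - n + i - 1) r) N
    rw [sum_range_succ, hN (-N - 1) (by omega), smul_zero, add_zero] at this
    rw [this, neg_add, ← sum_neg_distrib, ← neg_smul]
    simp only [Ring.choose_zero_right, ← neg_smul,
      show ∀ j : ℤ, q - (n + 1) + j = q - n + j - 1 from fun j => by ring,
      show ∀ j : ℤ, sgn (n + 1 + j) = -sgn (n + j) from fun j => by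
        rw [← neg_neg (sgn (n + 1 + j)), ← sgn_sub_one]; congr 2; ring, neg_mul]
  rw [sub_eq_add_neg, h1]
  have h2 : ∑ i ∈ range N, (sgn (n + i) * Ring.choose n i) • G (-i - 1 - 1) (q - n + i) r =
      ∑ i ∈ range N, (sgn (n + 1 + (i + 1 : ℕ)) * Ring.choose n i) •
        G (-(i + 1 : ℕ) - 1) (q - (n + 1) + (i + 1 : ℕ)) r := by
    refine sum_congr rfl fun i _ => ?_
    push_cast
    rw [show -((i : ℤ) + 1) - 1 = -i - 1 - 1 by ring,
      show q - (n + 1) + ((i : ℤ) + 1) = q - n + i by ring,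
      show n + 1 + ((i : ℤ) + 1) = n + i + (1 + 1) by ring, sgn_add (n + i), sgn_add 1 1,
      sgn_mul_self, mul_one]
  rw [h2]
  abel

theorem mulDiff_leftRes (n : ℤ) {G : ℤ → ℤ → ℤ → W} (h : G ∈ leftSummable) :
    mulDiff (leftRes n G) = leftRes n (diff₂₃ G) := by
  funext q r
  obtain ⟨N, hN⟩ := leftSummable.bound h q r
  obtain ⟨N', hN'⟩ := leftSummable.bound h q (r - 1)
  rw [mulDiff_apply, leftRes_apply n G (q - 1) r (N + N') fun i hi p => hN _ (by omega) _,
    leftRes_apply n G q (r - 1) (N + N') fun i hi p => hN' _ (by omega) _,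
    leftRes_apply n _ q r (N + N') fun i hi p => by
      rw [diff₂₃_apply, hN _ (by omega), hN' _ (by omega), sub_zero], ← sum_sub_distrib]
  refine sum_congr rfl fun i _ => ?_
  rw [diff₂₃_apply, smul_sub, show q - 1 - (i : ℤ) = q - i - 1 by ring]

theorem mulDiff_rightRes (n : ℤ) {G : ℤ → ℤ → ℤ → W} (h : G ∈ rightSummable) :
    mulDiff (rightRes n G) = rightRes n (diff₂₃ G) := by
  funext q r
  obtain ⟨N, hN⟩ := rightSummable.bound h r
  obtain ⟨N', hN'⟩ := rightSummable.bound h (r - 1)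
  rw [mulDiff_apply, rightRes_apply n G (q - 1) r (N + N') fun i hi p => hN _ (by omega) _,
    rightRes_apply n G q (r - 1) (N + N') fun i hi p => hN' _ (by omega) _,
    rightRes_apply n _ q r (N + N') fun i hi p => by
      rw [diff₂₃_apply, hN _ (by omega), hN' _ (by omega), sub_zero], ← sum_sub_distrib]
  refine sum_congr rfl fun i _ => ?_
  rw [diff₂₃_apply, smul_sub, show q - 1 - n + (i : ℤ) = q - n + i - 1 by ring]

theorem leftRes_sub (n : ℤ) {F G : ℤ → ℤ → ℤ → W} (hF : F ∈ leftSummable) (hG : G ∈ leftSummable) :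
    leftRes n (F - G) = leftRes n F - leftRes n G := by
  funext q r
  obtain ⟨N, hN⟩ := leftSummable.bound hF q r
  obtain ⟨N', hN'⟩ := leftSummable.bound hG q r
  rw [Pi.sub_apply, Pi.sub_apply,
    leftRes_apply n F q r (N + N') fun i hi p => hN _ (by omega) _,
    leftRes_apply n G q r (N + N') fun i hi p => hN' _ (by omega) _,
    leftRes_apply n _ q r (N + N') fun i hi p => by
      rw [Pi.sub_apply, Pi.sub_apply, Pi.sub_apply, hN _ (by omega), hN' _ (by omega), sub_zero],
    ← sum_sub_distrib]
  refine sum_congr rfl fun i _ => ?_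
  rw [← smul_sub]; rfl

theorem rightRes_sub (n : ℤ) {F G : ℤ → ℤ → ℤ → W} (hF : F ∈ rightSummable)
    (hG : G ∈ rightSummable) : rightRes n (F - G) = rightRes n F - rightRes n G := by
  funext q r
  obtain ⟨N, hN⟩ := rightSummable.bound hF r
  obtain ⟨N', hN'⟩ := rightSummable.bound hG r
  rw [Pi.sub_apply, Pi.sub_apply,
    rightRes_apply n F q r (N + N') fun i hi p => hN _ (by omega) _,
    rightRes_apply n G q r (N + N') fun i hi p => hN' _ (by omega) _,
    rightRes_apply n _ q r (N + N') fun i hi p => by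
      rw [Pi.sub_apply, Pi.sub_apply, Pi.sub_apply, hN _ (by omega), hN' _ (by omega), sub_zero],
    ← sum_sub_distrib]
  refine sum_congr rfl fun i _ => ?_
  rw [← smul_sub]; rfl

theorem diff₂₃_eq (G : ℤ → ℤ → ℤ → W) : diff₂₃ G = diff₁₃ G - diff₁₂ G := by
  funext p q r
  simp only [Pi.sub_apply, diff₂₃_apply, diff₁₃_apply, diff₁₂_apply]
  abel

theorem leftRes_natCast (n : ℕ) {G : ℤ → ℤ → ℤ → W} (h : G ∈ leftSummable) :
    leftRes n G = fun q r => (diff₁₂ ^ n) G (-1) q r := by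
  induction n generalizing G with
  | zero =>
    funext q r
    rw [leftRes, finsum_nat_eq_sum 1]
    · simp
    · intro i hi
      obtain ⟨j, rfl⟩ := Nat.exists_eq_add_of_le' hi
      rw [Nat.cast_zero, Ring.choose_zero_succ, mul_zero, zero_smul]
  | succ n ih =>
    rw [Nat.cast_succ, ← leftRes_diff₁₂ _ h, ih (leftSummable_diff₁₂ h), pow_succ]
    rfl

theorem rightRes_natCast (n : ℕ) {G : ℤ → ℤ → ℤ → W} (h : G ∈ rightSummable) :
    rightRes n G = fun q r => (diff₁₂ ^ n) G (-1) q r := by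
  induction n generalizing G with
  | zero =>
    funext q r
    rw [rightRes, finsum_nat_eq_sum 1]
    · simp [sgn]
    · intro i hi
      obtain ⟨j, rfl⟩ := Nat.exists_eq_add_of_le' hi
      rw [Nat.cast_zero, Ring.choose_zero_succ, mul_zero, zero_smul]
  | succ n ih =>
    rw [Nat.cast_succ, ← rightRes_diff₁₂ _ h, ih (rightSummable_diff₁₂ h), pow_succ]
    rfl

omit [Module ℂ W] in
theorem res_zero (n : ℤ) : leftRes n (0 : ℤ → ℤ → ℤ → W) - rightRes n 0 = 0 := by
  funext q r
  simp [leftRes, rightRes]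

/-- The core of Dong's lemma: a residue of the difference of two families that agree up to a power
of `z₁ - z₂` and that vanish up to a power of `z₁ - z₃` is annihilated by a power of `z₂ - z₃`. The
induction writes one factor `z₂ - z₃` as `(z₁ - z₃) - (z₁ - z₂)`; the first summand lowers `e` and
the second one raises `n`. -/
theorem res_sub_res_eq_zero (N : ℕ) (K : ℕ) : ∀ (n : ℤ) (e : ℕ) (A B : ℤ → ℤ → ℤ → W),
    A ∈ leftSummable → B ∈ rightSummable → (diff₁₂ ^ N) A = (diff₁₂ ^ N) B →
    (diff₁₃ ^ e) A = 0 → (diff₁₃ ^ e) B = 0 → (N - n).toNat + e ≤ K →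
    (mulDiff ^ K) (leftRes n A - rightRes n B) = 0 := by
  induction K with
  | zero =>
    intro n e A B hA hB _ hA3 hB3 hK
    obtain rfl : e = 0 := by omega
    rw [pow_zero, Module.End.one_apply] at hA3 hB3
    subst hA3 hB3
    rw [res_zero, map_zero]
  | succ K ih =>
    intro n e A B hA hB h12 hA3 hB3 hK
    by_cases hn : (N : ℤ) ≤ n
    · obtain ⟨m, rfl⟩ := Int.eq_ofNat_of_zero_le ((Int.natCast_nonneg N).trans hn)
      have hm : N ≤ m := by exact_mod_cast hn
      obtain ⟨d, rfl⟩ := Nat.exists_eq_add_of_le' hm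
      have h12' : (diff₁₂ ^ (d + N)) A = (diff₁₂ ^ (d + N)) B := by
        rw [pow_add, Module.End.mul_apply, Module.End.mul_apply, h12]
      rw [leftRes_natCast _ hA, rightRes_natCast _ hB, h12', sub_self, map_zero]
    · cases e with
      | zero =>
        rw [pow_zero, Module.End.one_apply] at hA3 hB3
        subst hA3 hB3
        rw [res_zero, map_zero]
      | succ e =>
        rw [mulDiff_pow_succ, map_sub, mulDiff_leftRes n hA, mulDiff_rightRes n hB, diff₂₃_eq,
          diff₂₃_eq, leftRes_sub n (leftSummable_diff₁₃ hA) (leftSummable_diff₁₂ hA),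
          rightRes_sub n (rightSummable_diff₁₃ hB) (rightSummable_diff₁₂ hB),
          leftRes_diff₁₂ n hA, rightRes_diff₁₂ n hB, sub_sub_sub_comm, map_sub,
          ih n e _ _ (leftSummable_diff₁₃ hA) (rightSummable_diff₁₃ hB) ?_ ?_ ?_ (by omega),
          ih (n + 1) (e + 1) _ _ hA hB h12 hA3 hB3 (by omega), sub_zero]
        · rw [← Module.End.mul_apply, ← Module.End.mul_apply,
            (commute_diff₁₂_diff₁₃.pow_left N).eq, Module.End.mul_apply, Module.End.mul_apply, h12]
        · rw [← Module.End.mul_apply, ← pow_succ, hA3]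
        · rw [← Module.End.mul_apply, ← pow_succ, hB3]

theorem mulDiff_pow_leftRes (n : ℤ) (N : ℕ) {G : ℤ → ℤ → ℤ → W} (h : G ∈ leftSummable) :
    (mulDiff ^ N) (leftRes n G) = leftRes n ((diff₂₃ ^ N) G) := by
  induction N generalizing G with
  | zero => rfl
  | succ N ih =>
    rw [mulDiff_pow_succ, mulDiff_leftRes n h, ih (leftSummable_diff₂₃ h), pow_succ]
    rfl

theorem mulDiff_pow_rightRes (n : ℤ) (N : ℕ) {G : ℤ → ℤ → ℤ → W} (h : G ∈ rightSummable) :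
    (mulDiff ^ N) (rightRes n G) = rightRes n ((diff₂₃ ^ N) G) := by
  induction N generalizing G with
  | zero => rfl
  | succ N ih =>
    rw [mulDiff_pow_succ, mulDiff_rightRes n h, ih (rightSummable_diff₂₃ h), pow_succ]
    rfl

namespace Fld

/-- Dong's lemma: locality is preserved by products of fields. -/
theorem Local.nprod {a b c : Fld W} (hab : Local a b) (hac : Local a c) (hbc : Local b c) (n : ℤ) :
    Local (nprod a n b) c := by
  obtain ⟨N₁, h₁⟩ := hab
  obtain ⟨N₂, h₂⟩ := hac
  obtain ⟨N₃, h₃⟩ := hbc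
  refine ⟨(N₁ - n).toNat + N₂ + N₃, fun w => ?_⟩
  set A : ℤ → ℤ → ℤ → W := fun p q r => a p (b q (c r w)) - c r (a p (b q w)) with hA
  set B : ℤ → ℤ → ℤ → W := fun p q r => b q (a p (c r w)) - c r (b q (a p w)) with hB
  have hAs : A ∈ leftSummable := by
    intro q r
    obtain ⟨N, hN⟩ := b.trunc (c r w)
    obtain ⟨N', hN'⟩ := b.trunc w
    refine ⟨q - min N N' + 1, fun q' hq p => ?_⟩
    simp only [hA]
    rw [hN q' (by omega), hN' q' (by omega), map_zero, map_zero, sub_zero]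
  have hBs : B ∈ rightSummable := by
    intro p r
    obtain ⟨N, hN⟩ := a.trunc (c r w)
    obtain ⟨N', hN'⟩ := a.trunc w
    refine ⟨p - min N N' + 1, fun q' hq p => ?_⟩
    simp only [hB]
    rw [hN q' (by omega), hN' q' (by omega), map_zero, map_zero, sub_zero]
  have hF : bracketFun (Fld.nprod a n b) c w = leftRes n A - rightRes n B := by
    funext q r
    obtain ⟨N, hN⟩ := b.trunc_sub q (c r w)
    obtain ⟨N', hN'⟩ := b.trunc_sub q w
    obtain ⟨M, hM⟩ := a.trunc_mode (c r w)
    obtain ⟨M', hM'⟩ := a.trunc_mode w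
    rw [Pi.sub_apply, Pi.sub_apply, leftRes_apply n A q r (N + N') fun i hi p => by
        simp only [hA]
        rw [hN i (by omega), hN' i (by omega), map_zero, map_zero, sub_zero],
      rightRes_apply n B q r (M + M') fun i hi p => by
        simp only [hB]
        have e1 := hM i (by omega)
        have e2 := hM' i (by omega)
        rw [mode] at e1 e2
        rw [e1, e2, map_zero, map_zero, sub_zero],
      bracketFun, nprod_apply a n b q _ (N + N') (M + M') (fun i hi => hN i (by omega))
        (fun i hi => hM i (by omega)), nprod_apply a n b q _ (N + N') (M + M')
        (fun i hi => hN' i (by omega)) (fun i hi => hM' i (by omega))]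
    simp only [hA, hB, map_sub, map_sum, map_zsmul, smul_sub, sum_sub_distrib, mode,
      show ∀ i : ℕ, -(n - (i : ℤ)) - 1 = i - n - 1 from fun i => by ring]
    abel
  -- `A` and `B` are sums of a term with the commutator `[b, c]`, removed by a power of `z₂ - z₃`,
  -- and a term with the commutator `[a, c]`, removed by a power of `z₁ - z₃`
  have h13 : ∀ G₁ G₂ : ℤ → ℤ → ℤ → W, (diff₂₃ ^ N₃) G₁ = 0 → (diff₁₃ ^ N₂) G₂ = 0 →
      (diff₁₃ ^ N₂) ((diff₂₃ ^ N₃) (G₁ + G₂)) = 0 := by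
    intro G₁ G₂ hG₁ hG₂
    rw [map_add, hG₁, zero_add, ← Module.End.mul_apply, (commute_diff₁₃_diff₂₃.pow_pow N₂ N₃).eq,
      Module.End.mul_apply, hG₂, map_zero]
  have h13A : (diff₁₃ ^ N₂) ((diff₂₃ ^ N₃) A) = 0 := by
    have e : A = (fun p q r => a p (bracketFun b c w q r)) +
        fun p q r => bracketFun a c (b q w) p r := by
      funext p q r
      simp only [hA, bracketFun, Pi.add_apply, map_sub]
      abel
    rw [e]
    refine h13 _ _ ?_ ?_
    · funext p q r
      rw [diff₂₃_pow_apply, mulDiff_pow_comp, h₃]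
      exact map_zero _
    · funext p q r
      rw [diff₁₃_pow_apply, h₂]
      rfl
  have h13B : (diff₁₃ ^ N₂) ((diff₂₃ ^ N₃) B) = 0 := by
    have e : B = (fun p q r => bracketFun b c (a p w) q r) +
        fun p q r => b q (bracketFun a c w p r) := by
      funext p q r
      simp only [hB, bracketFun, Pi.add_apply, map_sub]
      abel
    rw [e]
    refine h13 _ _ ?_ ?_
    · funext p q r
      rw [diff₂₃_pow_apply, h₃]
      rfl
    · funext p q r
      rw [diff₁₃_pow_apply, mulDiff_pow_comp, h₂]
      exact map_zero _
  have h12 : (diff₁₂ ^ N₁) A = (diff₁₂ ^ N₁) B := by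
    rw [← sub_eq_zero, ← map_sub]
    funext p q r
    rw [diff₁₂_pow_apply]
    have e : (fun p q => (A - B) p q r) = bracketFun a b (c r w) -
        fun p q => c r (bracketFun a b w p q) := by
      funext p q
      simp only [hA, hB, bracketFun, Pi.sub_apply, map_sub]
      abel
    rw [e, map_sub, h₁, mulDiff_pow_comp, h₁]
    simp
  rw [hF, pow_add, Module.End.mul_apply, map_sub, mulDiff_pow_leftRes n _ hAs,
    mulDiff_pow_rightRes n _ hBs]
  refine res_sub_res_eq_zero N₁ _ n N₂ _ _ (pow_mem_of_mem leftSummable_diff₂₃ _ hAs)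
    (pow_mem_of_mem rightSummable_diff₂₃ _ hBs) ?_ h13A h13B le_rfl
  rw [← Module.End.mul_apply, ← Module.End.mul_apply,
    (commute_diff₁₂_diff₂₃.pow_pow N₁ N₃).eq, Module.End.mul_apply, Module.End.mul_apply, h12]

end Fld

end Fields

/-! ### Representations of the Lie algebra of matrix differential operators -/

section Rep

-- the commutator bracket of `Module.End` is not a global instance
attribute [local instance] LieRing.ofAssociativeRing

variable {n : ℕ} {ℓ : Fin n → ℕ} {χ : ℂ}

/-- The element `t^m ∂_t^r E_{i,j}` of the Lie subalgebra. -/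
def basisElt (a : DiffIdx n) (h : ℓ a.col ≤ a.ord) : GlSub ℓ :=
  ⟨(diffMatrix n).basisVec a, by
    change Finsupp.single a (1 : ℂ) ∈ Finsupp.supported ℂ ℂ {a : DiffIdx n | ℓ a.col ≤ a.ord}
    exact Finsupp.single_mem_supported ℂ 1 h⟩

/-- The elements `t^m ∂_t^r E_{i,j}` and `κ` span the Lie algebra. -/
theorem glSub_span (S : Submodule ℂ (GlSub ℓ)) (h : ∀ a ha, basisElt a ha ∈ S)
    (hκ : kappa ℓ ∈ S) (x : GlSub ℓ) : x ∈ S := by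
  have key : ∀ u ∈ Submodule.span ℂ ((fun a => Finsupp.single a (1 : ℂ)) ''
      {a : DiffIdx n | ℓ a.col ≤ a.ord}), ∃ y ∈ S, y.1 = ((u, 0) : (DiffIdx n →₀ ℂ) × ℂ) := by
    intro u hu
    induction hu using Submodule.span_induction with
    | mem x hx =>
      obtain ⟨a, ha, rfl⟩ := hx
      exact ⟨_, h a ha, rfl⟩
    | zero => exact ⟨0, S.zero_mem, rfl⟩
    | add x y hx hy hx' hy' =>
      obtain ⟨x', h1, h2⟩ := hx'
      obtain ⟨y', h3, h4⟩ := hy'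
      refine ⟨x' + y', S.add_mem h1 h3, ?_⟩
      change x'.1 + y'.1 = _
      rw [h2, h4]
      exact Prod.ext rfl (add_zero (0 : ℂ))
    | smul r x hx hx' =>
      obtain ⟨x', h1, h2⟩ := hx'
      refine ⟨r • x', S.smul_mem r h1, ?_⟩
      change r • x'.1 = _
      rw [h2]
      exact Prod.ext rfl (mul_zero r)
  obtain ⟨y, hy, hy'⟩ := key x.1.1 (by
    have := x.2
    change x.1.1 ∈ Finsupp.supported ℂ ℂ {a : DiffIdx n | ℓ a.col ≤ a.ord} at this
    rwa [Finsupp.supported_eq_span_single] at this)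
  have e : x = y + x.1.2 • kappa ℓ := by
    refine Subtype.ext ?_
    change x.1 = y.1 + x.1.2 • (kappa ℓ).1
    rw [hy']
    refine Prod.ext ?_ ?_
    · change x.1.1 = x.1.1 + x.1.2 • (0 : DiffIdx n →₀ ℂ)
      rw [smul_zero, add_zero]
    · change x.1.2 = 0 + x.1.2 * 1
      ring
  rw [e]
  exact S.add_mem hy (S.smul_mem _ hκ)

theorem bracket_kappa (x : GlSub ℓ) : ⁅kappa ℓ, x⁆ = 0 := by
  refine Subtype.ext (Prod.ext ?_ ?_)
  · change bilin _ (0 : DiffIdx n →₀ ℂ) x.1.1 - bilin _ x.1.1 (0 : DiffIdx n →₀ ℂ) = 0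
    simp
  · change bilin _ (0 : DiffIdx n →₀ ℂ) x.1.1 = 0
    simp

variable {N : Type*} [AddCommGroup N] [Module ℂ N]

variable (ℓ χ) in
/-- The operators `op a` with `r ≥ ℓ_j` satisfy the commutation relations of the `t^m ∂_t^r E_{i,j}`
at level `χ`. Nothing is required of the operators with `r < ℓ_j`; they do not occur on the
right-hand side, as the orders in a product are at least that of the second factor. -/
def IsRep (op : DiffIdx n → Module.End ℂ N) : Prop :=
  ∀ a b : DiffIdx n, ℓ a.col ≤ a.ord → ℓ b.col ≤ b.ord →
    op a * op b - op b * op a =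
      Finsupp.linearCombination ℂ op (diffMul a b - diffMul b a) + (χ * diffCoc a b) • 1

theorem bilin_apply_eq_zero {I P : Type*} [AddCommGroup P] [Module ℂ P] {S : Set I}
    (B : (I →₀ ℂ) →ₗ[ℂ] (I →₀ ℂ) →ₗ[ℂ] P)
    (h : ∀ a ∈ S, ∀ b ∈ S, B (Finsupp.single a 1) (Finsupp.single b 1) = 0) (u v : I →₀ ℂ)
    (hu : u ∈ Finsupp.supported ℂ ℂ S) (hv : v ∈ Finsupp.supported ℂ ℂ S) : B u v = 0 := by
  have e : B = bilin fun a b => B (Finsupp.single a 1) (Finsupp.single b 1) := by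
    ext a b
    simp [bilin_single]
  rw [e, ← Submodule.mem_bot (R := ℂ)]
  exact bilin_mem _ S ⊥ (fun a ha b hb => by rw [h a ha b hb]; exact Submodule.zero_mem _) u v hu hv

/-- The representation defined by operators satisfying the commutation relations. -/
def IsRep.toLieHom {op : DiffIdx n → Module.End ℂ N} (h : IsRep ℓ χ op) :
    GlSub ℓ →ₗ⁅ℂ⁆ Module.End ℂ N where
  toFun x := Finsupp.linearCombination ℂ op x.1.1 + (χ * x.1.2) • 1
  map_add' x y := by
    change Finsupp.linearCombination ℂ op (x.1.1 + y.1.1) + (χ * (x.1.2 + y.1.2)) • 1 = _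
    rw [map_add, mul_add, add_smul]
    abel
  map_smul' r x := by
    change Finsupp.linearCombination ℂ op (r • x.1.1) + (χ * (r * x.1.2)) • 1 = _
    rw [map_smul, RingHom.id_apply, smul_add, smul_smul]
    congr 2
    ring
  map_lie' {x y} := by
    change Finsupp.linearCombination ℂ op (bilin diffMul x.1.1 y.1.1 - bilin diffMul y.1.1 x.1.1) +
      (χ * bilin diffCoc x.1.1 y.1.1) • 1 = _
    set L := Finsupp.linearCombination ℂ op with hL
    let B : (DiffIdx n →₀ ℂ) →ₗ[ℂ] (DiffIdx n →₀ ℂ) →ₗ[ℂ] Module.End ℂ N :=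
      ((LinearMap.mul ℂ (Module.End ℂ N)).compl₁₂ L L -
        ((LinearMap.mul ℂ (Module.End ℂ N)).flip.compl₁₂ L L)) -
      ((bilin (diffMul (n := n))).compr₂ L - (bilin diffMul).flip.compr₂ L +
        (bilin diffCoc).compr₂ (LinearMap.toSpanSingleton ℂ (Module.End ℂ N) (χ • 1)))
    have hB : ∀ u v, B u v = (L u * L v - L v * L u) -
        (L (bilin diffMul u v - bilin diffMul v u) + (χ * bilin diffCoc u v) • 1) := by
      intro u v
      simp [B, smul_smul, mul_comm χ]
    have := bilin_apply_eq_zero (S := {a : DiffIdx n | ℓ a.col ≤ a.ord}) B ?_ x.1.1 y.1.1 x.2 y.2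
    · rw [hB, sub_eq_zero] at this
      rw [← this]
      have key : ∀ (u v : DiffIdx n →₀ ℂ) (c d : ℂ), L u * L v - L v * L u =
          (L u + (χ * c) • 1) * (L v + (χ * d) • 1) -
            (L v + (χ * d) • 1) * (L u + (χ * c) • 1) := by
        intro u v c d
        simp only [add_mul, mul_add, smul_mul_assoc, mul_smul_comm, one_mul, mul_one, smul_add]
        rw [smul_comm (χ * c)]
        abel
      exact key x.1.1 y.1.1 x.1.2 y.1.2
    · intro a ha b hb
      rw [hB, sub_eq_zero, bilin_single, bilin_single, bilin_single, hL]
      simp only [Finsupp.linearCombination_single, one_smul]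
      exact h a b ha hb

theorem IsRep.toLieHom_diffE {op : DiffIdx n → Module.End ℂ N} (h : IsRep ℓ χ op) (i j : Fin n)
    (m : ℤ) (s : ℕ) : h.toLieHom (diffE ℓ i j m s) = op ⟨i, j, m, ℓ j + s⟩ := by
  change Finsupp.linearCombination ℂ op (Finsupp.single _ 1) + (χ * 0) • 1 = _
  simp

theorem IsRep.toLieHom_kappa {op : DiffIdx n → Module.End ℂ N} (h : IsRep ℓ χ op) :
    h.toLieHom (kappa ℓ) = χ • 1 := by
  change Finsupp.linearCombination ℂ op 0 + (χ * 1) • 1 = _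
  simp

/-- The operators of a representation which belong to the `t^m ∂_t^r E_{i,j}` with `r ≥ ℓ_j`; by
convention they vanish for `r < ℓ_j`. -/
def repOp (ρ : GlSub ℓ →ₗ⁅ℂ⁆ Module.End ℂ N) (a : DiffIdx n) : Module.End ℂ N :=
  if h : ℓ a.col ≤ a.ord then ρ (basisElt a h) else 0

theorem repOp_diffE (ρ : GlSub ℓ →ₗ⁅ℂ⁆ Module.End ℂ N) (i j : Fin n) (m : ℤ) (s : ℕ) :
    repOp ρ ⟨i, j, m, ℓ j + s⟩ = ρ (diffE ℓ i j m s) := dif_pos (Nat.le_add_right (ℓ j) s)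

/-- A representation of level `χ` is determined by its operators `repOp`. -/
theorem rep_eq (ρ : GlSub ℓ →ₗ⁅ℂ⁆ Module.End ℂ N) (hκ : ρ (kappa ℓ) = χ • 1) (x : GlSub ℓ) :
    ρ x = Finsupp.linearCombination ℂ (repOp ρ) x.1.1 + (χ * x.1.2) • 1 := by
  let φ : GlSub ℓ →ₗ[ℂ] Module.End ℂ N :=
    { toFun := fun x => Finsupp.linearCombination ℂ (repOp ρ) x.1.1 + (χ * x.1.2) • 1
      map_add' := fun x y => by
        change Finsupp.linearCombination ℂ (repOp ρ) (x.1.1 + y.1.1) +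
          (χ * (x.1.2 + y.1.2)) • 1 = _
        rw [map_add, mul_add, add_smul]
        abel
      map_smul' := fun r x => by
        change Finsupp.linearCombination ℂ (repOp ρ) (r • x.1.1) + (χ * (r * x.1.2)) • 1 = _
        rw [map_smul, RingHom.id_apply, smul_add, smul_smul]
        congr 2
        ring }
  refine glSub_span (LinearMap.eqLocus (ρ : GlSub ℓ →ₗ[ℂ] Module.End ℂ N) φ) ?_ ?_ x
  · intro a ha
    change ρ _ = Finsupp.linearCombination ℂ (repOp ρ) (Finsupp.single a 1) + (χ * 0) • 1
    simp [repOp, ha]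
  · change ρ _ = Finsupp.linearCombination ℂ (repOp ρ) 0 + (χ * 1) • 1
    simp [hκ]

theorem isRep_repOp (ρ : GlSub ℓ →ₗ⁅ℂ⁆ Module.End ℂ N) (hκ : ρ (kappa ℓ) = χ • 1) :
    IsRep ℓ χ (repOp ρ) := by
  intro a b ha hb
  have h := rep_eq ρ hκ ⁅basisElt a ha, basisElt b hb⁆
  rw [LieHom.map_lie, LieRing.of_associative_ring_bracket] at h
  rw [repOp, repOp, dif_pos ha, dif_pos hb, h]
  change Finsupp.linearCombination ℂ (repOp ρ) (bilin diffMul (Finsupp.single a 1)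
    (Finsupp.single b 1) - bilin diffMul (Finsupp.single b 1) (Finsupp.single a 1)) +
    (χ * bilin diffCoc (Finsupp.single a 1) (Finsupp.single b 1)) • 1 = _
  rw [bilin_single, bilin_single, bilin_single]

end Rep

/-! ### The vacuum module -/

section Vac

attribute [local instance] LieRing.ofAssociativeRing

variable {n : ℕ} {ℓ : Fin n → ℕ} {χ : ℂ}

variable (ℓ χ) in
/-- The action of the Lie algebra on the vacuum module. -/
def actHom : GlSub ℓ →ₗ⁅ℂ⁆ Module.End ℂ (Vacuum ℓ χ) :=
  (Algebra.lsmul ℂ ℂ (Vacuum ℓ χ)).toLieHom.comp (UniversalEnvelopingAlgebra.ι ℂ)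

theorem actHom_apply (x : GlSub ℓ) (v : Vacuum ℓ χ) : actHom ℓ χ x v = act x v := rfl

theorem act_diffE_vac (i j : Fin n) (m s : ℕ) : act (diffE ℓ i j m s) (vac ℓ χ) = 0 := by
  change Submodule.Quotient.mk (_ * 1) = _
  rw [mul_one, Submodule.Quotient.mk_eq_zero]
  exact Submodule.subset_span (Or.inl ⟨i, j, m, s, rfl⟩)

theorem act_kappa_vac : act (kappa ℓ) (vac ℓ χ) = χ • vac ℓ χ := by
  rw [← sub_eq_zero]
  have : act (kappa ℓ) (vac ℓ χ) - χ • vac ℓ χ = Submodule.Quotient.mk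
      (UniversalEnvelopingAlgebra.ι ℂ (kappa ℓ) - algebraMap ℂ (UGl ℓ) χ) := by
    rw [Submodule.Quotient.mk_sub, Algebra.algebraMap_eq_smul_one, Submodule.Quotient.mk_smul,
      ← mul_one (UniversalEnvelopingAlgebra.ι ℂ (kappa ℓ))]
    rfl
  rw [this, Submodule.Quotient.mk_eq_zero]
  exact Submodule.subset_span (Or.inr rfl)

/-- The universal property of the induced module. -/
theorem exists_vacuum_lift {N : Type*} [AddCommGroup N] [Module ℂ N]
    (ρ : GlSub ℓ →ₗ⁅ℂ⁆ Module.End ℂ N) (v₀ : N)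
    (h₀ : ∀ (i j : Fin n) (m s : ℕ), ρ (diffE ℓ i j m s) v₀ = 0)
    (hκ : ρ (kappa ℓ) v₀ = χ • v₀) :
    ∃ f : Vacuum ℓ χ →ₗ[ℂ] N, f (vac ℓ χ) = v₀ ∧ ∀ x v, f (act x v) = ρ x (f v) := by
  let φ := UniversalEnvelopingAlgebra.lift ℂ ρ
  let g : UGl ℓ →ₗ[ℂ] N := (LinearMap.applyₗ v₀).comp φ.toLinearMap
  have hg : ∀ u, g u = φ u v₀ := fun _ => rfl
  have hφ : ∀ x, φ (UniversalEnvelopingAlgebra.ι ℂ x) = ρ x := fun x =>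
    UniversalEnvelopingAlgebra.lift_ι_apply ℂ ρ x
  have hker : (vacuumIdeal ℓ χ).restrictScalars ℂ ≤ LinearMap.ker g := by
    intro u hu
    rw [Submodule.restrictScalars_mem, vacuumIdeal] at hu
    rw [LinearMap.mem_ker, hg]
    induction hu using Submodule.span_induction with
    | mem u hu =>
      rcases hu with ⟨i, j, m, s, rfl⟩ | hu
      · rw [hφ, h₀]
      · rw [Set.mem_singleton_iff.1 hu, map_sub, hφ, AlgHom.commutes, LinearMap.sub_apply, hκ,
          Module.algebraMap_end_apply, sub_self]
    | zero => rw [map_zero, LinearMap.zero_apply]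
    | add x y _ _ hx hy => rw [map_add, LinearMap.add_apply, hx, hy, add_zero]
    | smul a x _ hx => rw [smul_eq_mul, map_mul, Module.End.mul_apply, hx, map_zero]
  refine ⟨(Submodule.liftQ _ g hker) ∘ₗ
    (Submodule.Quotient.restrictScalarsEquiv ℂ (vacuumIdeal ℓ χ)).symm.toLinearMap, ?_, ?_⟩
  · change φ 1 v₀ = v₀
    rw [map_one]; rfl
  · intro x v
    obtain ⟨u, rfl⟩ := Submodule.Quotient.mk_surjective _ v
    change φ (UniversalEnvelopingAlgebra.ι ℂ x * u) v₀ = ρ x (φ u v₀)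
    rw [map_mul, hφ]; rfl

/-- The vacuum module is generated by the vacuum vector. -/
theorem vacuum_eq_top_of_act (P : Submodule ℂ (Vacuum ℓ χ)) (h0 : vac ℓ χ ∈ P)
    (h : ∀ x, ∀ v ∈ P, act x v ∈ P) (v : Vacuum ℓ χ) : v ∈ P := by
  have key : ∀ (t : TensorAlgebra ℂ (GlSub ℓ)), ∀ v ∈ P,
      UniversalEnvelopingAlgebra.mkAlgHom ℂ (GlSub ℓ) t • v ∈ P := by
    intro t
    induction t using TensorAlgebra.induction with
    | algebraMap r =>
      intro v hv
      rw [AlgHom.commutes, algebraMap_smul]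
      exact P.smul_mem r hv
    | ι x => exact h x
    | mul a b ha hb =>
      intro v hv
      rw [map_mul, mul_smul]
      exact ha _ (hb _ hv)
    | add a b ha hb =>
      intro v hv
      rw [map_add, add_smul]
      exact P.add_mem (ha _ hv) (hb _ hv)
  obtain ⟨u, rfl⟩ := Submodule.Quotient.mk_surjective _ v
  have hs : Function.Surjective (UniversalEnvelopingAlgebra.mkAlgHom ℂ (GlSub ℓ)) :=
    RingCon.mk'_surjective _
  obtain ⟨t, rfl⟩ := hs u
  have := key t _ h0
  change Submodule.Quotient.mk (_ * 1) ∈ P at this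
  rwa [mul_one] at this

theorem act_lie (x y : GlSub ℓ) (v : Vacuum ℓ χ) :
    act ⁅x, y⁆ v = act x (act y v) - act y (act x v) := by
  have := LinearMap.congr_fun ((actHom ℓ χ).map_lie x y) v
  rwa [LieRing.of_associative_ring_bracket] at this

theorem act_kappa (v : Vacuum ℓ χ) : act (kappa ℓ) v = χ • v := by
  refine vacuum_eq_top_of_act (LinearMap.eqLocus (actHom ℓ χ (kappa ℓ))
    (χ • LinearMap.id)) ?_ ?_ v
  · change act (kappa ℓ) (vac ℓ χ) = χ • vac ℓ χ
    exact act_kappa_vac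
  intro x v hv
  change act (kappa ℓ) (act x v) = χ • act x v
  have hv' : act (kappa ℓ) v = χ • v := hv
  have h : act ⁅kappa ℓ, x⁆ v = 0 := by
    rw [bracket_kappa, ← actHom_apply, map_zero, LinearMap.zero_apply]
  rw [act_lie, hv', sub_eq_zero] at h
  rw [h, ← actHom_apply, map_smul, actHom_apply]

theorem actHom_kappa : actHom ℓ χ (kappa ℓ) = χ • 1 := LinearMap.ext act_kappa

theorem basisElt_eq (a : DiffIdx n) (h : ℓ a.col ≤ a.ord) :
    basisElt a h = diffE ℓ a.row a.col a.deg (a.ord - ℓ a.col) := by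
  refine Subtype.ext ?_
  change (diffMatrix n).basisVec a = (diffMatrix n).basisVec _
  rw [Nat.add_sub_cancel' h]

/-- The vacuum module is generated from the vacuum vector by the `t^{-m-1} ∂_t^r E_{i,j}`. -/
theorem vacuum_eq_top (P : Submodule ℂ (Vacuum ℓ χ)) (h0 : vac ℓ χ ∈ P)
    (h : ∀ (i j : Fin n) (m s : ℕ), ∀ v ∈ P, act (diffE ℓ i j (-m - 1) s) v ∈ P)
    (v : Vacuum ℓ χ) : v ∈ P := by
  -- the smallest subspace with the two properties is a submodule
  let Cl : Set (Submodule ℂ (Vacuum ℓ χ)) := {P | vac ℓ χ ∈ P ∧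
    ∀ (i j : Fin n) (m s : ℕ), ∀ v ∈ P, act (diffE ℓ i j (-m - 1) s) v ∈ P}
  let R : Submodule ℂ (Vacuum ℓ χ) := sInf Cl
  have hR0 : vac ℓ χ ∈ R := Submodule.mem_sInf.2 fun P hP => hP.1
  have hR1 : ∀ (i j : Fin n) (m s : ℕ), ∀ v ∈ R, act (diffE ℓ i j (-m - 1) s) v ∈ R :=
    fun i j m s v hv => Submodule.mem_sInf.2 fun P hP =>
      hP.2 i j m s v (Submodule.mem_sInf.1 hv P hP)
  let Q : Submodule ℂ (Vacuum ℓ χ) := R ⊓ ⨅ x : GlSub ℓ, R.comap (actHom ℓ χ x)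
  have hQ : ∀ v, v ∈ Q ↔ v ∈ R ∧ ∀ x, act x v ∈ R := by
    intro v
    simp only [Q, Submodule.mem_inf, Submodule.mem_iInf, Submodule.mem_comap, actHom_apply]
  have hQC : Q ∈ Cl := by
    refine ⟨(hQ _).2 ⟨hR0, fun x => ?_⟩, fun i j m s v hv => ?_⟩
    · refine glSub_span (R.comap ((LinearMap.applyₗ (vac ℓ χ)).comp
        (actHom ℓ χ : GlSub ℓ →ₗ[ℂ] Module.End ℂ (Vacuum ℓ χ)))) ?_ ?_ x
      · intro a ha
        change act (basisElt a ha) (vac ℓ χ) ∈ R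
        rw [basisElt_eq]
        obtain ⟨m, hm | hm⟩ : ∃ m : ℕ, a.deg = m ∨ a.deg = -m - 1 := by
          rcases le_or_gt 0 a.deg with h | h
          · exact ⟨a.deg.toNat, Or.inl (by omega)⟩
          · exact ⟨(-a.deg - 1).toNat, Or.inr (by omega)⟩
        · rw [hm, act_diffE_vac]
          exact R.zero_mem
        · rw [hm]
          exact hR1 _ _ _ _ _ hR0
      · change act (kappa ℓ) (vac ℓ χ) ∈ R
        rw [act_kappa_vac]
        exact R.smul_mem _ hR0
    · obtain ⟨hv1, hv2⟩ := (hQ v).1 hv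
      refine (hQ _).2 ⟨hR1 i j m s v hv1, fun x => ?_⟩
      have := act_lie x (diffE ℓ i j (-m - 1) s) v
      rw [eq_sub_iff_add_eq] at this
      rw [← this]
      exact R.add_mem (hv2 _) (hR1 _ _ _ _ _ (hv2 x))
  refine (sInf_le (show P ∈ Cl from ⟨h0, h⟩) : R ≤ P) ?_
  refine vacuum_eq_top_of_act R hR0 (fun x v hv => ?_) v
  exact ((hQ v).1 ((sInf_le hQC : R ≤ Q) hv)).2 x

/-! ### The translation operator -/

variable (n) in
/-- The derivation `∂_t` of the circle, as a scalar differential operator. -/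
def ddt : GlHat n := ∑ i, (diffMatrix n).basisVec ⟨i, i, 0, 1⟩

theorem bracket_basisVec_basisVec (a b : DiffIdx n) :
    (⁅(diffMatrix n).basisVec a, (diffMatrix n).basisVec b⁆ : GlHat n) =
      ((diffMul a b - diffMul b a, diffCoc a b) : (DiffIdx n →₀ ℂ) × ℂ) := by
  refine Prod.ext ?_ ?_
  · change bilin diffMul (Finsupp.single a 1) (Finsupp.single b 1) -
      bilin diffMul (Finsupp.single b 1) (Finsupp.single a 1) = _
    rw [bilin_single, bilin_single]
  · change bilin diffCoc (Finsupp.single a 1) (Finsupp.single b 1) = _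
    rw [bilin_single]

theorem fall_zero_left (s : ℕ) : fall 0 s = if s = 0 then 1 else 0 := by
  cases s with
  | zero => simp [fall_zero]
  | succ s => simp [fall_zero_succ]

theorem bracket_ddt (a : DiffIdx n) : ⁅ddt n, (diffMatrix n).basisVec a⁆ =
    (a.deg : ℂ) • (diffMatrix n).basisVec ⟨a.row, a.col, a.deg - 1, a.ord⟩ := by
  have h1 : ∀ i : Fin n, diffMul ⟨i, i, 0, 1⟩ a = if i = a.row then
      Finsupp.single ⟨a.row, a.col, a.deg, a.ord + 1⟩ 1 +
      (a.deg : ℂ) • Finsupp.single ⟨a.row, a.col, a.deg - 1, a.ord⟩ 1 else 0 := by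
    intro i
    unfold diffMul
    dsimp only
    split_ifs with h
    · subst h
      simp [Finset.sum_range_succ, fall_zero, fall_succ, add_comm, -Finsupp.single_mul]
    · rfl
  have h2 : ∀ i : Fin n, diffMul a ⟨i, i, 0, 1⟩ = if i = a.col then
      Finsupp.single ⟨a.row, a.col, a.deg, a.ord + 1⟩ 1 else 0 := by
    intro i
    unfold diffMul
    dsimp only
    split_ifs with h h' h'
    · subst h'
      rw [Finset.sum_eq_single 0]
      · simp [fall_zero]
      · intro s _ hs
        rw [Int.cast_zero, fall_zero_left, if_neg hs]
        simp
      · simp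
    · exact absurd h.symm h'
    · exact absurd h'.symm h
    · rfl
  have h3 : ∀ i : Fin n, diffCoc ⟨i, i, 0, 1⟩ a = 0 := by
    intro i
    unfold diffCoc
    dsimp only
    split_ifs
    · rw [show ((1 : ℕ) + a.ord + 1) = (a.ord + 1) + 1 by ring, Ring.choose_zero_succ]
      simp
    · rfl
  rw [ddt, sum_lie]
  simp only [bracket_basisVec_basisVec]
  refine Prod.ext ?_ ?_
  · refine (map_sum (LinearMap.fst ℂ (DiffIdx n →₀ ℂ) ℂ) _ _).trans ?_
    simp only [LinearMap.fst_apply, h1, h2, Finset.sum_sub_distrib, Finset.sum_ite_eq',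
      Finset.mem_univ, if_true, add_sub_cancel_left]
    rfl
  · refine (map_sum (LinearMap.snd ℂ (DiffIdx n →₀ ℂ) ℂ) _ _).trans ?_
    simp only [LinearMap.snd_apply, h3, Finset.sum_const_zero]
    exact (mul_zero (a.deg : ℂ)).symm

theorem bracket_ddt_mem (x : GlSub ℓ) : ⁅ddt n, (x : GlHat n)⁆ ∈ GlSub ℓ := by
  refine glSub_span ((GlSub ℓ).toSubmodule.comap ((LieAlgebra.ad ℂ (GlHat n) (ddt n)) ∘ₗ
    (GlSub ℓ).toSubmodule.subtype)) ?_ ?_ x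
  · intro a ha
    change ⁅ddt n, (diffMatrix n).basisVec a⁆ ∈ GlSub ℓ
    rw [bracket_ddt]
    exact (GlSub ℓ).smul_mem _ (basisElt ⟨a.row, a.col, a.deg - 1, a.ord⟩ ha).2
  · change ⁅ddt n, (kappa ℓ : GlHat n)⁆ ∈ GlSub ℓ
    have : ⁅ddt n, (kappa ℓ : GlHat n)⁆ = 0 := by
      refine Prod.ext ?_ ?_
      · change bilin diffMul _ (0 : DiffIdx n →₀ ℂ) - bilin diffMul (0 : DiffIdx n →₀ ℂ) _ = 0
        simp
      · change bilin diffCoc _ (0 : DiffIdx n →₀ ℂ) = 0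
        simp
    rw [this]
    exact (GlSub ℓ).zero_mem

variable (ℓ) in
/-- The derivation `t^m ∂_t^r E_{i,j} ↦ m t^{m-1} ∂_t^r E_{i,j}`, `κ ↦ 0`. -/
def glDeriv : GlSub ℓ →ₗ[ℂ] GlSub ℓ where
  toFun x := ⟨⁅ddt n, (x : GlHat n)⁆, bracket_ddt_mem x⟩
  map_add' _ _ := Subtype.ext (lie_add _ _ _)
  map_smul' _ _ := Subtype.ext (lie_smul _ _ _)

theorem glDeriv_lie (x y : GlSub ℓ) :
    glDeriv ℓ ⁅x, y⁆ = ⁅glDeriv ℓ x, y⁆ + ⁅x, glDeriv ℓ y⁆ :=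
  Subtype.ext (leibniz_lie (ddt n) (x : GlHat n) (y : GlHat n))

theorem glDeriv_diffE (i j : Fin n) (m : ℤ) (s : ℕ) :
    glDeriv ℓ (diffE ℓ i j m s) = (m : ℂ) • diffE ℓ i j (m - 1) s :=
  Subtype.ext (bracket_ddt _)

theorem glDeriv_kappa : glDeriv ℓ (kappa ℓ) = 0 := by
  refine Subtype.ext (Prod.ext ?_ ?_)
  · change bilin diffMul _ (0 : DiffIdx n →₀ ℂ) - bilin diffMul (0 : DiffIdx n →₀ ℂ) _ = 0
    simp
  · change bilin diffCoc _ (0 : DiffIdx n →₀ ℂ) = 0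
    simp

variable (ℓ χ) in
/-- The first-order deformation of the vacuum module along the derivation `D = glDeriv`:
`x (v, v') = (x v, x v' - (D x) v)`. -/
def dualAct : GlSub ℓ →ₗ⁅ℂ⁆ Module.End ℂ (Vacuum ℓ χ × Vacuum ℓ χ) where
  toFun x := ((actHom ℓ χ x).comp (LinearMap.fst ℂ _ _)).prod
    ((actHom ℓ χ x).comp (LinearMap.snd ℂ _ _) -
      (actHom ℓ χ (glDeriv ℓ x)).comp (LinearMap.fst ℂ _ _))
  map_add' x y := by
    refine LinearMap.ext fun v => Prod.ext ?_ ?_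
    · simp
    · simp; abel
  map_smul' r x := by
    refine LinearMap.ext fun v => Prod.ext ?_ ?_
    · simp
    · simp [smul_sub]
  map_lie' {x y} := by
    refine LinearMap.ext fun v => Prod.ext ?_ ?_
    · simp [LieRing.of_associative_ring_bracket]
    · simp [LieRing.of_associative_ring_bracket, glDeriv_lie]; abel

/-- The operator `T` with `T|0⟩ = 0` and `[T, x] = -D x`, where `D` is the derivation `glDeriv`: the
map `v ↦ (v, T v)` comes from the universal property of the vacuum module, applied to the vector
`(|0⟩, 0)` of the module `dualAct`. -/
theorem exists_translation : ∃ T : Vacuum ℓ χ →ₗ[ℂ] Vacuum ℓ χ, T (vac ℓ χ) = 0 ∧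
    ∀ x v, T (act x v) = act x (T v) - act (glDeriv ℓ x) v := by
  obtain ⟨f, hf0, hf⟩ := exists_vacuum_lift (χ := χ) (dualAct ℓ χ) (vac ℓ χ, 0) (by
    intro i j m s
    refine Prod.ext (act_diffE_vac i j m s) ?_
    change actHom ℓ χ _ 0 - actHom ℓ χ (glDeriv ℓ _) (vac ℓ χ) = 0
    rw [glDeriv_diffE, map_zero, zero_sub, neg_eq_zero, map_smul, LinearMap.smul_apply]
    cases m with
    | zero => simp
    | succ m =>
      rw [actHom_apply, show ((m + 1 : ℕ) : ℤ) - 1 = (m : ℕ) by push_cast; ring, act_diffE_vac,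
        smul_zero]) (by
    refine Prod.ext act_kappa_vac ?_
    change actHom ℓ χ _ 0 - actHom ℓ χ (glDeriv ℓ _) (vac ℓ χ) = χ • 0
    rw [glDeriv_kappa, map_zero, map_zero, LinearMap.zero_apply, smul_zero, sub_zero])
  have h1 : ∀ v, (f v).1 = v := by
    intro v
    refine vacuum_eq_top_of_act (LinearMap.eqLocus ((LinearMap.fst ℂ _ _).comp f)
      LinearMap.id) ?_ ?_ v
    · change (f (vac ℓ χ)).1 = vac ℓ χ
      rw [hf0]
    · intro x v hv
      change (f (act x v)).1 = act x v
      have hv' : (f v).1 = v := hv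
      rw [hf]
      change act x (f v).1 = _
      rw [hv']
  refine ⟨(LinearMap.snd ℂ _ _).comp f, ?_, ?_⟩
  · change (f (vac ℓ χ)).2 = 0
    rw [hf0]
  · intro x v
    change (f (act x v)).2 = act x (f v).2 - act (glDeriv ℓ x) v
    rw [hf]
    change act x (f v).2 - act (glDeriv ℓ x) (f v).1 = _
    rw [h1]

theorem IsTranslation.ext {T T' : Vacuum ℓ χ →ₗ[ℂ] Vacuum ℓ χ} (h : IsTranslation T)
    (h' : IsTranslation T') : T = T' := by
  refine LinearMap.ext fun v => vacuum_eq_top (LinearMap.eqLocus T T') ?_ ?_ v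
  · change T (vac ℓ χ) = T' (vac ℓ χ)
    rw [h.1, h'.1]
  · intro i j m s v hv
    have hv' : T v = T' v := hv
    change T _ = T' _
    rw [h.2, h'.2, hv']

theorem isTranslation_of_glDeriv {T : Vacuum ℓ χ →ₗ[ℂ] Vacuum ℓ χ} (h0 : T (vac ℓ χ) = 0)
    (h : ∀ x v, T (act x v) = act x (T v) - act (glDeriv ℓ x) v) : IsTranslation T := by
  refine ⟨h0, fun i j m s v => ?_⟩
  rw [h, glDeriv_diffE, ← actHom_apply (_ • _), map_smul, LinearMap.smul_apply, actHom_apply,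
    show (-(m : ℤ) - 1 - 1) = -m - 2 by ring]
  push_cast
  rw [← Nat.cast_smul_eq_nsmul ℂ]
  push_cast
  module

theorem existsUnique_translation :
    ∃! T : Vacuum ℓ χ →ₗ[ℂ] Vacuum ℓ χ, IsTranslation T := by
  obtain ⟨T, h0, h⟩ := exists_translation (ℓ := ℓ) (χ := χ)
  exact ⟨T, isTranslation_of_glDeriv h0 h, fun T' h' => h'.ext (isTranslation_of_glDeriv h0 h)⟩

theorem IsTranslation.act {T : Vacuum ℓ χ →ₗ[ℂ] Vacuum ℓ χ} (hT : IsTranslation T)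
    (x : GlSub ℓ) (v : Vacuum ℓ χ) :
    T (act x v) = _root_.act x (T v) - _root_.act (glDeriv ℓ x) v := by
  obtain ⟨T', h0, h⟩ := exists_translation (ℓ := ℓ) (χ := χ)
  rw [hT.ext (isTranslation_of_glDeriv h0 h)]
  exact h x v

end Vac

section Restricted

variable {W : Type*} [AddCommGroup W] [Module ℂ W]

namespace Fld

/-! ### Products with the unit field -/

theorem nprod_smul_left (r : ℂ) (a : Fld W) (k : ℤ) (c : Fld W) :
    nprod (r • a) k c = r • nprod a k c := by
  refine ext_apply fun p w => ?_
  obtain ⟨N, hN⟩ := c.trunc_sub p w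
  obtain ⟨N', hN'⟩ := a.trunc_mode w
  have hN'' : ∀ i : ℕ, N' ≤ i → (r • a).mode i w = 0 := fun i hi => by
    rw [mode, smul_apply, LinearMap.smul_apply, ← mode, hN' i hi, smul_zero]
  rw [smul_apply, LinearMap.smul_apply, nprod_apply a k c p w N N' hN hN',
    nprod_apply (r • a) k c p w N N' hN hN'', smul_sub, smul_sum, smul_sum]
  have e : ∀ (k : ℤ) (w : W), (r • a).mode k w = r • a.mode k w := fun _ _ => rfl
  simp only [e, map_smul]
  congr 1 <;> exact sum_congr rfl fun i _ => smul_comm _ _ _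

theorem one_mode (k : ℤ) (w : W) : (one : Fld W).mode k w = if k = -1 then w else 0 := by
  rw [mode, one_apply]
  by_cases h : k = -1
  · subst h; simp
  · rw [if_neg (by omega), if_neg h, LinearMap.zero_apply]

theorem nprod_one_left (k : ℤ) (c : Fld W) : nprod one k c = if k = -1 then c else 0 := by
  refine ext_apply fun p w => ?_
  obtain ⟨N, hN⟩ := c.trunc_sub p w
  rw [nprod_apply one k c p w (N + (k + 1).toNat + 1) 0 (fun i hi => hN i (by omega))
    (fun i _ => by rw [one_mode, if_neg (by omega)]), sum_range_zero, sub_zero]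
  simp only [one_mode]
  rcases lt_trichotomy k (-1) with h | rfl | h
  · rw [sum_eq_zero, if_neg (by omega), zero_apply, LinearMap.zero_apply]
    intro i _
    rw [if_neg (by omega), smul_zero]
  · rw [sum_eq_single 0]
    · simp
    · intro i _ hi
      rw [if_neg (by omega), smul_zero]
    · simp
  · obtain ⟨j, rfl⟩ : ∃ j : ℕ, k = j := ⟨k.toNat, by omega⟩
    rw [sum_eq_zero, if_neg (by omega), zero_apply, LinearMap.zero_apply]
    intro i _
    by_cases hi : i = j + 1
    · rw [Ring.choose_natCast, Nat.choose_eq_zero_of_lt (by omega)]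
      simp
    · rw [if_neg (by omega), smul_zero]

theorem nprod_natCast_one (a : Fld W) (k : ℕ) : nprod a k one = 0 := by
  refine ext_apply fun p w => ?_
  rw [nprod_natCast_apply]
  have : bracketFun a one w = 0 := by
    funext p q
    rw [bracketFun, one_apply]
    split_ifs <;> simp
  rw [this, map_zero]
  rfl

/-- A family which depends polynomially, with degree `j`, on the first mode number, and otherwise
only on the sum of the mode numbers, is annihilated by `(z₁ - z₂)^(j+1)`. -/
theorem mulDiff_pow_choose_left (j : ℕ) : ∀ g : ℤ → W,
    (mulDiff ^ (j + 1)) (fun p q => Ring.choose (-p - 1) j • g (p + q)) = 0 := by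
  induction j with
  | zero =>
    intro g
    funext p q
    rw [zero_add, pow_one, mulDiff_apply, Ring.choose_zero_right, Ring.choose_zero_right,
      show p - 1 + q = p + (q - 1) by ring, sub_self]
    rfl
  | succ j ih =>
    intro g
    rw [mulDiff_pow_succ, ← ih fun x => g (x - 1)]
    congr 1
    funext p q
    rw [mulDiff_apply, show -(p - 1) - 1 = (-p - 1) + 1 by ring, Ring.choose_succ_succ,
      show p - 1 + q = p + q - 1 by ring, show p + (q - 1) = p + q - 1 by ring]
    module

theorem mulDiff_pow_choose_right (j : ℕ) (g : ℤ → W) :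
    (mulDiff ^ (j + 1)) (fun p q => Ring.choose (-q - 1) j • g (p + q)) = 0 := by
  have h := mulDiff_pow_swap (j + 1) (fun p q => Ring.choose (-p - 1) j • g (p + q))
  rw [mulDiff_pow_choose_left] at h
  simp only [add_comm _ (_ : ℤ)] at h ⊢
  rw [h]
  funext p q
  simp

end Fld

/-! ### The commutation relations in terms of generating series -/

variable {n : ℕ} {ℓ : Fin n → ℕ} {χ : ℂ}

/-- The index set of the terms in the commutator of `t^m₁ ∂^r₁ E_{i₁,j₁}` and
`t^m₂ ∂^r₂ E_{i₂,j₂}`: the terms of the two products, and the central term. -/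
def commSet (r₁ r₂ : ℕ) : Finset (ℕ ⊕ ℕ ⊕ Unit) :=
  (range (r₁ + 1)).disjSum ((range (r₂ + 1)).disjSum {()})

/-- The dependence on `m₁` and `m₂` of the coefficients of the commutator. -/
def commWeight (r₁ r₂ : ℕ) : ℕ ⊕ ℕ ⊕ Unit → ℤ → ℤ → ℤ
  | .inl s => fun _ m₂ => Ring.choose m₂ s
  | .inr (.inl s) => fun m₁ _ => Ring.choose m₁ s
  | .inr (.inr _) => fun m₁ _ => Ring.choose m₁ (r₁ + r₂ + 1)

/-- The defect of the degrees of the terms of the commutator. -/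
def commShift (r₁ r₂ : ℕ) : ℕ ⊕ ℕ ⊕ Unit → ℕ
  | .inl s => s
  | .inr (.inl s) => s
  | .inr (.inr _) => r₁ + r₂ + 1

variable (χ) in
/-- The factors of the coefficients of the commutator which do not depend on `m₁` and `m₂`. -/
def commCoef (i₁ j₁ i₂ j₂ : Fin n) (r₁ r₂ : ℕ) : ℕ ⊕ ℕ ⊕ Unit → ℂ
  | .inl s => if j₁ = i₂ then (r₁.choose s : ℂ) * s.factorial else 0
  | .inr (.inl s) => if j₂ = i₁ then -((r₂.choose s : ℂ) * s.factorial) else 0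
  | .inr (.inr _) => if i₁ = j₂ ∧ j₁ = i₂ then
      χ * ((-1) ^ r₁ * r₁.factorial * r₂.factorial) else 0

/-- The series which occur in the commutator. -/
def commBase {X : Type*} (G : Fin n → Fin n → ℕ → X) (e : X) (i₁ j₁ i₂ j₂ : Fin n) (r₁ r₂ : ℕ) :
    ℕ ⊕ ℕ ⊕ Unit → X
  | .inl s => G i₁ j₂ (r₁ + r₂ - s)
  | .inr (.inl s) => G i₂ j₁ (r₂ + r₁ - s)
  | .inr (.inr _) => e

theorem commBase_comp {X Z : Type*} (φ : X → Z) (G : Fin n → Fin n → ℕ → X) (e : X)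
    (i₁ j₁ i₂ j₂ : Fin n) (r₁ r₂ : ℕ) (t : ℕ ⊕ ℕ ⊕ Unit) :
    commBase (fun i j r => φ (G i j r)) (φ e) i₁ j₁ i₂ j₂ r₁ r₂ t =
      φ (commBase G e i₁ j₁ i₂ j₂ r₁ r₂ t) := by
  rcases t with s | s | s <;> rfl

theorem isModeWeight_commWeight (r₁ r₂ : ℕ) (t : ℕ ⊕ ℕ ⊕ Unit) :
    IsModeWeight (commWeight r₁ r₂ t) (commShift r₁ r₂ t) := by
  rcases t with s | s | s
  · exact (isModeWeight_choose s).swap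
  · exact isModeWeight_choose s
  · exact isModeWeight_choose _

/-- The bracket of two generators, evaluated in a family `G i j r k` with the unit element `u`, as a
sum over `commSet`. It is applied both to the operators of a representation and to the operators of
taking products with fields; the two results are matched by `Fld.nprod_comm`. -/
theorem commutator_expansion {X : Type*} [AddCommGroup X] [Module ℂ X]
    (G : Fin n → Fin n → ℕ → ℤ → X) (u : X) (e : ℤ → X)
    (he : ∀ k, e k = if k = -1 then u else 0) (i₁ j₁ i₂ j₂ : Fin n) (m₁ m₂ : ℤ) (r₁ r₂ : ℕ) :
    Finsupp.linearCombination ℂ (fun a : DiffIdx n => G a.row a.col a.ord a.deg)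
        (diffMul ⟨i₁, j₁, m₁, r₁⟩ ⟨i₂, j₂, m₂, r₂⟩ - diffMul ⟨i₂, j₂, m₂, r₂⟩ ⟨i₁, j₁, m₁, r₁⟩) +
        (χ * diffCoc ⟨i₁, j₁, m₁, r₁⟩ ⟨i₂, j₂, m₂, r₂⟩) • u =
      ∑ t ∈ commSet r₁ r₂, commWeight r₁ r₂ t m₁ m₂ • commCoef χ i₁ j₁ i₂ j₂ r₁ r₂ t •
        commBase G e i₁ j₁ i₂ j₂ r₁ r₂ t
          (m₁ + m₂ - commShift r₁ r₂ t) := by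
  have key : ∀ (i₁ j₁ i₂ j₂ : Fin n) (m₁ m₂ : ℤ) (r₁ r₂ : ℕ),
      Finsupp.linearCombination ℂ (fun a : DiffIdx n => G a.row a.col a.ord a.deg)
        (diffMul ⟨i₁, j₁, m₁, r₁⟩ ⟨i₂, j₂, m₂, r₂⟩) = ∑ s ∈ range (r₁ + 1), Ring.choose m₂ s •
        (if j₁ = i₂ then (r₁.choose s : ℂ) * s.factorial else 0) •
          G i₁ j₂ (r₁ + r₂ - s) (m₁ + m₂ - s) := by
    intro i₁ j₁ i₂ j₂ m₁ m₂ r₁ r₂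
    unfold diffMul
    dsimp only
    split_ifs with h
    · rw [map_sum]
      refine sum_congr rfl fun s _ => ?_
      rw [Finsupp.linearCombination_single, fall_choose, ← Int.cast_smul_eq_zsmul ℂ, smul_smul]
      congr 1
      ring
    · simp
  rw [map_sub, key, key, commSet, sum_disjSum, sum_disjSum, sum_singleton]
  simp only [commWeight, commShift, commCoef, commBase, he]
  rw [sub_eq_add_neg, add_assoc]
  congr 1
  congr 1
  · rw [← sum_neg_distrib]
    refine sum_congr rfl fun s _ => ?_
    rw [add_comm m₂ m₁]
    split_ifs
    · module
    · simp
  · unfold diffCoc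
    dsimp only
    by_cases h : i₁ = j₂ ∧ j₁ = i₂
    · by_cases h' : (r₁ : ℤ) + r₂ = m₁ + m₂
      · rw [if_pos ⟨h.1, h.2, h'⟩, if_pos h, if_pos (by push_cast; omega),
          ← Int.cast_smul_eq_zsmul ℂ, smul_smul]
        congr 1
        ring
      · rw [if_neg (fun H => h' H.2.2), if_pos h, if_neg (by push_cast; omega)]
        simp
    · rw [if_neg (fun H => h ⟨H.1, H.2.1⟩), if_neg h]
      simp

/-! ### Restricted representations -/

/-- The generating series of the operators `op ⟨i, j, m, r⟩`, for all orders `r`, are fields. -/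
def IsRestricted (op : DiffIdx n → Module.End ℂ W) : Prop :=
  ∀ i j r w, ∃ N : ℤ, ∀ p < N, op ⟨i, j, -p - 1, r⟩ w = 0

/-- The field `∑_m op(t^m ∂_t^r E_{i,j}) z^(-m-1)`. -/
def IsRestricted.field {op : DiffIdx n → Module.End ℂ W} (h : IsRestricted op) (i j : Fin n)
    (r : ℕ) : Fld W := Fld.ofCoeff (fun p => op ⟨i, j, -p - 1, r⟩) (h i j r)

variable {op : DiffIdx n → Module.End ℂ W}

theorem IsRestricted.field_apply (h : IsRestricted op) (i j : Fin n) (r : ℕ) (p : ℤ) :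
    h.field i j r p = op ⟨i, j, -p - 1, r⟩ := rfl

theorem IsRestricted.field_mode (h : IsRestricted op) (i j : Fin n) (r : ℕ) (m : ℤ) :
    (h.field i j r).mode m = op ⟨i, j, m, r⟩ := by
  rw [Fld.mode, h.field_apply, show -(-m - 1) - 1 = m by ring]

theorem IsRestricted.comm_modes (h : IsRestricted op) (hr : IsRep ℓ χ op) (i₁ j₁ i₂ j₂ : Fin n)
    (r₁ r₂ : ℕ) (h₁ : ℓ j₁ ≤ r₁) (h₂ : ℓ j₂ ≤ r₂) (m₁ m₂ : ℤ) (w : W) :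
    (h.field i₁ j₁ r₁).mode m₁ ((h.field i₂ j₂ r₂).mode m₂ w) -
      (h.field i₂ j₂ r₂).mode m₂ ((h.field i₁ j₁ r₁).mode m₁ w) =
      ∑ t ∈ commSet r₁ r₂, commWeight r₁ r₂ t m₁ m₂ •
        (commCoef χ i₁ j₁ i₂ j₂ r₁ r₂ t • commBase h.field Fld.one i₁ j₁ i₂ j₂ r₁ r₂ t).mode
          (m₁ + m₂ - commShift r₁ r₂ t) w := by
  have := LinearMap.congr_fun (hr ⟨i₁, j₁, m₁, r₁⟩ ⟨i₂, j₂, m₂, r₂⟩ h₁ h₂) w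
  have e2 : ∀ k : ℤ, Fld.mode Fld.one k = if k = -1 then (1 : Module.End ℂ W) else 0 := by
    intro k
    refine LinearMap.ext fun w => ?_
    rw [Fld.one_mode]
    split_ifs <;> rfl
  have e := commutator_expansion (χ := χ) (fun i j r k => op ⟨i, j, k, r⟩) 1 _ e2
    i₁ j₁ i₂ j₂ m₁ m₂ r₁ r₂
  rw [h.field_mode, h.field_mode]
  refine this.trans ((LinearMap.congr_fun e w).trans ?_)
  rw [LinearMap.sum_apply]
  refine sum_congr rfl fun t _ => ?_
  have e1 : (fun i j r k => op ⟨i, j, k, r⟩ : Fin n → Fin n → ℕ → ℤ → Module.End ℂ W) =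
      fun i j r => Fld.mode (h.field i j r) := by
    funext i j r k
    rw [h.field_mode]
  rw [e1, commBase_comp Fld.mode h.field Fld.one]
  rfl

/-- The fields of a restricted representation are mutually local. -/
theorem IsRestricted.local_field (h : IsRestricted op) (hr : IsRep ℓ χ op) (i₁ j₁ i₂ j₂ : Fin n)
    (r₁ r₂ : ℕ) (h₁ : ℓ j₁ ≤ r₁) (h₂ : ℓ j₂ ≤ r₂) :
    Fld.Local (h.field i₁ j₁ r₁) (h.field i₂ j₂ r₂) := by
  refine ⟨r₁ + r₂ + 2, fun w => ?_⟩
  have e : Fld.bracketFun (h.field i₁ j₁ r₁) (h.field i₂ j₂ r₂) w = ∑ t ∈ commSet r₁ r₂,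
      fun p q => commWeight r₁ r₂ t (-p - 1) (-q - 1) •
        (commCoef χ i₁ j₁ i₂ j₂ r₁ r₂ t • commBase h.field Fld.one i₁ j₁ i₂ j₂ r₁ r₂ t).mode
          (-(p + q) - 2 - commShift r₁ r₂ t) w := by
    funext p q
    have := h.comm_modes hr i₁ j₁ i₂ j₂ r₁ r₂ h₁ h₂ (-p - 1) (-q - 1) w
    rw [Fld.mode, Fld.mode, show -(-p - 1) - 1 = p by ring, show -(-q - 1) - 1 = q by ring] at this
    rw [Fld.bracketFun, this, Finset.sum_apply, Finset.sum_apply]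
    refine sum_congr rfl fun t _ => ?_
    rw [show -p - 1 + (-q - 1) = -(p + q) - 2 by ring]
  rw [e, map_sum]
  refine sum_eq_zero fun t ht => ?_
  rcases t with s | s | s
  · have hs : s < r₁ + 1 := by simpa [commSet] using ht
    exact mulDiff_pow_eq_zero (Fld.mulDiff_pow_choose_right s fun x =>
      (commCoef χ i₁ j₁ i₂ j₂ r₁ r₂ (.inl s) • commBase h.field Fld.one i₁ j₁ i₂ j₂ r₁ r₂
        (.inl s)).mode (-x - 2 - s) w) (by omega)
  · have hs : s < r₂ + 1 := by simpa [commSet] using ht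
    exact mulDiff_pow_eq_zero (Fld.mulDiff_pow_choose_left s fun x =>
      (commCoef χ i₁ j₁ i₂ j₂ r₁ r₂ (.inr (.inl s)) • commBase h.field Fld.one i₁ j₁ i₂ j₂ r₁ r₂
        (.inr (.inl s))).mode (-x - 2 - s) w) (by omega)
  · exact mulDiff_pow_eq_zero (Fld.mulDiff_pow_choose_left (r₁ + r₂ + 1) fun x =>
      (commCoef χ i₁ j₁ i₂ j₂ r₁ r₂ (.inr (.inr s)) • commBase h.field Fld.one i₁ j₁ i₂ j₂ r₁ r₂
        (.inr (.inr s))).mode (-x - 2 - (r₁ + r₂ + 1 : ℕ)) w) (by omega)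

/-- The operators of taking products with the fields of a restricted representation again form a
representation, on the space of fields. -/
theorem IsRestricted.isRep_nprod (h : IsRestricted op) (hr : IsRep ℓ χ op) :
    IsRep ℓ χ fun a : DiffIdx n => Fld.nprod (h.field a.row a.col a.ord) a.deg := by
  rintro ⟨i₁, j₁, m₁, r₁⟩ ⟨i₂, j₂, m₂, r₂⟩ h₁ h₂
  have e2 : ∀ k : ℤ, Fld.nprod Fld.one k = if k = -1 then (1 : Module.End ℂ (Fld W)) else 0 := by
    intro k
    refine LinearMap.ext fun c => ?_
    rw [Fld.nprod_one_left]
    split_ifs <;> rfl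
  have e := commutator_expansion (χ := χ) (fun i j r k => Fld.nprod (h.field i j r) k) 1 _ e2
    i₁ j₁ i₂ j₂ m₁ m₂ r₁ r₂
  refine LinearMap.ext fun c => ?_
  refine Eq.trans ?_ (LinearMap.congr_fun e c).symm
  refine (Fld.nprod_comm _ _ _ _ _ _ (isModeWeight_commWeight r₁ r₂)
    (h.comm_modes hr i₁ j₁ i₂ j₂ r₁ r₂ h₁ h₂) m₁ m₂ c).trans ?_
  rw [LinearMap.sum_apply]
  refine sum_congr rfl fun t _ => ?_
  rw [commBase_comp Fld.nprod h.field Fld.one, Fld.nprod_smul_left]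
  rfl

end Restricted

section Structure

attribute [local instance] LieRing.ofAssociativeRing

variable {W : Type*} [AddCommGroup W] [Module ℂ W]

namespace Fld

/-! ### Normally ordered products -/

theorem choose_neg_natCast (m i : ℕ) :
    Ring.choose (-(m : ℤ) - 1) i = (-1) ^ i * ((m + i).choose i : ℤ) := by
  rw [show -(m : ℤ) - 1 = -((m : ℤ) + 1) by ring, Ring.choose_neg, Units.smul_def,
    show (m : ℤ) + 1 + i - 1 = ((m + i : ℕ) : ℤ) by push_cast; ring, Ring.choose_natCast,
    smul_eq_mul, ← sgn_natCast]
  rfl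

/-- The normally ordered product of a divided derivative of `a` with `c` is the product
`a_(-m-1) c`. -/
theorem normalOrder_dividedDeriv (a c : Fld W) (m : ℕ) (p : ℤ) (w : W) :
    normalOrder (dividedDeriv m fun p w => a p w) (fun p => c p) p w =
      nprod a (-m - 1) c p w := by
  obtain ⟨N, hN⟩ := c.trunc_sub p w
  obtain ⟨N', hN'⟩ := a.trunc_mode w
  rw [nprod_apply a _ c p w N N' hN hN', normalOrder, finsum_nat_eq_sum N, finsum_nat_eq_sum
    (m + N'), sum_range_add, sub_eq_add_neg]
  · congr 1
    · refine sum_congr rfl fun i _ => ?_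
      rw [dividedDeriv, choose_neg_natCast, ← mul_assoc, ← mul_pow, neg_one_mul, neg_neg, one_pow,
        one_mul, ← Nat.cast_add, Ring.choose_natCast, mode, add_comm m i, Nat.choose_symm_add,
        show -(-(m : ℤ) - 1 - i) - 1 = ((i + m : ℕ) : ℤ) by push_cast; ring]
    · rw [← sum_neg_distrib, add_eq_right.2]
      · refine sum_congr rfl fun i _ => ?_
        rw [dividedDeriv, map_zsmul, ← neg_smul, choose_neg_natCast, mode,
          show -((m + i : ℕ) : ℤ) - 1 + m = -i - 1 by push_cast; ring, choose_neg_natCast,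
          show p + ((m + i : ℕ) : ℤ) + 1 = p - (-m - 1) + i by push_cast; ring,
          show -(m : ℤ) - 1 + i = ((i : ℤ) - 1) - (m : ℕ) by ring, ← sgn_add_natCast, sgn_add,
          sgn_sub_one, sgn_natCast, sgn_natCast, add_comm i m, Nat.choose_symm_add]
        congr 1
        have hsq : (-1 : ℤ) ^ i * (-1) ^ i = 1 := by rw [← mul_pow]; simp
        linear_combination -((-1) ^ m * ((m + i).choose i : ℤ)) * hsq
      · refine sum_eq_zero fun i hi => ?_
        have hi := mem_range.1 hi
        rw [dividedDeriv, show -(i : ℤ) - 1 + m = ((m - 1 - i : ℕ) : ℤ) by omega,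
          Ring.choose_natCast, Nat.choose_eq_zero_of_lt (by omega)]
        simp
  · intro i hi
    obtain ⟨j, rfl⟩ := Nat.exists_eq_add_of_le (show m ≤ i by omega)
    have := hN' j (by omega)
    rw [mode] at this
    rw [dividedDeriv, show -((m + j : ℕ) : ℤ) - 1 + m = -j - 1 by push_cast; ring, this, smul_zero,
      map_zero]
  · intro i hi
    rw [hN i hi, dividedDeriv, map_zero, smul_zero]

theorem nprod_neg_one_one (a : Fld W) : nprod a (-1) one = a := by
  refine ext_apply fun p w => ?_
  have := normalOrder_dividedDeriv a one 0 p w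
  rw [Nat.cast_zero, neg_zero, zero_sub] at this
  rw [← this, normalOrder]
  have e : (dividedDeriv 0 fun p w => a p w) = fun p w => a p w := by
    funext p w
    simp [dividedDeriv]
  rw [e]
  simp only [one_apply]
  rcases le_or_gt 0 p with hp | hp
  · obtain ⟨k, rfl⟩ : ∃ k : ℕ, p = k := ⟨p.toNat, by omega⟩
    rw [finsum_eq_single _ k, finsum_eq_zero_of_forall_eq_zero]
    · simp
    · intro i
      rw [if_neg (by omega), LinearMap.zero_apply]
    · intro i hi
      rw [if_neg (by omega), LinearMap.zero_apply, map_zero]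
  · obtain ⟨k, rfl⟩ : ∃ k : ℕ, p = -k - 1 := ⟨(-p - 1).toNat, by omega⟩
    rw [finsum_eq_zero_of_forall_eq_zero, finsum_eq_single _ k]
    · rw [zero_add, if_pos (by ring)]
      rfl
    · intro i hi
      rw [if_neg (by omega), LinearMap.zero_apply]
    · intro i
      rw [if_neg (by omega), LinearMap.zero_apply, map_zero]

theorem deriv_one : deriv (one : Fld W) = 0 := by
  refine ext_apply fun p w => ?_
  rw [deriv_apply, one_apply]
  split_ifs with h
  · rw [h, zero_smul]; rfl
  · rw [LinearMap.zero_apply, smul_zero]; rfl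

theorem deriv_nprod_one (a : Fld W) (n : ℤ) :
    deriv (nprod a n one) = -n • nprod a (n - 1) one := by
  rw [deriv_nprod, deriv_one, map_zero, zero_sub, neg_smul]

/-! ### Linearity of locality -/

theorem Local.zero_left (c : Fld W) : Local 0 c := by
  refine ⟨0, fun w => ?_⟩
  funext p q
  simp [bracketFun, zero_apply]

theorem Local.add_left {a b c : Fld W} (ha : Local a c) (hb : Local b c) : Local (a + b) c := by
  obtain ⟨N, hN⟩ := ha
  obtain ⟨N', hN'⟩ := hb
  refine ⟨max N N', fun w => ?_⟩
  have e : bracketFun (a + b) c w = bracketFun a c w + bracketFun b c w := by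
    funext p q
    simp only [bracketFun, add_apply, LinearMap.add_apply, map_add, Pi.add_apply]
    abel
  rw [e, map_add, mulDiff_pow_eq_zero (hN w) (le_max_left _ _),
    mulDiff_pow_eq_zero (hN' w) (le_max_right _ _), add_zero]

theorem Local.smul_left {a c : Fld W} (r : ℂ) (ha : Local a c) : Local (r • a) c := by
  obtain ⟨N, hN⟩ := ha
  refine ⟨N, fun w => ?_⟩
  have e : bracketFun (r • a) c w = r • bracketFun a c w := by
    funext p q
    simp only [bracketFun, smul_apply, LinearMap.smul_apply, map_smul, Pi.smul_apply, smul_sub]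
  rw [e, map_smul, hN, smul_zero]

/-! ### Fields as vertex operators -/

/-- A field, as a linear map to formal Laurent series. -/
def toVertexOperator : Fld W →ₗ[ℂ] HVertexOperator ℤ ℂ W W where
  toFun c := HVertexOperator.of_coeff (fun p => c p) fun w => by
    obtain ⟨N, hN⟩ := c.trunc w
    refine (BddBelow.isWF ⟨N, fun p hp => ?_⟩).isPWO
    by_contra h
    exact hp (hN p (not_le.1 h))
  map_add' _ _ := HVertexOperator.coeff_inj rfl
  map_smul' _ _ := HVertexOperator.coeff_inj rfl

theorem coeff_toVertexOperator (c : Fld W) : (toVertexOperator c).coeff = fun p => c p := rfl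

end Fld

/-! ### The state-field correspondence of a restricted representation -/

variable {n : ℕ} {ℓ : Fin n → ℕ} {χ : ℂ} {op : DiffIdx n → Module.End ℂ W}

/-- Induction on the vacuum module, built up from the vacuum vector by the operators
`t^{-m-1} ∂_t^r E_{i,j}`. -/
theorem vacuum_induction {P : Vacuum ℓ χ → Prop} (zero : P 0) (add : ∀ u v, P u → P v → P (u + v))
    (smul : ∀ (r : ℂ) v, P v → P (r • v)) (vac : P (vac ℓ χ))
    (act : ∀ (i j : Fin n) (m : ℕ) (s : ℕ) v, P v → P (act (diffE ℓ i j (-m - 1) s) v))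
    (v : Vacuum ℓ χ) : P v := by
  let Q : Submodule ℂ (Vacuum ℓ χ) :=
    { carrier := {v | P v}
      add_mem' := fun h h' => add _ _ h h'
      zero_mem' := zero
      smul_mem' := fun r _ h => smul r _ h }
  exact vacuum_eq_top Q vac act v

/-- The linear map from the vacuum module to the fields which sends the vacuum vector to `1` and
intertwines the modes `a_(m)` with the products `a_(m)` of fields. -/
structure IsFieldMap (h : IsRestricted op) (f : Vacuum ℓ χ →ₗ[ℂ] Fld W) : Prop where
  map_vac : f (vac ℓ χ) = Fld.one
  map_act : ∀ (i j : Fin n) (m : ℤ) (s : ℕ) v, f (act (diffE ℓ i j m s) v) =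
    Fld.nprod (h.field i j (ℓ j + s)) m (f v)

/-- The products with the fields of a restricted representation represent the Lie algebra, with
level `χ`, and the nonnegative modes annihilate the field `1`; so the universal property of the
vacuum module applies. -/
theorem exists_fieldMap (h : IsRestricted op) (hr : IsRep ℓ χ op) :
    ∃ f : Vacuum ℓ χ →ₗ[ℂ] Fld W, IsFieldMap h f := by
  obtain ⟨f, hf0, hf⟩ := exists_vacuum_lift (h.isRep_nprod hr).toLieHom Fld.one
    (fun i j m s => by rw [IsRep.toLieHom_diffE]; exact Fld.nprod_natCast_one _ _)
    (by rw [IsRep.toLieHom_kappa]; rfl)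
  refine ⟨f, hf0, fun i j m s v => ?_⟩
  rw [hf, IsRep.toLieHom_diffE]

variable {h : IsRestricted op} {f : Vacuum ℓ χ →ₗ[ℂ] Fld W}

/-- For negative `m`, the defining property of a field map is the recursion by normally ordered
products. -/
theorem IsFieldMap.isInductiveMap (hf : IsFieldMap h f) {E : Fin n → Fin n → ℕ → ℤ → W → W}
    (hE : ∀ i j s p w, E i j s p w = op ⟨i, j, -p - 1, ℓ j + s⟩ w) :
    IsInductiveMap E (Fld.toVertexOperator ∘ₗ f) := by
  refine ⟨fun p w => ?_, fun i j s m v p w => ?_⟩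
  · rw [LinearMap.comp_apply, hf.map_vac, Fld.coeff_toVertexOperator]
    dsimp only
    rw [Fld.one_apply]
    split_ifs <;> rfl
  · rw [LinearMap.comp_apply, hf.map_act, LinearMap.comp_apply, Fld.coeff_toVertexOperator,
      Fld.coeff_toVertexOperator, show E i j s = fun p w => h.field i j (ℓ j + s) p w from
      funext fun p => funext fun w => hE i j s p w, Fld.normalOrder_dividedDeriv]

theorem IsInductiveMap.ext {E : Fin n → Fin n → ℕ → ℤ → W → W}
    {Y Y' : Vacuum ℓ χ →ₗ[ℂ] HVertexOperator ℤ ℂ W W} (h : IsInductiveMap E Y)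
    (h' : IsInductiveMap E Y') : Y = Y' := by
  refine LinearMap.ext fun v => vacuum_eq_top (LinearMap.eqLocus Y Y') ?_ ?_ v
  · refine HVertexOperator.coeff_inj (funext fun p => LinearMap.ext fun w => ?_)
    rw [h.1, h'.1]
  · intro i j m s v hv
    have hv' : Y v = Y' v := hv
    refine HVertexOperator.coeff_inj (funext fun p => LinearMap.ext fun w => ?_)
    rw [h.2, h'.2, hv']

theorem IsFieldMap.local_field (hf : IsFieldMap h f) (hr : IsRep ℓ χ op) (i j : Fin n) (s : ℕ)
    (v : Vacuum ℓ χ) : Fld.Local (h.field i j (ℓ j + s)) (f v) := by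
  refine Fld.Local.symm ?_
  refine vacuum_induction (P := fun v => ∀ i j s, Fld.Local (f v) (h.field i j (ℓ j + s)))
    ?_ ?_ ?_ ?_ ?_ v i j s
  · intro i j s
    rw [map_zero]
    exact Fld.Local.zero_left _
  · intro u v hu hv i j s
    rw [map_add]
    exact (hu i j s).add_left (hv i j s)
  · intro r v hv i j s
    rw [map_smul]
    exact (hv i j s).smul_left r
  · intro i j s
    rw [hf.map_vac]
    exact Fld.local_one _
  · intro i' j' m s' v hv i j s
    rw [hf.map_act]
    exact (hv i' j' s').symm.nprod (h.local_field hr i' j' i j _ _ (Nat.le_add_right _ _)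
      (Nat.le_add_right _ _)) (hv i j s) _

theorem IsFieldMap.local (hf : IsFieldMap h f) (hr : IsRep ℓ χ op) (u v : Vacuum ℓ χ) :
    Fld.Local (f u) (f v) := by
  refine vacuum_induction (P := fun u => Fld.Local (f u) (f v)) ?_ ?_ ?_ ?_ ?_ u
  · rw [map_zero]
    exact Fld.Local.zero_left _
  · intro u u' hu hu'
    rw [map_add]
    exact hu.add_left hu'
  · intro r u hu
    rw [map_smul]
    exact hu.smul_left r
  · rw [hf.map_vac]
    exact Fld.local_one _
  · intro i j m s u hu
    rw [hf.map_act]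
    exact (hf.local_field hr i j s u).nprod (hf.local_field hr i j s v) hu _

theorem IsFieldMap.deriv (hf : IsFieldMap h f) {T : Vacuum ℓ χ →ₗ[ℂ] Vacuum ℓ χ}
    (hT : IsTranslation T) (v : Vacuum ℓ χ) : f (T v) = (f v).deriv := by
  refine vacuum_induction (P := fun v => f (T v) = (f v).deriv) ?_ ?_ ?_ ?_ ?_ v
  · rw [map_zero, map_zero]
    refine Fld.ext_apply fun p w => ?_
    rw [Fld.deriv_apply, Fld.zero_apply, Fld.zero_apply, LinearMap.zero_apply]
    exact (smul_zero _).symm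
  · intro u v hu hv
    rw [map_add, map_add, map_add, hu, hv]
    refine Fld.ext_apply fun p w => ?_
    simp only [Fld.deriv_apply, Fld.add_apply, LinearMap.add_apply, smul_add]
  · intro r v hv
    rw [map_smul, map_smul, map_smul, hv]
    refine Fld.ext_apply fun p w => ?_
    simp only [Fld.deriv_apply, Fld.smul_apply, LinearMap.smul_apply]
    exact smul_comm _ _ _
  · rw [hT.1, map_zero, hf.map_vac, Fld.deriv_one]
  · intro i j m s v hv
    rw [hT.act, map_sub, hf.map_act, hf.map_act, hv, Fld.deriv_nprod, glDeriv_diffE,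
      ← actHom_apply (_ • _), map_smul, LinearMap.smul_apply, map_smul, actHom_apply, hf.map_act]
    exact congrArg (Fld.nprod (h.field i j (ℓ j + s)) (-m - 1) (f v).deriv - ·)
      (Int.cast_smul_eq_zsmul ℂ (-m - 1) (Fld.nprod (h.field i j (ℓ j + s)) (-m - 1 - 1) (f v)))

/-! ### The vacuum module is restricted -/

theorem repOp_actHom (a : DiffIdx n) (ha : ℓ a.col ≤ a.ord) (v : Vacuum ℓ χ) :
    repOp (actHom ℓ χ) a v = act (diffE ℓ a.row a.col a.deg (a.ord - ℓ a.col)) v := by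
  rw [repOp, dif_pos ha, basisElt_eq, actHom_apply]

theorem isRep_actHom : IsRep ℓ χ (repOp (actHom ℓ χ)) := isRep_repOp _ actHom_kappa

theorem isRestricted_actHom : IsRestricted (repOp (actHom ℓ χ)) := by
  intro i j r w
  refine vacuum_induction (P := fun w => ∀ i j r, ∃ N : ℤ, ∀ p < N,
    repOp (actHom ℓ χ) ⟨i, j, -p - 1, r⟩ w = 0) ?_ ?_ ?_ ?_ ?_ w i j r
  · intro i j r
    exact ⟨0, fun p _ => map_zero _⟩
  · intro u v hu hv i j r
    obtain ⟨N, hN⟩ := hu i j r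
    obtain ⟨N', hN'⟩ := hv i j r
    refine ⟨min N N', fun p hp => ?_⟩
    rw [map_add, hN p (by omega), hN' p (by omega), add_zero]
  · intro r v hv i j r
    obtain ⟨N, hN⟩ := hv i j r
    exact ⟨N, fun p hp => by rw [map_smul, hN p hp, smul_zero]⟩
  · intro i j r
    refine ⟨0, fun p hp => ?_⟩
    by_cases hr : ℓ j ≤ r
    · rw [repOp_actHom _ hr]
      dsimp only
      obtain ⟨m, hm⟩ : ∃ m : ℕ, -p - 1 = m := ⟨(-p - 1).toNat, by omega⟩
      rw [hm, act_diffE_vac]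
    · rw [repOp, dif_neg hr, LinearMap.zero_apply]
  · intro i' j' m s v hv i j r
    by_cases hr : ℓ j ≤ r
    swap
    · exact ⟨0, fun p _ => by rw [repOp, dif_neg hr, LinearMap.zero_apply]⟩
    set a' : DiffIdx n := ⟨i', j', -m - 1, ℓ j' + s⟩ with ha'
    have e0 : act (diffE ℓ i' j' (-m - 1) s) v = repOp (actHom ℓ χ) a' v := by
      rw [repOp_actHom _ (Nat.le_add_right _ _)]
      simp only [ha', Nat.add_sub_cancel_left]
    -- commuting a generator with large `m` past a fixed generator leaves generators with large `m`
    obtain ⟨N, hN⟩ := hv i j r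
    have key : ∀ t : ℕ ⊕ ℕ ⊕ Unit, ∃ N : ℕ, ∀ k : ℤ, N ≤ k →
        commBase (fun i j r k => repOp (actHom ℓ χ) ⟨i, j, k, r⟩)
          (fun k : ℤ => if k = -1 then 1 else 0) i j i' j' r (ℓ j' + s) t k v = 0 := by
      have aux : ∀ i j r, ∃ N : ℕ, ∀ k : ℤ, N ≤ k → repOp (actHom ℓ χ) ⟨i, j, k, r⟩ v = 0 := by
        intro i j r
        obtain ⟨N, hN⟩ := hv i j r
        refine ⟨(-N).toNat, fun k hk => ?_⟩
        have := hN (-k - 1) (by omega)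
        rwa [show -(-k - 1) - 1 = k by ring] at this
      rintro (t | t | t)
      · exact aux _ _ _
      · exact aux _ _ _
      · refine ⟨0, fun k hk => ?_⟩
        rw [commBase, if_neg (by omega), LinearMap.zero_apply]
    choose K hK using key
    set Q := (commSet r (ℓ j' + s)).sup fun t => K t + commShift r (ℓ j' + s) t with hQ
    refine ⟨min N (-(Q : ℤ) - m - 2), fun p hp => ?_⟩
    rw [e0]
    have h1 := LinearMap.congr_fun (isRep_actHom (ℓ := ℓ) (χ := χ) ⟨i, j, -p - 1, r⟩ a' hr
      (Nat.le_add_right _ _)) v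
    have h2 := LinearMap.congr_fun (commutator_expansion (χ := χ)
      (fun i j r k => repOp (actHom ℓ χ) ⟨i, j, k, r⟩) 1 _ (fun _ => rfl)
      i j i' j' (-p - 1) (-m - 1) r (ℓ j' + s)) v
    have h3 := h1.trans h2
    rw [LinearMap.sum_apply, sum_eq_zero] at h3
    · rw [LinearMap.sub_apply, Module.End.mul_apply, Module.End.mul_apply, hN p (by omega),
        map_zero, sub_zero] at h3
      exact h3
    · intro t ht
      have hQt := le_sup (f := fun t => K t + commShift r (ℓ j' + s) t) ht
      rw [LinearMap.smul_apply, LinearMap.smul_apply, hK t _ (by push_cast [← hQ] at hQt; omega),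
        smul_zero, smul_zero]

end Structure

section Structure

attribute [local instance] LieRing.ofAssociativeRing

variable {W : Type*} [AddCommGroup W] [Module ℂ W]

variable {n : ℕ} {ℓ : Fin n → ℕ} {χ : ℂ}

/-! ### The vertex algebra of the vacuum module -/

section VertexAlgebra

variable {f : Vacuum ℓ χ →ₗ[ℂ] Fld (Vacuum ℓ χ)} {T : Vacuum ℓ χ →ₗ[ℂ] Vacuum ℓ χ}

theorem field_actHom_mode (i j : Fin n) (s : ℕ) (m : ℤ) (v : Vacuum ℓ χ) :
    ((isRestricted_actHom (ℓ := ℓ) (χ := χ)).field i j (ℓ j + s)).mode m v =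
      act (diffE ℓ i j m s) v := by
  rw [IsRestricted.field_mode, repOp_actHom _ (Nat.le_add_right _ _)]
  simp only [Nat.add_sub_cancel_left]

theorem isTransl_field_actHom (hT : IsTranslation T) (i j : Fin n) (s : ℕ) :
    Fld.IsTransl T ((isRestricted_actHom (ℓ := ℓ) (χ := χ)).field i j (ℓ j + s)) := by
  intro p v
  have e : ∀ (p : ℤ) (v : Vacuum ℓ χ),
      (isRestricted_actHom (ℓ := ℓ) (χ := χ)).field i j (ℓ j + s) p v =
        act (diffE ℓ i j (-p - 1) s) v := by
    intro p v
    rw [← field_actHom_mode, Fld.mode, show -(-p - 1) - 1 = p by ring]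
  rw [e, e, e, hT.act, glDeriv_diffE, ← actHom_apply (_ • _), map_smul, LinearMap.smul_apply,
    actHom_apply, Int.cast_smul_eq_zsmul, show -(p + 1) - 1 = -p - 1 - 1 by ring]
  module

theorem IsFieldMap.isTransl (hf : IsFieldMap isRestricted_actHom f) (hT : IsTranslation T)
    (v : Vacuum ℓ χ) : Fld.IsTransl T (f v) := by
  refine vacuum_induction (P := fun v => Fld.IsTransl T (f v)) ?_ ?_ ?_ ?_ ?_ v
  · intro p w
    rw [map_zero, Fld.zero_apply, Fld.zero_apply, LinearMap.zero_apply, LinearMap.zero_apply,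
      map_zero, sub_zero]
    exact (smul_zero _).symm
  · intro u v hu hv p w
    have h1 := hu p w
    have h2 := hv p w
    simp only [map_add, Fld.add_apply, LinearMap.add_apply, smul_add, ← h1, ← h2]
    abel
  · intro r v hv p w
    have h1 := hv p w
    simp only [map_smul, Fld.smul_apply, LinearMap.smul_apply]
    rw [smul_comm (p + 1) r, ← h1, smul_sub]
  · rw [hf.map_vac]
    exact Fld.isTransl_one T
  · intro i j m s v hv
    rw [hf.map_act]
    exact (isTransl_field_actHom hT i j s).nprod hv _

/-- `f(v)(z)|0⟩` is a power series with constant term `v`. -/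
theorem IsFieldMap.creation (hf : IsFieldMap isRestricted_actHom f) (v : Vacuum ℓ χ) :
    (∀ p < 0, f v p (vac ℓ χ) = 0) ∧ f v 0 (vac ℓ χ) = v := by
  refine vacuum_induction (P := fun v => (∀ p < 0, f v p (vac ℓ χ) = 0) ∧ f v 0 (vac ℓ χ) = v)
    ?_ ?_ ?_ ?_ ?_ v
  · rw [map_zero]
    exact ⟨fun p _ => rfl, rfl⟩
  · intro u v hu hv
    refine ⟨fun p hp => ?_, ?_⟩
    · rw [map_add, Fld.add_apply, LinearMap.add_apply, hu.1 p hp, hv.1 p hp, add_zero]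
    · rw [map_add, Fld.add_apply, LinearMap.add_apply, hu.2, hv.2]
  · intro r v hv
    refine ⟨fun p hp => ?_, ?_⟩
    · rw [map_smul, Fld.smul_apply, LinearMap.smul_apply, hv.1 p hp, smul_zero]
    · rw [map_smul, Fld.smul_apply, LinearMap.smul_apply, hv.2]
  · rw [hf.map_vac]
    refine ⟨fun p hp => ?_, ?_⟩
    · rw [Fld.one_apply, if_neg (by omega), LinearMap.zero_apply]
    · rw [Fld.one_apply, if_pos rfl, LinearMap.id_apply]
  · intro i j m s v hv
    rw [hf.map_act]
    have hN' : ∀ i' : ℕ, 0 ≤ i' →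
        ((isRestricted_actHom (ℓ := ℓ) (χ := χ)).field i j (ℓ j + s)).mode i' (vac ℓ χ) = 0 := by
      intro i' _
      rw [field_actHom_mode, act_diffE_vac]
    refine ⟨fun p hp => ?_, ?_⟩
    · rw [Fld.nprod_apply _ _ _ p _ 0 0 (fun i' _ => hv.1 _ (by omega)) hN', sum_range_zero,
        sum_range_zero, sub_zero]
    · rw [Fld.nprod_apply _ _ _ 0 _ 1 0 (fun i' _ => hv.1 _ (by omega)) hN', sum_range_zero,
        sum_range_one, sub_zero, Nat.cast_zero, sub_zero, sub_zero, hv.2, field_actHom_mode]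
      simp

theorem IsFieldMap.translation_vac (hf : IsFieldMap isRestricted_actHom f) (hT : IsTranslation T)
    (v : Vacuum ℓ χ) (p : ℤ) :
    T (f v p (vac ℓ χ)) = (p + 1) • f v (p + 1) (vac ℓ χ) := by
  have := hf.isTransl hT v p (vac ℓ χ)
  rwa [hT.1, map_zero, sub_zero] at this

theorem IsFieldMap.exp_translation (hf : IsFieldMap isRestricted_actHom f) (hT : IsTranslation T)
    (v : Vacuum ℓ χ) (p : ℕ) : f v p (vac ℓ χ) = ((p.factorial : ℂ)⁻¹) • (T ^ p) v := by
  induction p with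
  | zero => simpa using (hf.creation v).2
  | succ p ih =>
    have h1 := hf.translation_vac hT v p
    have h0 : ((p : ℂ) + 1) ≠ 0 := by exact_mod_cast p.succ_ne_zero
    rw [ih, map_smul, ← Module.End.mul_apply, ← pow_succ', ← Int.cast_smul_eq_zsmul ℂ] at h1
    rw [Nat.factorial_succ, Nat.cast_mul, mul_inv, mul_smul, h1, smul_smul]
    push_cast
    rw [inv_mul_cancel₀ h0, one_smul]

theorem IsFieldMap.isVertexAlgebra (hf : IsFieldMap isRestricted_actHom f)
    (hT : IsTranslation T) :
    IsVertexAlgebra (Fld.toVertexOperator ∘ₗ f) T (vac ℓ χ) where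
  vacuum p w := by
    change f (vac ℓ χ) p w = _
    rw [hf.map_vac, Fld.one_apply]
    split_ifs <;> rfl
  translation v p w := hf.isTransl hT v p w
  creation v p := hf.exp_translation hT v p
  creation_neg v p hp := (hf.creation v).1 p hp
  locality u v := (hf.local isRep_actHom u v).isLocal

end VertexAlgebra

/-! ### Modules of the vertex algebra -/

variable {op : DiffIdx n → Module.End ℂ W} {h : IsRestricted op}
  {f : Vacuum ℓ χ →ₗ[ℂ] Fld (Vacuum ℓ χ)} {g : Vacuum ℓ χ →ₗ[ℂ] Fld W}

/-- The property `IsFieldMap.mode` for the vacuum vector: both sides are divided derivatives of the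
same field. -/
theorem IsFieldMap.mode_vac (hf : IsFieldMap isRestricted_actHom f) (hg : IsFieldMap h g)
    (u : Vacuum ℓ χ) (k : ℤ) :
    g ((f u).mode k (vac ℓ χ)) = Fld.nprod (g u) k Fld.one := by
  obtain ⟨T, hT, -⟩ := existsUnique_translation (ℓ := ℓ) (χ := χ)
  obtain ⟨j, rfl | rfl⟩ : ∃ j : ℕ, k = j ∨ k = -j - 1 := by
    rcases le_or_gt 0 k with h | h
    · exact ⟨k.toNat, Or.inl (by omega)⟩
    · exact ⟨(-k - 1).toNat, Or.inr (by omega)⟩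
  · rw [Fld.mode, (hf.creation u).1 _ (by omega), map_zero, Fld.nprod_natCast_one]
  · induction j with
    | zero =>
      rw [Nat.cast_zero, neg_zero, zero_sub, Fld.nprod_neg_one_one, Fld.mode, neg_neg, sub_self,
        (hf.creation u).2]
    | succ j ih =>
      rw [Fld.mode, show -(-(j : ℤ) - 1) - 1 = j by ring] at ih
      have h0 : ((j : ℂ) + 1) ≠ 0 := by exact_mod_cast j.succ_ne_zero
      have h1 := congrArg g (hf.translation_vac hT u j)
      rw [hg.deriv hT, ih, Fld.deriv_nprod_one, map_zsmul, ← Int.cast_smul_eq_zsmul ℂ,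
        ← Int.cast_smul_eq_zsmul ℂ] at h1
      rw [Fld.mode, show -(-((j + 1 : ℕ) : ℤ) - 1) - 1 = (j : ℤ) + 1 by push_cast; ring,
        show -((j + 1 : ℕ) : ℤ) - 1 = -(j : ℤ) - 1 - 1 by push_cast; ring]
      push_cast at h1
      rw [show -(-(j : ℂ) - 1) = j + 1 by ring] at h1
      exact (smul_right_injective _ h0 h1).symm

/-- The map to the fields on `W` turns the products of the vertex algebra into the products of
fields. -/
theorem IsFieldMap.mode (hf : IsFieldMap isRestricted_actHom f) (hg : IsFieldMap h g)
    (hr : IsRep ℓ χ op) (u v : Vacuum ℓ χ) (k : ℤ) :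
    g ((f u).mode k v) = Fld.nprod (g u) k (g v) := by
  refine vacuum_induction (P := fun v => ∀ u k, g ((f u).mode k v) = Fld.nprod (g u) k (g v))
    ?_ ?_ ?_ ?_ ?_ v u k
  · intro u k
    rw [map_zero, map_zero, map_zero]
  · intro v v' hv hv' u k
    rw [map_add, map_add, map_add, map_add, hv, hv']
  · intro r v hv u k
    rw [map_smul, map_smul, map_smul, map_smul, hv]
  · intro u k
    rw [hf.mode_vac hg, hg.map_vac]
  · intro i j m s v hv u k
    -- Both `f` and `g` satisfy the commutator formula for a generator and `u`. Its right-hand sides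
    -- agree because the induction hypothesis holds for all states, in particular for those obtained
    -- from `u` by the nonnegative modes of the generator.
    have e : ∀ N : ℕ, f (act (diffE ℓ i j N s) u) = _ := fun N => hf.map_act i j N s u
    have e' : ∀ N : ℕ, g (act (diffE ℓ i j N s) u) = _ := fun N => hg.map_act i j N s u
    obtain ⟨N, hN⟩ := (hf.local_field isRep_actHom i j s u).comm_modes
    obtain ⟨N', hN'⟩ := (hg.local_field hr i j s u).comm_nprod
    have h1 := congrArg g (hN (max N N') (le_max_left _ _) (-m - 1) k v)
    have h2 := hN' (max N N') (le_max_right _ _) (-m - 1) k (g v)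
    rw [field_actHom_mode, field_actHom_mode, map_sub, hg.map_act, hv, map_sum] at h1
    rw [hg.map_act]
    have h3 : ∀ t ∈ range (max N N'), g (Ring.choose (-(m : ℤ) - 1) t •
        (Fld.nprod (isRestricted_actHom.field i j (ℓ j + s)) t (f u)).mode (-m - 1 + k - t) v) =
        Ring.choose (-(m : ℤ) - 1) t •
          Fld.nprod (Fld.nprod (h.field i j (ℓ j + s)) t (g u)) (-m - 1 + k - t) (g v) := by
      intro t _
      rw [map_zsmul, ← e, ← e', hv]
    rw [sum_congr rfl h3, ← h2] at h1
    exact sub_right_injective h1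

theorem IsFieldMap.isVertexModule (hf : IsFieldMap isRestricted_actHom f) (hg : IsFieldMap h g)
    (hr : IsRep ℓ χ op) {T : Vacuum ℓ χ →ₗ[ℂ] Vacuum ℓ χ} (hT : IsTranslation T) :
    IsVertexModule (Fld.toVertexOperator ∘ₗ f) T (vac ℓ χ) (Fld.toVertexOperator ∘ₗ g) where
  vacuum p w := by
    change g (vac ℓ χ) p w = _
    rw [hg.map_vac, Fld.one_apply]
    split_ifs <;> rfl
  translation v p w := by
    change g (T v) p w = _
    rw [hg.deriv hT]
    rfl
  locality u v := (hg.local hr u v).isLocal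
  associativity u v w := by
    obtain ⟨N, hN⟩ := (g u).trunc w
    refine ⟨(-N).toNat + 1, Nat.succ_pos _, fun p q => ?_⟩
    refine (Fld.assoc_relation (g u) (g v) w _ (fun p hp => hN p (by push_cast at hp; omega)) p
      q).trans (sum_congr rfl fun k _ => ?_)
    rw [← hf.mode hg hr, Fld.mode, show -((k : ℤ) - p - 1) - 1 = p - k by ring]
    rfl

/-- A generating field is the image of a state. -/
theorem IsFieldMap.generator (hg : IsFieldMap h g) (i j : Fin n) (s : ℕ) :
    g (act (diffE ℓ i j (-1) s) (vac ℓ χ)) = h.field i j (ℓ j + s) := by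
  rw [hg.map_act, hg.map_vac, Fld.nprod_neg_one_one]

end Structure

/-! ### Modules over the Lie algebra of infinite matrices -/

section Matrices

variable {M : Type*} [AddCommGroup M] [Module ℂ M] [LieRingModule GlInf M] [LieModule ℂ GlInf M]

theorem glInf_span (S : Submodule ℂ GlInf) (h : ∀ p q, matE p q ∈ S) (hκ : kappa0 ∈ S)
    (x : GlInf) : x ∈ S := by
  let φ : (ℤ × ℤ →₀ ℂ) → GlInf := fun u => ((u, 0) : (ℤ × ℤ →₀ ℂ) × ℂ)
  have key : ∀ u, φ u ∈ S := by
    intro u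
    induction u using Finsupp.induction_linear with
    | zero => exact S.zero_mem
    | add u v hu hv =>
      have e : φ (u + v) = φ u + φ v := Prod.ext rfl (add_zero (0 : ℂ)).symm
      rw [e]
      exact S.add_mem hu hv
    | single a r =>
      have e : φ (Finsupp.single a r) = r • matE a.1 a.2 := by
        refine Prod.ext ?_ (mul_zero r).symm
        change Finsupp.single a r = r • Finsupp.single a 1
        rw [Finsupp.smul_single, smul_eq_mul, mul_one]
      rw [e]
      exact S.smul_mem r (h _ _)
  have e : x = φ x.1 + x.2 • kappa0 := by
    refine Prod.ext ?_ ?_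
    · change x.1 = x.1 + x.2 • (0 : ℤ × ℤ →₀ ℂ)
      rw [smul_zero, add_zero]
    · change x.2 = 0 + x.2 * 1
      ring
  rw [e]
  exact S.add_mem (key _) (S.smul_mem _ hκ)

variable (M) in
/-- The action of the matrix unit which maps the basis vector at position `Q` to the basis vector at
position `P`, that is of `E_{P+1/2, -Q-1/2}`. -/
def unitOp (P Q : ℤ) : Module.End ℂ M where
  toFun w := ⁅matE P (-Q - 1), w⁆
  map_add' := lie_add _
  map_smul' r w := lie_smul r _ w

theorem unitOp_apply (P Q : ℤ) (w : M) : unitOp M P Q w = ⁅matE P (-Q - 1), w⁆ := rfl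

theorem bracket_matE (P Q R S : ℤ) : (⁅matE P (-Q - 1), matE R (-S - 1)⁆ : GlInf) =
    ((if Q = R then matE P (-S - 1) else 0) - if S = P then matE R (-Q - 1) else 0) +
      (if Q = R ∧ S = P then stepH P - stepH Q else 0 : ℂ) • kappa0 := by
  have e1 : matMul (P, -Q - 1) (R, -S - 1) = (if Q = R then matE P (-S - 1) else 0 : GlInf).1 ∧
      (if Q = R then matE P (-S - 1) else 0 : GlInf).2 = 0 := by
    unfold matMul
    dsimp only
    by_cases h : Q = R
    · rw [if_pos (by omega), if_pos h]; exact ⟨rfl, rfl⟩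
    · rw [if_neg (by omega), if_neg h]; exact ⟨rfl, rfl⟩
  have e2 : matMul (R, -S - 1) (P, -Q - 1) = (if S = P then matE R (-Q - 1) else 0 : GlInf).1 ∧
      (if S = P then matE R (-Q - 1) else 0 : GlInf).2 = 0 := by
    unfold matMul
    dsimp only
    by_cases h : S = P
    · rw [if_pos (by omega), if_pos h]; exact ⟨rfl, rfl⟩
    · rw [if_neg (by omega), if_neg h]; exact ⟨rfl, rfl⟩
  have e3 : matCoc (P, -Q - 1) (R, -S - 1) =
      if Q = R ∧ S = P then stepH P - stepH Q else 0 := by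
    rw [matCoc_eq]
    dsimp only
    by_cases h : Q = R ∧ S = P
    · rw [if_pos h, if_pos (by omega), h.1]
    · rw [if_neg h, if_neg (by omega)]
  generalize (if Q = R then matE P (-S - 1) else 0 : GlInf) = X at *
  generalize (if S = P then matE R (-Q - 1) else 0 : GlInf) = Y at *
  generalize (if Q = R ∧ S = P then stepH P - stepH Q else 0 : ℂ) = c at *
  refine Prod.ext ?_ ?_
  · change bilin matMul (Finsupp.single (P, -Q - 1) 1) (Finsupp.single (R, -S - 1) 1) -
      bilin matMul (Finsupp.single (R, -S - 1) 1) (Finsupp.single (P, -Q - 1) 1) =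
      X.1 - Y.1 + c • (0 : ℤ × ℤ →₀ ℂ)
    rw [bilin_single, bilin_single, e1.1, e2.1, smul_zero, add_zero]
  · change bilin matCoc (Finsupp.single (P, -Q - 1) 1) (Finsupp.single (R, -S - 1) 1) =
      X.2 - Y.2 + c * 1
    rw [bilin_single, e1.2, e2.2, e3]
    ring

theorem unitOp_comm {χ : ℂ} (hκ : ∀ w : M, ⁅kappa0, w⁆ = χ • w) (P Q R S : ℤ) (w : M) :
    unitOp M P Q (unitOp M R S w) - unitOp M R S (unitOp M P Q w) =
      ((if Q = R then unitOp M P S w else 0) - if S = P then unitOp M R Q w else 0) +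
        (χ * if Q = R ∧ S = P then stepH P - stepH Q else 0) • w := by
  simp only [unitOp_apply]
  rw [← lie_lie, bracket_matE, add_lie, sub_lie, smul_lie, hκ, smul_smul, mul_comm χ]
  congr 2
  · split_ifs <;> simp
  · split_ifs <;> simp

/-- Every vector of a finitely placed module is annihilated by the matrix units which are far away
from the origin. -/
theorem IsFinitelyPlaced.unitOp_eq_zero (hfin : IsFinitelyPlaced M)
    (w : M) : ∃ m : ℕ, ∀ P Q : ℤ, ((m : ℤ) ≤ P ∧ (m : ℤ) ≤ Q ∨ P < -m ∧ Q < -m) →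
      unitOp M P Q w = 0 := by
  obtain ⟨m₀, M₀, hgen, hM₀⟩ := hfin
  let S : Submodule ℂ M :=
    { carrier := {w | ∃ m : ℕ, ∀ P Q : ℤ, ((m : ℤ) ≤ P ∧ (m : ℤ) ≤ Q ∨ P < -m ∧ Q < -m) →
        unitOp M P Q w = 0}
      zero_mem' := ⟨0, fun P Q _ => map_zero _⟩
      add_mem' := by
        rintro x y ⟨m, hm⟩ ⟨m', hm'⟩
        refine ⟨max m m', fun P Q h => ?_⟩
        rw [map_add, hm P Q (by omega), hm' P Q (by omega), add_zero]
      smul_mem' := by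
        rintro r x ⟨m, hm⟩
        exact ⟨m, fun P Q h => by rw [map_smul, hm P Q h, smul_zero]⟩ }
  have hS : ∀ x : GlInf, ∀ w ∈ S, ⁅x, w⁆ ∈ S := by
    intro x
    let L : Submodule ℂ GlInf :=
      { carrier := {x | ∀ w ∈ S, ⁅x, w⁆ ∈ S}
        zero_mem' := fun w _ => by rw [zero_lie]; exact S.zero_mem
        add_mem' := fun hx hy w hw => by rw [add_lie]; exact S.add_mem (hx w hw) (hy w hw)
        smul_mem' := fun r x hx w hw => by rw [smul_lie]; exact S.smul_mem r (hx w hw) }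
    refine glInf_span L ?_ ?_ x
    · rintro R q w ⟨m, hm⟩
      refine ⟨m + R.natAbs + q.natAbs + 2, fun P Q h => ?_⟩
      have h1 := bracket_matE P Q R (-q - 1)
      rw [if_neg (by omega), if_neg (by omega), if_neg (by omega), sub_zero, zero_smul, add_zero,
        show -(-q - 1) - 1 = q by ring] at h1
      have h2 := lie_lie (matE P (-Q - 1)) (matE R q) w
      rw [h1, zero_lie, ← unitOp_apply P Q w, hm P Q (by omega), lie_zero, sub_zero] at h2
      exact h2.symm
    · rintro w ⟨m, hm⟩
      refine ⟨m, fun P Q h => ?_⟩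
      have h1 : ⁅matE P (-Q - 1), kappa0⁆ = 0 := by
        refine Prod.ext ?_ ?_
        · change bilin matMul _ (0 : ℤ × ℤ →₀ ℂ) - bilin matMul (0 : ℤ × ℤ →₀ ℂ) _ = 0
          simp
        · change bilin matCoc _ (0 : ℤ × ℤ →₀ ℂ) = 0
          simp
      have h2 := lie_lie (matE P (-Q - 1)) kappa0 w
      rw [h1, zero_lie, ← unitOp_apply P Q w, hm P Q h, lie_zero, sub_zero] at h2
      exact h2.symm
  let N : LieSubmodule ℂ GlInf M := { S with lie_mem := fun {x w} hw => hS x w hw }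
  have hle : LieSubmodule.lieSpan ℂ GlInf (M₀ : Set M) ≤ N := by
    refine LieSubmodule.lieSpan_le.2 fun w hw => ⟨m₀, fun P Q h => ?_⟩
    refine hM₀ _ (Submodule.subset_span ?_) w hw
    rcases h with h | h
    · exact ⟨P, Q, h.1, h.2, Or.inl rfl⟩
    · exact ⟨-P - 1, -Q - 1, by omega, by omega, Or.inr (by rw [show -(-P - 1) - 1 = P by ring])⟩
  rw [hgen] at hle
  exact hle (LieSubmodule.mem_top w)

/-! ### Band matrices -/

/-- The space of band matrices, i.e. of infinite matrices supported in a strip around the diagonal.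
-/
def bandSubmodule : Submodule ℂ (ℤ → ℤ → ℂ) where
  carrier := {K | ∃ B : ℕ, ∀ P Q : ℤ, K P Q ≠ 0 → |P - Q| ≤ B}
  zero_mem' := ⟨0, fun _ _ h => absurd rfl h⟩
  add_mem' := by
    rintro K L ⟨B, hB⟩ ⟨B', hB'⟩
    refine ⟨max B B', fun P Q h => ?_⟩
    by_cases hK : K P Q = 0
    · by_cases hL : L P Q = 0
      · exact absurd (by simp [hK, hL]) h
      · exact (hB' P Q hL).trans (by simp)
    · exact (hB P Q hK).trans (by simp)
  smul_mem' := by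
    rintro r K ⟨B, hB⟩
    exact ⟨B, fun P Q h => hB P Q fun hK => h (by simp [hK])⟩

/-- The square `[-A, A) × [-A, A)` of positions. -/
def centralBox (A : ℕ) : Finset (ℤ × ℤ) := Ico (-A : ℤ) A ×ˢ Ico (-A : ℤ) A

theorem mem_centralBox {A : ℕ} {x : ℤ × ℤ} : x ∈ centralBox A ↔
    (-(A : ℤ) ≤ x.1 ∧ x.1 < A) ∧ -(A : ℤ) ≤ x.2 ∧ x.2 < A := by
  rw [centralBox, mem_product, mem_Ico, mem_Ico]

variable (M) in
/-- The family of operators whose sum is the action of a matrix. -/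
def bandTerm (K : ℤ → ℤ → ℂ) (x : ℤ × ℤ) : Module.End ℂ M := K x.1 x.2 • unitOp M x.1 x.2

theorem bandTerm_support (hfin : IsFinitelyPlaced M) (K : bandSubmodule) (w : M) :
    ∃ A₀ : ℕ, ∀ A ≥ A₀, ∀ x, x ∉ centralBox A → bandTerm M K.1 x w = 0 := by
  obtain ⟨m, hm⟩ := hfin.unitOp_eq_zero w
  obtain ⟨B, hB⟩ := K.2
  refine ⟨m + B, fun A hA x hx => ?_⟩
  rw [bandTerm, LinearMap.smul_apply]
  by_cases h : K.1 x.1 x.2 = 0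
  · rw [h, zero_smul]
  · have h1 := abs_le.1 (hB _ _ h)
    rw [hm, smul_zero]
    rw [mem_centralBox] at hx
    omega

theorem bandTerm_finite (hfin : IsFinitelyPlaced M) (K : bandSubmodule) (w : M) :
    {x | bandTerm M K.1 x w ≠ 0}.Finite := by
  obtain ⟨A, hA⟩ := bandTerm_support hfin K w
  refine (centralBox A).finite_toSet.subset fun x hx => ?_
  by_contra h
  exact hx (hA A le_rfl x h)

/-- The action of a band matrix on a finitely placed module. -/
def bandOp (hfin : IsFinitelyPlaced M) : bandSubmodule →ₗ[ℂ] Module.End ℂ M where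
  toFun K := locSum (bandTerm M K.1) (bandTerm_finite hfin K)
  map_add' K L := by
    refine LinearMap.ext fun w => ?_
    rw [LinearMap.add_apply, locSum_apply, locSum_apply, locSum_apply,
      ← finsum_add_distrib (bandTerm_finite hfin K w) (bandTerm_finite hfin L w)]
    exact finsum_congr fun x => LinearMap.congr_fun (add_smul _ _ _) w
  map_smul' r K := by
    refine LinearMap.ext fun w => ?_
    rw [RingHom.id_apply, LinearMap.smul_apply, locSum_apply, locSum_apply, smul_finsum]
    exact finsum_congr fun x => LinearMap.congr_fun (mul_smul _ _ _) w

theorem bandOp_apply (hfin : IsFinitelyPlaced M) (K : bandSubmodule) (w : M) :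
    bandOp hfin K w = ∑ᶠ x : ℤ × ℤ, K.1 x.1 x.2 • unitOp M x.1 x.2 w :=
  locSum_apply _ (bandTerm_finite hfin K) w

theorem bandOp_eq_sum (hfin : IsFinitelyPlaced M) (K : bandSubmodule) (w : M) :
    ∃ A₀ : ℕ, ∀ A ≥ A₀, bandOp hfin K w = ∑ x ∈ centralBox A, K.1 x.1 x.2 • unitOp M x.1 x.2 w := by
  obtain ⟨A₀, hA₀⟩ := bandTerm_support hfin K w
  refine ⟨A₀, fun A hA => ?_⟩
  rw [bandOp_apply]
  refine finsum_eq_sum_of_support_subset _ fun x hx => ?_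
  by_contra h
  exact hx (hA₀ A hA x h)

theorem sum_centralBox_mul (hfin : IsFinitelyPlaced M) (K L X : bandSubmodule)
    (hX : ∀ P R, ∑ᶠ Q, K.1 P Q * L.1 Q R = X.1 P R) (w : M) : ∃ A₀ : ℕ, ∀ A ≥ A₀,
    ∑ x ∈ centralBox A, ∑ y ∈ centralBox A, (K.1 x.1 x.2 * L.1 y.1 y.2) •
      (if x.2 = y.1 then unitOp M x.1 y.2 w else 0) = bandOp hfin X w := by
  obtain ⟨A₀, hA₀⟩ := bandOp_eq_sum hfin X w
  obtain ⟨m, hm⟩ := hfin.unitOp_eq_zero w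
  obtain ⟨B, hB⟩ := K.2
  obtain ⟨B', hB'⟩ := L.2
  refine ⟨max A₀ (m + B + B'), fun A hA => ?_⟩
  rw [hA₀ A (by omega)]
  simp only [centralBox, sum_product]
  refine sum_congr rfl fun P hP => ?_
  have e : ∀ Q ∈ Ico (-A : ℤ) A, ∑ R ∈ Ico (-A : ℤ) A, ∑ S ∈ Ico (-A : ℤ) A,
      (K.1 P Q * L.1 R S) • (if Q = R then unitOp M P S w else 0) =
      ∑ S ∈ Ico (-A : ℤ) A, (K.1 P Q * L.1 Q S) • unitOp M P S w := by
    intro Q hQ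
    rw [sum_eq_single_of_mem Q hQ]
    · simp only [if_true]
    · intro R _ hR
      refine sum_eq_zero fun S _ => ?_
      rw [if_neg (Ne.symm hR), smul_zero]
  rw [sum_congr rfl e, sum_comm]
  refine sum_congr rfl fun S hS => ?_
  rw [← sum_smul]
  by_cases hz : unitOp M P S w = 0
  · rw [hz, smul_zero, smul_zero]
  · congr 1
    rw [← hX]
    refine (finsum_eq_sum_of_support_subset _ fun Q hQ => ?_).symm
    have h1 := abs_le.1 (hB P Q (left_ne_zero_of_mul hQ))
    have h2 := abs_le.1 (hB' Q S (right_ne_zero_of_mul hQ))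
    rw [coe_Ico, Set.mem_Ico]
    by_contra hcon
    exact hz (hm P S (by omega))

/-- The commutator of the actions of two band matrices `K`, `L` with products `X = KL` and `Y = LK`;
the central term is the stable value `γ` of the cocycle on large squares. -/
theorem bandOp_comm {χ : ℂ} (hκ : ∀ w : M, ⁅kappa0, w⁆ = χ • w) (hfin : IsFinitelyPlaced M)
    (K L X Y : bandSubmodule) (hX : ∀ P R, ∑ᶠ Q, K.1 P Q * L.1 Q R = X.1 P R)
    (hY : ∀ P R, ∑ᶠ Q, L.1 P Q * K.1 Q R = Y.1 P R) (γ : ℂ)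
    (hγ : ∃ A₀ : ℕ, ∀ A ≥ A₀,
      ∑ x ∈ centralBox A, K.1 x.1 x.2 * L.1 x.2 x.1 * (stepH x.1 - stepH x.2) = γ) (w : M) :
    bandOp hfin K (bandOp hfin L w) - bandOp hfin L (bandOp hfin K w) =
      bandOp hfin (X - Y) w + (χ * γ) • w := by
  obtain ⟨A₁, h₁⟩ := bandOp_eq_sum hfin L w
  obtain ⟨A₂, h₂⟩ := bandOp_eq_sum hfin K (bandOp hfin L w)
  obtain ⟨A₃, h₃⟩ := bandOp_eq_sum hfin K w
  obtain ⟨A₄, h₄⟩ := bandOp_eq_sum hfin L (bandOp hfin K w)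
  obtain ⟨A₅, h₅⟩ := sum_centralBox_mul hfin K L X hX w
  obtain ⟨A₆, h₆⟩ := sum_centralBox_mul hfin L K Y hY w
  obtain ⟨A₇, h₇⟩ := hγ
  set A := A₁ + A₂ + A₃ + A₄ + A₅ + A₆ + A₇
  rw [h₂ A (by omega), h₄ A (by omega), h₁ A (by omega), h₃ A (by omega), map_sub,
    LinearMap.sub_apply, ← h₅ A (by omega), ← h₆ A (by omega), ← h₇ A (by omega)]
  simp only [map_sum, smul_sum, map_smul]
  rw [sum_comm (s := centralBox A) (t := centralBox A)
      (f := fun x y => L.1 x.1 x.2 • K.1 y.1 y.2 • _), ← sum_sub_distrib,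
    sum_comm (s := centralBox A) (t := centralBox A)
      (f := fun x y => (L.1 x.1 x.2 * K.1 y.1 y.2) • _), ← sum_sub_distrib, mul_sum, sum_smul,
    ← sum_add_distrib]
  refine sum_congr rfl fun x hx => ?_
  rw [← sum_sub_distrib, ← sum_sub_distrib]
  have e : (χ * (K.1 x.1 x.2 * L.1 x.2 x.1 * (stepH x.1 - stepH x.2))) • w =
      ∑ y ∈ centralBox A, (K.1 x.1 x.2 * L.1 y.1 y.2) •
        (χ * if x.2 = y.1 ∧ y.2 = x.1 then stepH x.1 - stepH x.2 else 0) • w := by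
    have hx' : (x.2, x.1) ∈ centralBox A := mem_centralBox.2 (mem_centralBox.1 hx).symm
    rw [sum_eq_single_of_mem _ hx', if_pos ⟨rfl, rfl⟩, smul_smul]
    · congr 1
      ring
    · intro y _ hy
      rw [if_neg, mul_zero, zero_smul, smul_zero]
      rintro ⟨h1, h2⟩
      exact hy (Prod.ext h1.symm h2)
  rw [e, ← sum_add_distrib]
  refine sum_congr rfl fun y _ => ?_
  rw [smul_smul, smul_smul, mul_comm (L.1 y.1 y.2), ← smul_sub, unitOp_comm hκ, ← smul_sub,
    ← smul_add]

end Matrices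

/-! ### Primitives of products of falling factorials -/

section Primitive

variable {n : ℕ}

theorem fall_eq_zero_of_le {x : ℂ} {l r : ℕ} (h : fall x l = 0) (hr : l ≤ r) : fall x r = 0 := by
  obtain ⟨k, rfl⟩ := Nat.exists_eq_add_of_le hr
  rw [fall_add, h, zero_mul]

/-- A polynomial with difference `⟨y⟩_s ⟨y + m - s⟩_r`, where `t^k ∂^r` is the first and `t^m ∂^s`
the second operator. -/
def primitive (a b : DiffIdx n) (y : ℂ) : ℂ :=
  ∑ s ∈ range (a.ord + 1), (a.ord.choose s : ℂ) * fall b.deg s *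
    (fall y (a.ord + b.ord - s + 1) / ((a.ord + b.ord - s : ℕ) + 1))

theorem primitive_zero (a b : DiffIdx n) : primitive a b 0 = 0 :=
  sum_eq_zero fun s _ => by rw [fall_zero_succ, zero_div, mul_zero]

theorem primitive_add_one (a b : DiffIdx n) (y : ℂ) : primitive a b (y + 1) =
    primitive a b y + fall y b.ord * fall (y + (b.deg - b.ord)) a.ord := by
  rw [← fall_leibniz, primitive, primitive, ← sum_add_distrib]
  refine sum_congr rfl fun s _ => ?_
  have h : (((a.ord + b.ord - s : ℕ) : ℂ) + 1) ≠ 0 := Nat.cast_add_one_ne_zero _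
  rw [fall_diff]
  field_simp

theorem primitive_eq_eval (a b : DiffIdx n) (c : ℂ) :
    ∃ p : Polynomial ℂ, ∀ y, p.eval y = primitive a b (y + c) := by
  refine ⟨∑ s ∈ range (a.ord + 1), Polynomial.C ((a.ord.choose s : ℂ) * fall b.deg s /
    ((a.ord + b.ord - s : ℕ) + 1)) *
    (descPochhammer ℂ (a.ord + b.ord - s + 1)).comp (Polynomial.X + Polynomial.C c), fun y => ?_⟩
  rw [Polynomial.eval_finsetSum, primitive]
  refine sum_congr rfl fun s _ => ?_
  simp only [Polynomial.eval_mul, Polynomial.eval_C, Polynomial.eval_comp, Polynomial.eval_add,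
    Polynomial.eval_X, fall]
  ring

/-- The primitives for the two orders of the factors differ by a translation and a constant, and
this constant is the cocycle: both primitives have the same differences, so the polynomial
`primitive a b (y + (a.deg - a.ord)) - primitive b a y` takes the same value at all natural numbers.
-/
theorem primitive_sub_primitive (a b : DiffIdx n)
    (h : a.deg - a.ord + (b.deg - b.ord) = 0) (y : ℂ) :
    primitive a b (y + (a.deg - a.ord)) - primitive b a y =
      signedSum (a.deg - a.ord) (fun x => fall x b.ord * fall (x - (a.deg - a.ord) : ℤ) a.ord) := by
  have hC : (a.deg : ℂ) - a.ord + (b.deg - b.ord) = 0 := by exact_mod_cast h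
  obtain ⟨p, hp⟩ := primitive_eq_eval a b (a.deg - a.ord)
  obtain ⟨q, hq⟩ := primitive_eq_eval b a 0
  simp only [add_zero] at hq
  have hper : ∀ k : ℕ, (p - q).eval (k : ℂ) = (Polynomial.C ((p - q).eval 0)).eval (k : ℂ) := by
    intro k
    rw [Polynomial.eval_C]
    induction k with
    | zero => rw [Nat.cast_zero]
    | succ k ih =>
      rw [← ih, Polynomial.eval_sub, Polynomial.eval_sub, hp, hq, hp, hq, Nat.cast_succ,
        add_right_comm, primitive_add_one, primitive_add_one,
        show (k : ℂ) + (a.deg - a.ord) + (b.deg - b.ord) = k by linear_combination hC]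
      ring
  have hpq : p - q = Polynomial.C ((p - q).eval 0) :=
    Polynomial.eq_of_infinite_eval_eq _ _ ((Set.infinite_range_of_injective
      (Nat.cast_injective (R := ℂ))).mono fun x hx => by
        obtain ⟨k, rfl⟩ := hx
        exact hper k)
  rw [← hp, ← hq, ← Polynomial.eval_sub, hpq, Polynomial.eval_C, Polynomial.eval_sub, hp, hq,
    primitive_zero, sub_zero, zero_add]
  have := signedSum_unique (fun d => primitive a b (d : ℂ))
    (fun x => fall x b.ord * fall (x - (a.deg - a.ord) : ℤ) a.ord)
    (by rw [Int.cast_zero, primitive_zero]) (fun d => by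
      push_cast
      rw [primitive_add_one, show (d : ℂ) + (b.deg - b.ord) = d - (a.deg - a.ord) by
        linear_combination hC]) (a.deg - a.ord)
  rw [← this]
  push_cast
  rfl

theorem sum_Ico_telescope (G : ℤ → ℂ) (θ E : ℤ) (h : θ ≤ E) :
    ∑ x ∈ Ico θ E, (G (x + 1) - G x) = G E - G θ := by
  induction E, h using Int.leInduction with
  | base => simp
  | succ k hk ih =>
    have e : Ico θ (k + 1) = insert k (Ico θ k) := by
      ext x
      simp only [mem_Ico, mem_insert]
      omega
    rw [e, sum_insert (by simp), ih]
    ring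

theorem sum_Ico_threshold (G : ℤ → ℂ) (θ E : ℤ) (h : -E ≤ θ) (h' : θ ≤ E) :
    ∑ x ∈ Ico (-E) E, (G (x + 1) - G x) * (if θ ≤ x then 1 else 0) = G E - G θ := by
  simp only [mul_ite, mul_one, mul_zero]
  rw [← sum_filter, ← sum_Ico_telescope G θ E h']
  refine sum_congr ?_ fun _ _ => rfl
  ext x
  simp only [mem_filter, mem_Ico]
  omega

end Primitive

/-! ### Differential operators as band matrices -/

/-- A labelling of the positions `P ∈ ℤ` by vectors `t^(μ + x) e_j`, where `j = comp P` and
`x = expo P`; it is required that every vector `t^(μ + x) e_j` not annihilated by `∂_t^{ℓ_j}` occurs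
exactly once, that the positions `P ≥ 0` of component `j` are those with `x ≥ thr j`, and that
positions with nearby exponents are near each other, so that differential operators become band
matrices. The vectors left out span a subspace which all `t^m ∂_t^r E_{i,j}`, `r ≥ ℓ_j`, annihilate,
and the labelling is a basis of the quotient. -/
structure Labelling {n : ℕ} (ℓ : Fin n → ℕ) where
  μ : ℂ
  comp : ℤ → Fin n
  expo : ℤ → ℤ
  thr : Fin n → ℤ
  inj : ∀ P Q, comp P = comp Q → expo P = expo Q → P = Q
  fall_ne_zero : ∀ P, fall (μ + expo P) (ℓ (comp P)) ≠ 0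
  surj : ∀ j (x : ℤ), fall (μ + x) (ℓ j) ≠ 0 → ∃ P, comp P = j ∧ expo P = x
  nonneg_iff : ∀ P, 0 ≤ P ↔ thr (comp P) ≤ expo P
  band : ∀ D : ℕ, ∃ B : ℕ, ∀ P Q, |expo P - expo Q| ≤ D → |P - Q| ≤ B

namespace Labelling

variable {n : ℕ} {ℓ : Fin n → ℕ} (Λ : Labelling ℓ)

/-- The matrix of the operator `t^m ∂_t^r E_{i,j}` with respect to the labelling. -/
def matrix (a : DiffIdx n) : bandSubmodule :=
  ⟨fun P Q => if a.row = Λ.comp P ∧ a.col = Λ.comp Q ∧ Λ.expo P = Λ.expo Q + (a.deg - a.ord) then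
    fall (Λ.μ + Λ.expo Q) a.ord else 0, by
    obtain ⟨B, hB⟩ := Λ.band (a.deg - a.ord).natAbs
    refine ⟨B, fun P Q h => hB P Q ?_⟩
    dsimp only at h
    have h' := (ite_ne_right_iff.1 h).1.2.2
    rw [h', add_sub_cancel_left, Int.abs_eq_natAbs]⟩

theorem matrix_apply (a : DiffIdx n) (P Q : ℤ) : (Λ.matrix a).1 P Q =
    if a.row = Λ.comp P ∧ a.col = Λ.comp Q ∧ Λ.expo P = Λ.expo Q + (a.deg - a.ord) then
      fall (Λ.μ + Λ.expo Q) a.ord else 0 := rfl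

theorem linearCombination_matrix (u : DiffIdx n →₀ ℂ) (P Q : ℤ) :
    (Finsupp.linearCombination ℂ Λ.matrix u).1 P Q =
      Finsupp.linearCombination ℂ (fun a => (Λ.matrix a).1 P Q) u := by
  induction u using Finsupp.induction_linear with
  | zero => simp
  | add u v hu hv => rw [map_add, map_add, ← hu, ← hv]; rfl
  | single a r => rw [Finsupp.linearCombination_single, Finsupp.linearCombination_single]; rfl

theorem linearCombination_matrix_mul (a b : DiffIdx n) (P R : ℤ) :
    (Finsupp.linearCombination ℂ Λ.matrix (diffMul a b)).1 P R =
      if a.col = b.row ∧ a.row = Λ.comp P ∧ b.col = Λ.comp R ∧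
        Λ.expo P = Λ.expo R + (b.deg - b.ord) + (a.deg - a.ord) then
        fall (Λ.μ + Λ.expo R) b.ord * fall (Λ.μ + Λ.expo R + (b.deg - b.ord)) a.ord else 0 := by
  rw [linearCombination_matrix]
  unfold diffMul
  split_ifs with h1 h2 h2
  · rw [map_sum, ← fall_leibniz]
    refine sum_congr rfl fun s hs => ?_
    have : s ≤ a.ord := by simpa [Nat.lt_succ_iff] using hs
    rw [Finsupp.linearCombination_single, matrix_apply, if_pos, smul_eq_mul]
    refine ⟨h2.2.1, h2.2.2.1, ?_⟩
    dsimp only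
    omega
  · rw [map_sum]
    refine sum_eq_zero fun s hs => ?_
    have : s ≤ a.ord := by simpa [Nat.lt_succ_iff] using hs
    rw [Finsupp.linearCombination_single, matrix_apply, if_neg, smul_zero]
    rintro ⟨h3, h4, h5⟩
    refine h2 ⟨h1, h3, h4, ?_⟩
    dsimp only at h5
    omega
  · exact absurd h2.1 h1
  · simp

/-- The labelling turns products of operators into products of matrices. If the intermediate vector
is not labelled, it is annihilated by the first operator, whose order is at least `ℓ_j`. -/
theorem finsum_matrix_mul (a b : DiffIdx n) (ha : ℓ a.col ≤ a.ord) (P R : ℤ) :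
    ∑ᶠ Q, (Λ.matrix a).1 P Q * (Λ.matrix b).1 Q R =
      (Finsupp.linearCombination ℂ Λ.matrix (diffMul a b)).1 P R := by
  rw [linearCombination_matrix_mul]
  by_cases hQ : a.col = b.row ∧ ∃ Q, Λ.comp Q = a.col ∧ Λ.expo Q = Λ.expo R + (b.deg - b.ord)
  · obtain ⟨h1, Q, h2, h3⟩ := hQ
    rw [finsum_eq_single _ Q]
    · have h4 : Λ.μ + (Λ.expo Q : ℤ) = Λ.μ + Λ.expo R + (b.deg - b.ord) := by
        rw [h3]; push_cast; ring
      rw [matrix_apply, matrix_apply, h4, h3, h2, ← h1]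
      by_cases hA : a.row = Λ.comp P <;> by_cases hB : b.col = Λ.comp R <;>
        by_cases hC : Λ.expo P = Λ.expo R + (b.deg - b.ord) + (a.deg - a.ord) <;>
        simp [hA, hB, hC, mul_comm]
    · intro Q' hQ'
      rw [matrix_apply, matrix_apply]
      by_cases h5 : b.row = Λ.comp Q' ∧ b.col = Λ.comp R ∧
        Λ.expo Q' = Λ.expo R + (b.deg - b.ord)
      · exact absurd (Λ.inj _ _ (by rw [h2, h1, h5.1]) (by rw [h3, h5.2.2])) hQ'
      · rw [if_neg h5, mul_zero]
  · rw [finsum_eq_zero_of_forall_eq_zero]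
    · split_ifs with h
      · have h0 : fall (Λ.μ + (Λ.expo R + (b.deg - b.ord) : ℤ)) (ℓ a.col) = 0 := by
          by_contra hne
          exact hQ ⟨h.1, Λ.surj _ _ hne⟩
        have h1 := fall_eq_zero_of_le h0 ha
        push_cast at h1
        rw [add_assoc, h1, mul_zero]
      · rfl
    · intro Q
      rw [matrix_apply, matrix_apply]
      split_ifs with h1 h2 h2
      · exact absurd ⟨h1.2.1.trans h2.1.symm, Q, h1.2.1.symm, h2.2.2⟩ hQ
      · rw [mul_zero]
      · rw [zero_mul]
      · rw [mul_zero]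

/-- The scalar by which the action of `t^m ∂_t^r E_{i,j}` is corrected, in units of `κ₀`. -/
def correction (a : DiffIdx n) : ℂ :=
  if a.row = a.col ∧ a.deg = a.ord then anomaly (Λ.μ + Λ.thr a.row) a.ord else 0

theorem linearCombination_correction (a b : DiffIdx n) :
    Finsupp.linearCombination ℂ Λ.correction (diffMul a b) =
      if a.col = b.row ∧ a.row = b.col ∧ a.deg - a.ord + (b.deg - b.ord) = 0 then
        -primitive a b (Λ.μ + Λ.thr a.row) else 0 := by
  unfold diffMul
  by_cases h1 : a.col = b.row
  · rw [if_pos h1, map_sum]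
    by_cases h2 : a.row = b.col ∧ a.deg - a.ord + (b.deg - b.ord) = 0
    · rw [if_pos ⟨h1, h2⟩, primitive, ← sum_neg_distrib]
      refine sum_congr rfl fun s hs => ?_
      have : s ≤ a.ord := by simpa [Nat.lt_succ_iff] using hs
      rw [Finsupp.linearCombination_single, correction, if_pos, anomaly, smul_eq_mul]
      · ring
      · refine ⟨h2.1, ?_⟩
        dsimp only
        omega
    · rw [if_neg (fun h => h2 h.2)]
      refine sum_eq_zero fun s hs => ?_
      have : s ≤ a.ord := by simpa [Nat.lt_succ_iff] using hs
      rw [Finsupp.linearCombination_single, correction, if_neg, smul_zero]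
      rintro ⟨h3, h4⟩
      dsimp only at h3 h4
      exact h2 ⟨h3, by omega⟩
  · rw [if_neg h1, map_zero, if_neg (fun h => h1 h.1)]

theorem stepH_eq (P : ℤ) : stepH P = if Λ.thr (Λ.comp P) ≤ Λ.expo P then 1 else 0 := by
  unfold stepH
  by_cases h : 0 ≤ P
  · rw [if_pos h, if_pos ((Λ.nonneg_iff P).1 h)]
  · rw [if_neg h, if_neg (fun h' => h ((Λ.nonneg_iff P).2 h'))]

/-- The cocycle of infinite matrices, evaluated on the matrices of two differential operators: the
terms are differences of a primitive, so that the sum telescopes between the two thresholds. -/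
theorem sum_matrix_cocycle (a b : DiffIdx n) (ha : ℓ a.col ≤ a.ord) (hb : ℓ b.col ≤ b.ord) :
    ∃ A₀ : ℕ, ∀ A ≥ A₀, ∑ x ∈ centralBox A, (Λ.matrix a).1 x.1 x.2 * (Λ.matrix b).1 x.2 x.1 *
      (stepH x.1 - stepH x.2) =
      if a.col = b.row ∧ a.row = b.col ∧ a.deg - a.ord + (b.deg - b.ord) = 0 then
        primitive a b (Λ.μ + Λ.thr a.col + (a.deg - a.ord)) -
          primitive a b (Λ.μ + Λ.thr a.row) else 0 := by
  by_cases hm : a.col = b.row ∧ a.row = b.col ∧ a.deg - a.ord + (b.deg - b.ord) = 0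
  swap
  · refine ⟨0, fun A _ => ?_⟩
    rw [if_neg hm]
    refine sum_eq_zero fun x _ => ?_
    rw [matrix_apply, matrix_apply]
    split_ifs with h1 h2
    · exact absurd ⟨h1.2.1.trans h2.1.symm, h1.1.trans h2.2.1.symm, by omega⟩ hm
    · rw [mul_zero, zero_mul]
    · rw [zero_mul, zero_mul]
    · rw [zero_mul, zero_mul]
  obtain ⟨B, hB⟩ := (Λ.matrix a).2
  refine ⟨B + 1, fun A hA => ?_⟩
  rw [if_pos hm]
  obtain ⟨hab, hba, hd⟩ := hm
  have hdC : (a.deg : ℂ) - a.ord + (b.deg - b.ord) = 0 := by exact_mod_cast hd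
  set d : ℤ := b.deg - b.ord with hd'
  -- the terms of the sum, in terms of the exponent of the first position
  let G : ℤ → ℂ := fun x => primitive a b (Λ.μ + x)
  have hG : ∀ x : ℤ, G (x + 1) - G x = fall (Λ.μ + x) b.ord * fall (Λ.μ + (x + d : ℤ)) a.ord := by
    intro x
    simp only [G, hd']
    push_cast
    rw [← add_assoc, primitive_add_one, add_sub_cancel_left, ← add_assoc]
  -- beyond `E`, both step functions have become constant
  let E : ℤ := |Λ.thr a.row| + |Λ.thr a.col| + |d| + 1
  let F : ℤ → ℂ := fun x => (G (x + 1) - G x) * (if Λ.thr a.row ≤ x then 1 else 0) -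
    (G (x + 1) - G x) * (if Λ.thr a.col - d ≤ x then 1 else 0)
  have hE1 := abs_le.1 (le_refl |Λ.thr a.row|)
  have hE2 := abs_le.1 (le_refl |Λ.thr a.col|)
  have hE3 := abs_le.1 (le_refl |d|)
  have hterm : ∀ x : ℤ × ℤ, Λ.comp x.1 = a.row → Λ.comp x.2 = a.col →
      Λ.expo x.2 = Λ.expo x.1 + d → (Λ.matrix a).1 x.1 x.2 * (Λ.matrix b).1 x.2 x.1 *
        (stepH x.1 - stepH x.2) = F (Λ.expo x.1) := by
    intro x h1 h2 h3
    rw [matrix_apply, matrix_apply, if_pos ⟨h1.symm, h2.symm, by omega⟩,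
      if_pos ⟨by rw [h2, hab], by rw [h1, hba], by omega⟩, Λ.stepH_eq, Λ.stepH_eq, h1, h2, h3]
    simp only [F, hG, sub_le_iff_le_add]
    ring
  have hsupp : ∀ x : ℤ × ℤ, (Λ.matrix a).1 x.1 x.2 * (Λ.matrix b).1 x.2 x.1 *
      (stepH x.1 - stepH x.2) ≠ 0 → Λ.comp x.1 = a.row ∧ Λ.comp x.2 = a.col ∧
        Λ.expo x.2 = Λ.expo x.1 + d ∧ x ∈ centralBox A := by
    intro x hx
    have hx1 := left_ne_zero_of_mul (left_ne_zero_of_mul hx)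
    have hx2 := right_ne_zero_of_mul hx
    have h1 := abs_le.1 (hB _ _ hx1)
    rw [matrix_apply] at hx1
    have h2 := (ite_ne_right_iff.1 hx1).1
    refine ⟨h2.1.symm, h2.2.1.symm, by omega, ?_⟩
    rw [mem_centralBox]
    unfold stepH at hx2
    split_ifs at hx2 with h3 h4 h4
    · exact absurd (sub_self _) hx2
    · omega
    · omega
    · exact absurd (sub_self _) hx2
  have key : ∑ x ∈ centralBox A, (Λ.matrix a).1 x.1 x.2 * (Λ.matrix b).1 x.2 x.1 *
      (stepH x.1 - stepH x.2) = ∑ x ∈ Ico (-E) E, F x := by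
    refine sum_bij_ne_zero (fun x _ _ => Λ.expo x.1) ?_ ?_ ?_ ?_
    · intro x _ hx
      obtain ⟨h1, h2, h3, -⟩ := hsupp x hx
      rw [hterm x h1 h2 h3] at hx
      rw [mem_Ico]
      by_contra hcon
      refine hx ?_
      simp only [F]
      by_cases h4 : Λ.thr a.row ≤ Λ.expo x.1
      · rw [if_pos h4, if_pos (by omega), sub_self]
      · rw [if_neg h4, if_neg (by omega), sub_self]
    · intro x _ hx y _ hy hxy
      obtain ⟨h1, h2, h3, -⟩ := hsupp x hx
      obtain ⟨h1', h2', h3', -⟩ := hsupp y hy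
      exact Prod.ext (Λ.inj _ _ (h1.trans h1'.symm) hxy)
        (Λ.inj _ _ (h2.trans h2'.symm) (by rw [h3, h3', hxy]))
    · intro x _ hx
      have hg : fall (Λ.μ + x) b.ord * fall (Λ.μ + (x + d : ℤ)) a.ord ≠ 0 := by
        rw [← hG]
        intro h0
        refine hx ?_
        simp only [F, h0, zero_mul, sub_self]
      obtain ⟨P, hP, hP'⟩ := Λ.surj a.row x fun h0 => left_ne_zero_of_mul hg
        (fall_eq_zero_of_le h0 (hba ▸ hb))
      obtain ⟨Q, hQ, hQ'⟩ := Λ.surj a.col (x + d) fun h0 => right_ne_zero_of_mul hg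
        (fall_eq_zero_of_le h0 ha)
      have h1 := hterm (P, Q) hP hQ (by rw [hQ', hP'])
      simp only at h1
      rw [hP'] at h1
      have h2 := hsupp (P, Q) (by simp only; rw [h1]; exact hx)
      exact ⟨(P, Q), h2.2.2.2, by simp only; rw [h1]; exact hx, hP'⟩
    · intro x _ hx
      obtain ⟨h1, h2, h3, -⟩ := hsupp x hx
      exact hterm x h1 h2 h3
  rw [key]
  simp only [F]
  rw [sum_sub_distrib, sum_Ico_threshold _ _ _ (by omega) (by omega),
    sum_Ico_threshold _ _ _ (by omega) (by omega)]
  simp only [G]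
  rw [show Λ.μ + ((Λ.thr a.col - d : ℤ) : ℂ) = Λ.μ + Λ.thr a.col + (a.deg - a.ord) by
    rw [hd']; push_cast; linear_combination -hdC]
  ring

/-! ### The representation on a finitely placed module -/

variable {M : Type*} [AddCommGroup M] [Module ℂ M] [LieRingModule GlInf M] [LieModule ℂ GlInf M]

/-- The action of `t^m ∂_t^r E_{i,j}` on a finitely placed module of level `χ`. -/
def op (χ : ℂ) (hfin : IsFinitelyPlaced M) (a : DiffIdx n) : Module.End ℂ M :=
  bandOp hfin (Λ.matrix a) + (χ * Λ.correction a) • 1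

theorem linearCombination_op (χ : ℂ) (hfin : IsFinitelyPlaced M) (u : DiffIdx n →₀ ℂ) :
    Finsupp.linearCombination ℂ (Λ.op χ hfin) u =
      bandOp hfin (Finsupp.linearCombination ℂ Λ.matrix u) +
        (χ * Finsupp.linearCombination ℂ Λ.correction u) • 1 := by
  induction u using Finsupp.induction_linear with
  | zero => simp
  | add u v hu hv =>
    simp only [map_add, hu, hv, mul_add, add_smul]
    abel
  | single a r =>
    simp only [Finsupp.linearCombination_single, op, smul_add, map_smul, smul_smul, smul_eq_mul]
    congr 2
    ring

/-- The correction by scalars turns the cocycle of infinite matrices into the cocycle of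
differential operators. -/
theorem isRep_op {χ : ℂ} (hκ : ∀ w : M, ⁅kappa0, w⁆ = χ • w) (hfin : IsFinitelyPlaced M) :
    IsRep ℓ χ (Λ.op χ hfin) := by
  intro a b ha hb
  have h := fun w => bandOp_comm hκ hfin (Λ.matrix a) (Λ.matrix b) _ _
    (Λ.finsum_matrix_mul a b ha) (Λ.finsum_matrix_mul b a hb) _ (Λ.sum_matrix_cocycle a b ha hb) w
  rw [linearCombination_op, map_sub, map_sub, map_sub, linearCombination_correction,
    linearCombination_correction, diffCoc_eq]
  refine LinearMap.ext fun w => ?_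
  have h1 := h w
  simp only [op, LinearMap.sub_apply, Module.End.mul_apply, LinearMap.add_apply,
    LinearMap.smul_apply, Module.End.one_apply, map_add, map_smul]
  have e : ∀ c d : ℂ, bandOp hfin (Λ.matrix a) (bandOp hfin (Λ.matrix b) w) +
      c • bandOp hfin (Λ.matrix b) w + d • (bandOp hfin (Λ.matrix a) w + c • w) -
      (bandOp hfin (Λ.matrix b) (bandOp hfin (Λ.matrix a) w) +
      d • bandOp hfin (Λ.matrix a) w + c • (bandOp hfin (Λ.matrix b) w + d • w)) =
      bandOp hfin (Λ.matrix a) (bandOp hfin (Λ.matrix b) w) -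
        bandOp hfin (Λ.matrix b) (bandOp hfin (Λ.matrix a) w) := by
    intro c d
    module
  rw [e, h1, map_sub, LinearMap.sub_apply, add_assoc (_ - _), ← add_smul, ← mul_add]
  congr 3
  by_cases hm : a.col = b.row ∧ a.row = b.col ∧ a.deg - a.ord + (b.deg - b.ord) = 0
  · have h2 := primitive_sub_primitive a b hm.2.2 (Λ.μ + Λ.thr a.col)
    rw [if_pos hm, if_pos hm, if_pos ⟨hm.2.1.symm, hm.1.symm, by omega⟩,
      if_pos ⟨hm.2.1, hm.1, by omega⟩, ← h2, ← hm.1]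
    ring
  · rw [if_neg hm, if_neg hm, if_neg, if_neg]
    · ring
    · rintro ⟨h2, h3, h4⟩
      exact hm ⟨h3, h2, by omega⟩
    · rintro ⟨h2, h3, h4⟩
      exact hm ⟨h3.symm, h2.symm, by omega⟩

end Labelling

/-! ### The labellings attached to a complex number -/

section Labellings

variable {n : ℕ}

theorem exists_of_fall_eq_zero {x : ℂ} {m : ℕ} (h : fall x m = 0) : ∃ k < m, x = (k : ℕ) := by
  induction m with
  | zero => simp [fall_zero] at h
  | succ m ih =>
    rw [fall_succ, mul_eq_zero] at h
    rcases h with h | h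
    · obtain ⟨k, hk, hx⟩ := ih h
      exact ⟨k, by omega, hx⟩
    · exact ⟨m, by omega, sub_eq_zero.1 h⟩

theorem fall_intCast_ne_zero_iff (x : ℤ) (m : ℕ) : fall (x : ℂ) m ≠ 0 ↔ x < 0 ∨ (m : ℤ) ≤ x := by
  constructor
  · intro h
    by_contra hc
    obtain ⟨k, rfl⟩ : ∃ k : ℕ, x = k := ⟨x.toNat, by omega⟩
    refine h ?_
    rw [Int.cast_natCast, fall_nat, Nat.choose_eq_zero_of_lt (by omega), Nat.cast_zero, mul_zero]
  · intro h h0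
    obtain ⟨k, hk, hx⟩ := exists_of_fall_eq_zero h0
    have : x = k := by exact_mod_cast hx
    omega

/-- The component of a position: its residue modulo `n`. -/
def posComp (hn : 0 < n) (P : ℤ) : Fin n :=
  ⟨(P % n).toNat, by have := Int.emod_lt_of_pos P (b := n) (by omega); omega⟩

theorem pos_eq (hn : 0 < n) (P : ℤ) : P = P / n * n + (posComp hn P : ℕ) := by
  have h1 := Int.emod_nonneg P (b := n) (by omega)
  have h2 := Int.mul_ediv_add_emod P n
  rw [posComp]
  dsimp only
  rw [Int.toNat_of_nonneg h1, mul_comm]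
  exact h2.symm

theorem pos_div (hn : 0 < n) (i : Fin n) (y : ℤ) : (y * n + (i : ℕ)) / n = y := by
  rw [add_comm, Int.add_mul_ediv_right _ _ (by omega),
    Int.ediv_eq_zero_of_lt (by omega) (by omega), zero_add]

theorem posComp_pos (hn : 0 < n) (i : Fin n) (y : ℤ) : posComp hn (y * n + (i : ℕ)) = i := by
  refine Fin.ext ?_
  rw [posComp]
  dsimp only
  rw [add_comm, Int.add_mul_emod_self_right, Int.emod_eq_of_lt (by omega) (by omega)]
  simp

theorem abs_sub_le_of_div (hn : 0 < n) (P Q : ℤ) (D : ℕ) (h : |P / n - Q / n| ≤ D) :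
    |P - Q| ≤ ((D + 1) * n : ℕ) := by
  have h1 := pos_eq hn P
  have h2 := pos_eq hn Q
  have h3 := (posComp hn P).2
  have h4 := (posComp hn Q).2
  rw [abs_le] at h ⊢
  push_cast
  constructor <;> nlinarith

/-- The labelling for a parameter which is not an integer: the position `P = xn + j` belongs to
`t^(ι + x) e_j`. -/
def genericLabelling (hn : 0 < n) (ℓ : Fin n → ℕ) (ι : ℂ) (hι : ¬∃ a : ℤ, (a : ℂ) = ι) :
    Labelling ℓ where
  μ := ι
  comp := posComp hn
  expo P := P / n
  thr _ := 0
  inj P Q h h' := by rw [pos_eq hn P, pos_eq hn Q, h, h']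
  fall_ne_zero P h := by
    obtain ⟨k, -, hk⟩ := exists_of_fall_eq_zero h
    exact hι ⟨k - P / n, by push_cast; linear_combination -hk⟩
  surj j x _ := ⟨x * n + (j : ℕ), posComp_pos hn j x, pos_div hn j x⟩
  nonneg_iff P := by
    rw [Int.le_ediv_iff_mul_le (by omega), zero_mul]
  band D := ⟨(D + 1) * n, fun P Q h => abs_sub_le_of_div hn P Q D h⟩

/-- The labelling for an integer parameter: the exponents `0, …, ℓ_j - 1`, which are annihilated by
`∂_t^{ℓ_j}`, are left out. The first position of component `j` in the nonnegative half has exponent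
`a + ℓ_j` for `a ≥ 0` and `a` for `a < 0`; for `a = 0` the threshold can be taken to be `0` as well,
since no exponent lies between `0` and `ℓ_j`. -/
def integerLabelling (hn : 0 < n) (ℓ : Fin n → ℕ) (a : ℤ) : Labelling ℓ where
  μ := 0
  comp := posComp hn
  expo P := if P / n + a < 0 then P / n + a else P / n + a + ℓ (posComp hn P)
  thr j := if 0 < a then a + ℓ j else a
  inj P Q h h' := by
    have : P / n = Q / n := by
      rw [h] at h'
      split_ifs at h' <;> omega
    rw [pos_eq hn P, pos_eq hn Q, h, this]
  fall_ne_zero P := by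
    rw [zero_add, fall_intCast_ne_zero_iff]
    split_ifs <;> omega
  surj j x h := by
    rw [zero_add, fall_intCast_ne_zero_iff] at h
    rcases h with h | h
    · refine ⟨(x - a) * n + (j : ℕ), posComp_pos hn j _, ?_⟩
      rw [pos_div hn, sub_add_cancel, if_pos h]
    · refine ⟨(x - a - ℓ j) * n + (j : ℕ), posComp_pos hn j _, ?_⟩
      rw [pos_div hn, posComp_pos hn, if_neg (by omega)]
      ring
  nonneg_iff P := by
    have h : 0 ≤ P ↔ 0 ≤ P / n := by
      rw [Int.le_ediv_iff_mul_le (by omega), zero_mul]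
    rw [h]
    split_ifs <;> omega
  band D := by
    refine ⟨(D + ∑ j, ℓ j + 1) * n, fun P Q h => abs_sub_le_of_div hn P Q _ ?_⟩
    have h1 : ∀ i, ℓ i ≤ ∑ j, ℓ j := fun i => single_le_sum (fun _ _ => Nat.zero_le _) (mem_univ i)
    have h2 := h1 (posComp hn P)
    have h3 := h1 (posComp hn Q)
    rw [abs_le] at h ⊢
    generalize ∑ j, ℓ j = L at *
    push_cast
    split_ifs at h <;> omega

theorem integerLabelling_expo (hn : 0 < n) (ℓ : Fin n → ℕ) (a : ℤ) (i : Fin n) (y : ℤ) :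
    (integerLabelling hn ℓ a).expo (y * n + (i : ℕ)) =
      if y + a < 0 then y + a else y + a + ℓ i := by
  change (if (y * n + (i : ℕ)) / n + a < 0 then _ else _ + (ℓ (posComp hn _) : ℤ)) = _
  rw [pos_div hn, posComp_pos hn]

end Labellings

/-! ### Comparison with the explicit series -/

section Comparison

variable {n : ℕ} {M : Type*} [AddCommGroup M]

theorem finsum_comp_of_support {α β : Type*} (g : β → M) (φ : α → β) (hφ : Function.Injective φ)
    (h : ∀ b, g b ≠ 0 → b ∈ Set.range φ) : ∑ᶠ a, g (φ a) = ∑ᶠ b, g b := by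
  rw [← finsum_mem_range hφ, finsum_mem_def, Set.indicator_eq_self.2 h]

theorem finsum_block (hn : 0 < n) (i j : Fin n) (g : ℤ × ℤ → M)
    (hg : ∀ x, g x ≠ 0 → i = posComp hn x.1 ∧ j = posComp hn x.2) :
    ∑ᶠ y : ℤ × ℤ, g (y.1 * n + (i : ℕ), y.2 * n + (j : ℕ)) = ∑ᶠ x, g x := by
  refine finsum_comp_of_support g (fun y : ℤ × ℤ => (y.1 * n + (i : ℕ), y.2 * n + (j : ℕ))) ?_ ?_
  · rintro ⟨y, z⟩ ⟨y', z'⟩ h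
    simp only [Prod.mk.injEq] at h
    rw [← pos_div hn i y, ← pos_div hn j z, h.1, h.2, pos_div hn, pos_div hn]
  · intro x hx
    obtain ⟨h1, h2⟩ := hg x hx
    refine ⟨(x.1 / n, x.2 / n), Prod.ext ?_ ?_⟩
    · dsimp only
      rw [h1]
      exact (pos_eq hn x.1).symm
    · dsimp only
      rw [h2]
      exact (pos_eq hn x.2).symm

/-- The integers, as the union of the two half-lines starting at `-a` and ending at `-a - 1`. -/
def halfLine (a : ℤ) : Bool → ℕ → ℤ
  | false, x => x - a
  | true, x => -(x + a + 1)

theorem finsum_halfLines (a : ℤ) (g : ℤ × ℤ → M) (hg : (Function.support g).Finite) :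
    ∑ᶠ y, g y =
      (∑ᶠ x : ℕ × ℕ, g (halfLine a false x.1, halfLine a true x.2)) +
      (∑ᶠ x : ℕ × ℕ, g (halfLine a false x.1, halfLine a false x.2)) +
      (∑ᶠ x : ℕ × ℕ, g (halfLine a true x.1, halfLine a false x.2)) +
      (∑ᶠ x : ℕ × ℕ, g (halfLine a true x.1, halfLine a true x.2)) := by
  let φ : (Bool × Bool) × (ℕ × ℕ) → ℤ × ℤ := fun z =>
    (halfLine a z.1.1 z.2.1, halfLine a z.1.2 z.2.2)
  have hinj : ∀ (s s' : Bool) (x x' : ℕ), halfLine a s x = halfLine a s' x' → s = s' ∧ x = x' := by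
    intro s s' x x' h
    cases s <;> cases s' <;> simp only [halfLine] at h <;>
      first
      | exact ⟨rfl, by omega⟩
      | (exfalso; omega)
  have hsurj : ∀ y : ℤ, ∃ s x, halfLine a s x = y := by
    intro y
    rcases le_or_gt 0 (y + a) with h | h
    · exact ⟨false, (y + a).toNat, by simp only [halfLine]; omega⟩
    · exact ⟨true, (-(y + a) - 1).toNat, by simp only [halfLine]; omega⟩
  have hφ : Function.Injective φ := by
    rintro ⟨⟨s, t⟩, x, y⟩ ⟨⟨s', t'⟩, x', y'⟩ h
    simp only [φ, Prod.mk.injEq] at h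
    obtain ⟨rfl, rfl⟩ := hinj _ _ _ _ h.1
    obtain ⟨rfl, rfl⟩ := hinj _ _ _ _ h.2
    rfl
  rw [← finsum_comp_of_support g φ hφ fun b _ => by
    obtain ⟨s, x, hx⟩ := hsurj b.1
    obtain ⟨t, y, hy⟩ := hsurj b.2
    exact ⟨((s, t), (x, y)), Prod.ext hx hy⟩]
  rw [finsum_curry _ (hg.preimage hφ.injOn), finsum_eq_sum_of_fintype, Fintype.sum_prod_type,
    Fintype.sum_bool, Fintype.sum_bool, Fintype.sum_bool]
  simp only [φ]
  abel

variable [Module ℂ M] [LieRingModule GlInf M] [LieModule ℂ GlInf M]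

theorem blockE_lie (i j : Fin n) (l k : ℤ) (w : M) :
    ⁅blockE i j l (-k), w⁆ = unitOp M (l * n + (i : ℕ)) (k * n + (j : ℕ)) w := by
  rw [unitOp_apply, blockE, show -k * (n : ℤ) - (j : ℕ) - 1 = -(k * n + (j : ℕ)) - 1 by ring]

/-- The action of a differential operator in terms of the blocks of matrix units with fixed residues
modulo `n`. -/
theorem bandOp_matrix_eq (hn : 0 < n) {ℓ : Fin n → ℕ} (Λ : Labelling ℓ)
    (hΛ : Λ.comp = posComp hn) (hfin : IsFinitelyPlaced M) (a : DiffIdx n) (w : M) :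
    bandOp hfin (Λ.matrix a) w = ∑ᶠ y : ℤ × ℤ,
      (if Λ.expo (y.1 * n + (a.row : ℕ)) = Λ.expo (y.2 * n + (a.col : ℕ)) + (a.deg - a.ord) then
        fall (Λ.μ + Λ.expo (y.2 * n + (a.col : ℕ))) a.ord else 0) •
          ⁅blockE a.row a.col y.1 (-y.2), w⁆ := by
  rw [bandOp_apply, ← finsum_block hn a.row a.col]
  · refine finsum_congr fun y => ?_
    rw [Λ.matrix_apply, hΛ, posComp_pos, posComp_pos, blockE_lie]
    simp only [true_and]
  · intro x hx
    have := left_ne_zero_of_smul hx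
    rw [Λ.matrix_apply, hΛ] at this
    exact ⟨(ite_ne_right_iff.1 this).1.1, (ite_ne_right_iff.1 this).1.2.1⟩

theorem fieldGeneric_eq (hn : 0 < n) (ℓ : Fin n → ℕ) (ι : ℂ) (hι : ¬∃ a : ℤ, (a : ℂ) = ι) {χ : ℂ}
    (hκ : ∀ w : M, ⁅kappa0, w⁆ = χ • w) (hfin : IsFinitelyPlaced M) (i j : Fin n) (r : ℕ) (p : ℤ)
    (w : M) : fieldGeneric ι i j r p w =
      (genericLabelling hn ℓ ι hι).op χ hfin ⟨i, j, -p - 1, r⟩ w := by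
  rw [Labelling.op, LinearMap.add_apply, bandOp_matrix_eq hn _ rfl, fieldGeneric,
    ← finsum_comp_equiv ((Equiv.refl ℤ).prodCongr (Equiv.neg ℤ))]
  congr 1
  · refine finsum_congr fun x => ?_
    simp only [genericLabelling, pos_div hn, Equiv.prodCongr_apply, Prod.map_fst, Prod.map_snd,
      Equiv.refl_apply, Equiv.neg_apply, ite_smul, zero_smul]
    refine if_congr (by omega) ?_ rfl
    push_cast
    rw [sub_neg_eq_add]
  · simp only [Labelling.correction, genericLabelling, Int.cast_zero, add_zero]
    rw [hκ, LinearMap.smul_apply, Module.End.one_apply]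
    by_cases h : i = j ∧ p = -r - 1
    · rw [if_pos h, if_pos ⟨h.1, by omega⟩, smul_smul, mul_comm]
    · rw [if_neg h, if_neg (fun h' => h ⟨h'.1, by omega⟩), mul_zero, zero_smul]

theorem fieldInteger_eq (hn : 0 < n) (ℓ : Fin n → ℕ) (a : ℤ) {χ : ℂ}
    (hκ : ∀ w : M, ⁅kappa0, w⁆ = χ • w) (hfin : IsFinitelyPlaced M) (i j : Fin n) (r : ℕ) (p : ℤ)
    (w : M) : fieldInteger ℓ a i j r p w =
      (integerLabelling hn ℓ a).op χ hfin ⟨i, j, -p - 1, r⟩ w := by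
  set Λ := integerLabelling hn ℓ a with hΛ
  have hμ : Λ.μ = 0 := rfl
  have hexp : ∀ (s : Bool) (x : ℕ) (i : Fin n), Λ.expo (halfLine a s x * n + (i : ℕ)) =
      if s then -(x : ℤ) - 1 else (x : ℤ) + ℓ i := by
    intro s x i
    rw [hΛ, integerLabelling_expo]
    cases s
    · rw [if_neg (by simp only [halfLine]; omega), if_neg (by simp)]
      simp only [halfLine]
      ring
    · rw [if_pos (by simp only [halfLine]; omega), if_pos rfl]
      simp only [halfLine]
      ring
  -- the four sums are the four quadrants of the double sum over all pairs of blocks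
  rw [Labelling.op, LinearMap.add_apply, bandOp_matrix_eq hn Λ rfl, finsum_halfLines a,
    fieldInteger]
  · simp only [hexp, hμ, if_true, Bool.false_eq_true, if_false]
    congr 1
    · congr 1
      · congr 1
        · congr 1
          · refine finsum_congr fun x => ?_
            simp only [halfLine, ite_smul, zero_smul, neg_neg]
            refine if_congr (by omega) ?_ rfl
            push_cast
            rw [zero_add]
          · refine finsum_congr fun x => ?_
            simp only [halfLine, ite_smul, zero_smul, neg_sub]
            refine if_congr (by omega) ?_ rfl
            push_cast
            rw [zero_add]
        · refine finsum_congr fun x => ?_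
          simp only [halfLine, ite_smul, zero_smul, neg_sub]
          refine if_congr (by omega) ?_ rfl
          push_cast
          rw [zero_add]
      · refine finsum_congr fun x => ?_
        simp only [halfLine, ite_smul, zero_smul, neg_neg]
        refine if_congr (by omega) ?_ rfl
        push_cast
        rw [zero_add]
    · simp only [Labelling.correction, hΛ, integerLabelling, zero_add]
      rw [hκ, LinearMap.smul_apply, Module.End.one_apply]
      by_cases h : i = j ∧ p = -r - 1
      · rw [if_pos h, if_pos (show i = j ∧ -p - 1 = (r : ℤ) from ⟨h.1, by omega⟩), smul_smul,
          mul_comm]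
        split_ifs <;> push_cast <;> rfl
      · rw [if_neg h, if_neg (show ¬(i = j ∧ -p - 1 = (r : ℤ)) from fun h' => h ⟨h'.1, by omega⟩),
          mul_zero, zero_smul]
  · have h1 := bandTerm_finite hfin (Λ.matrix ⟨i, j, -p - 1, r⟩) w
    have h2 : Function.Injective fun y : ℤ × ℤ =>
        (y.1 * (n : ℤ) + (i : ℕ), y.2 * (n : ℤ) + (j : ℕ)) := by
      rintro ⟨y, z⟩ ⟨y', z'⟩ h
      simp only [Prod.mk.injEq] at h
      rw [← pos_div hn i y, ← pos_div hn j z, h.1, h.2, pos_div hn, pos_div hn]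
    refine (h1.preimage h2.injOn).subset fun y hy => ?_
    rw [Function.mem_support, blockE_lie] at hy
    rw [Set.mem_preimage, Set.mem_ofPred_eq, bandTerm, LinearMap.smul_apply, Λ.matrix_apply]
    have e1 : Λ.comp (y.1 * (n : ℤ) + (i : ℕ)) = i := posComp_pos hn i y.1
    have e2 : Λ.comp (y.2 * (n : ℤ) + (j : ℕ)) = j := posComp_pos hn j y.2
    simp only [e1, e2, true_and]
    exact hy

/-- The series of the module are the generating series of the action of differential operators
given by a labelling. -/
theorem exists_labelling (hn : 0 < n) (ℓ : Fin n → ℕ) (ι : ℂ) {χ : ℂ}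
    (hκ : ∀ w : M, ⁅kappa0, w⁆ = χ • w) (hfin : IsFinitelyPlaced M) :
    ∃ Λ : Labelling ℓ, ∀ (i j : Fin n) (s : ℕ) (p : ℤ) (w : M),
      moduleField M ℓ ι i j s p w = Λ.op χ hfin ⟨i, j, -p - 1, ℓ j + s⟩ w := by
  by_cases h : ∃ a : ℤ, (a : ℂ) = ι
  · refine ⟨integerLabelling hn ℓ h.choose, fun i j s p w => ?_⟩
    rw [moduleField, dif_pos h, fieldInteger_eq hn ℓ _ hκ hfin]
  · refine ⟨genericLabelling hn ℓ ι h, fun i j s p w => ?_⟩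
    rw [moduleField, dif_neg h, fieldGeneric_eq hn ℓ ι h hκ hfin]

end Comparison

/-! ### Irreducibility -/

section Interpolation

variable {M : Type*} [AddCommGroup M] [Module ℂ M]

/-- The vectors `v x` can be recovered from their sums with coefficients `⟨t x⟩_s`, `s ≥ 0`, because
the falling factorials span the polynomials. -/
theorem mem_of_sum_fall_smul_mem {α : Type*} (N : Submodule ℂ M) (T : Finset α) (t : α → ℂ)
    (v : α → M) (ht : Set.InjOn t T) (h : ∀ s, ∑ x ∈ T, fall (t x) s • v x ∈ N) {x : α}
    (hx : x ∈ T) : v x ∈ N := by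
  classical
  have h1 : ∀ k s, ∑ x ∈ T, (t x ^ k * fall (t x) s) • v x ∈ N := by
    intro k
    induction k with
    | zero => intro s; simpa using h s
    | succ k ih =>
      intro s
      have e : ∑ x ∈ T, (t x ^ (k + 1) * fall (t x) s) • v x =
          ∑ x ∈ T, (t x ^ k * fall (t x) (s + 1)) • v x +
            (s : ℂ) • ∑ x ∈ T, (t x ^ k * fall (t x) s) • v x := by
        rw [smul_sum, ← sum_add_distrib]
        refine sum_congr rfl fun x _ => ?_
        rw [smul_smul, ← add_smul, fall_succ]
        congr 1
        ring
      rw [e]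
      exact N.add_mem (ih _) (N.smul_mem _ (ih _))
  have h2 : ∀ p : Polynomial ℂ, ∑ x ∈ T, p.eval (t x) • v x ∈ N := by
    intro p
    induction p using Polynomial.induction_on' with
    | add p q hp hq =>
      simp only [Polynomial.eval_add, add_smul, sum_add_distrib]
      exact N.add_mem hp hq
    | monomial k c =>
      have := N.smul_mem c (h1 k 0)
      simpa only [Polynomial.eval_monomial, smul_sum, smul_smul, fall_zero, mul_one] using this
  have h3 := h2 (Lagrange.basis T t x)
  rwa [sum_eq_single_of_mem x hx, Lagrange.eval_basis_self ht hx, one_smul] at h3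
  intro y hy hne
  rw [Lagrange.eval_basis_of_ne hne.symm hy, zero_smul]

end Interpolation

section Irreducibility

variable {n : ℕ} {ℓ : Fin n → ℕ} {χ : ℂ}
variable {M : Type*} [AddCommGroup M] [Module ℂ M] [LieRingModule GlInf M] [LieModule ℂ GlInf M]

/-- A matrix unit acts on a given vector as a combination of the operators
`t^(m+s) ∂_t^(ℓ_j+s) E_{i,j}`, `s ≥ 0`: only finitely many matrix units contribute, and on them these operators have the
coefficients `⟨y⟩_{ℓ_j} ⟨y - ℓ_j⟩_s`, with `⟨y⟩_{ℓ_j} ≠ 0` and pairwise different `y`. -/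
theorem Labelling.unitOp_mem (Λ : Labelling ℓ) (hfin : IsFinitelyPlaced M) (N : Submodule ℂ M)
    {w : M} (h : ∀ i j m s, bandOp hfin (Λ.matrix ⟨i, j, m, ℓ j + s⟩) w ∈ N)
    (P Q : ℤ) : unitOp M P Q w ∈ N := by
  set i := Λ.comp P with hi
  set j := Λ.comp Q with hj
  let a : ℕ → DiffIdx n := fun s => ⟨i, j, Λ.expo P - Λ.expo Q + (ℓ j + s : ℕ), ℓ j + s⟩
  let t : ℤ × ℤ → ℂ := fun x => Λ.μ + Λ.expo x.2 - ℓ j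
  have hmat : ∀ s (x : ℤ × ℤ), (Λ.matrix (a s)).1 x.1 x.2 =
      fall (t x) s * (Λ.matrix (a 0)).1 x.1 x.2 := by
    intro s x
    rw [Λ.matrix_apply, Λ.matrix_apply]
    simp only [a, add_sub_cancel_right, add_zero, mul_ite, mul_zero, fall_add, t]
    split_ifs
    · ring
    · rfl
  set T := (bandTerm_finite hfin (Λ.matrix (a 0)) w).toFinset with hT
  have hmem : ∀ x, x ∈ T ↔ bandTerm M (Λ.matrix (a 0)).1 x w ≠ 0 := fun x => by
    rw [hT, Set.Finite.mem_toFinset, Set.mem_ofPred_eq]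
  have hsum : ∀ s, ∑ x ∈ T, fall (t x) s • bandTerm M (Λ.matrix (a 0)).1 x w =
      bandOp hfin (Λ.matrix (a s)) w := by
    intro s
    rw [bandOp_apply]
    have e : ∀ x : ℤ × ℤ, (Λ.matrix (a s)).1 x.1 x.2 • unitOp M x.1 x.2 w =
        fall (t x) s • bandTerm M (Λ.matrix (a 0)).1 x w := by
      intro x
      rw [hmat, mul_smul, bandTerm, LinearMap.smul_apply]
    rw [finsum_congr e]
    refine (finsum_eq_sum_of_support_subset _ fun x hx => ?_).symm
    rw [mem_coe, hmem]
    exact right_ne_zero_of_smul hx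
  have hne : (Λ.matrix (a 0)).1 P Q ≠ 0 := by
    rw [Λ.matrix_apply, if_pos ⟨hi, hj, by simp only [a]; ring⟩]
    exact Λ.fall_ne_zero Q
  have ht : Set.InjOn t T := by
    have hT' : ∀ x ∈ T, i = Λ.comp x.1 ∧ j = Λ.comp x.2 ∧
        Λ.expo x.1 = Λ.expo x.2 + (Λ.expo P - Λ.expo Q) := by
      intro x hx
      rw [hmem, bandTerm, LinearMap.smul_apply] at hx
      have h1 := left_ne_zero_of_smul hx
      rw [Λ.matrix_apply] at h1
      have h2 := (ite_ne_right_iff.1 h1).1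
      simpa only [a, add_sub_cancel_right] using h2
    intro x hx y hy hxy
    obtain ⟨h1, h2, h3⟩ := hT' x hx
    obtain ⟨h1', h2', h3'⟩ := hT' y hy
    have h4 : Λ.expo x.2 = Λ.expo y.2 := by
      have : (Λ.expo x.2 : ℂ) = Λ.expo y.2 := by
        simp only [t] at hxy
        linear_combination hxy
      exact_mod_cast this
    exact Prod.ext (Λ.inj _ _ (h1.symm.trans h1') (by rw [h3, h3', h4]))
      (Λ.inj _ _ (h2.symm.trans h2') h4)
  have key : bandTerm M (Λ.matrix (a 0)).1 (P, Q) w ∈ N := by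
    by_cases hPQ : (P, Q) ∈ T
    · exact mem_of_sum_fall_smul_mem N T t _ ht (fun s => by rw [hsum]; exact h _ _ _ s) hPQ
    · rw [hmem, not_not] at hPQ
      rw [hPQ]
      exact N.zero_mem
  rw [bandTerm, LinearMap.smul_apply] at key
  exact (Submodule.smul_mem_iff N hne).1 key

/-- A subspace of an irreducible module which is stable under the operators `t^m ∂_t^r E_{i,j}`,
`r ≥ ℓ_j`, is trivial. -/
theorem Labelling.eq_bot_or_eq_top (Λ : Labelling ℓ) (hirr : LieModule.IsIrreducible ℂ GlInf M)
    (hκ : ∀ w : M, ⁅kappa0, w⁆ = χ • w) (hfin : IsFinitelyPlaced M) (N : Submodule ℂ M)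
    (h : ∀ i j m s, ∀ w ∈ N, Λ.op χ hfin ⟨i, j, m, ℓ j + s⟩ w ∈ N) : N = ⊥ ∨ N = ⊤ := by
  have hunit : ∀ P Q, ∀ w ∈ N, unitOp M P Q w ∈ N := by
    intro P Q w hw
    refine Λ.unitOp_mem hfin N (fun i j m s => ?_) P Q
    have h1 := h i j m s w hw
    rw [Labelling.op, LinearMap.add_apply, LinearMap.smul_apply, Module.End.one_apply] at h1
    exact (N.add_mem_iff_left (N.smul_mem _ hw)).1 h1
  let S : Submodule ℂ GlInf :=
    { carrier := {x | ∀ w ∈ N, ⁅x, w⁆ ∈ N}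
      zero_mem' := fun w _ => by rw [zero_lie]; exact N.zero_mem
      add_mem' := fun hx hy w hw => by rw [add_lie]; exact N.add_mem (hx w hw) (hy w hw)
      smul_mem' := fun r x hx w hw => by rw [smul_lie]; exact N.smul_mem r (hx w hw) }
  have hS : ∀ x, x ∈ S := by
    refine glInf_span S (fun p q w hw => ?_) fun w hw => ?_
    · have h1 := hunit p (-q - 1) w hw
      rwa [unitOp_apply, show -(-q - 1) - 1 = q by ring] at h1
    · rw [hκ]
      exact N.smul_mem χ hw
  let N' : LieSubmodule ℂ GlInf M := { N with lie_mem := fun {x w} hw => hS x w hw }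
  have e : N'.toSubmodule = N := rfl
  rcases hirr.eq_bot_or_eq_top N' with h1 | h1
  · left
    rw [← e, h1, LieSubmodule.bot_toSubmodule]
  · right
    rw [← e, h1, LieSubmodule.top_toSubmodule]

end Irreducibility

section RestrictedRep

attribute [local instance] LieRing.ofAssociativeRing

/-- The series of the module come from a restricted irreducible representation. The operators of
order `r < ℓ_j`, whose series need not be Laurent series, are replaced by zero. -/
theorem exists_restricted_rep {n : ℕ} (hn : 0 < n) (ℓ : Fin n → ℕ) (χ ι : ℂ)
    (M : Type*) [AddCommGroup M] [Module ℂ M] [LieRingModule GlInf M] [LieModule ℂ GlInf M]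
    (hirr : LieModule.IsIrreducible ℂ GlInf M) (hfin : IsFinitelyPlaced M)
    (hκ : ∀ w : M, ⁅kappa0, w⁆ = χ • w)
    (hlaurent : ∀ (i j : Fin n) (s : ℕ) (w : M),
      ∃ N : ℤ, ∀ p < N, moduleField M ℓ ι i j s p w = 0) :
    ∃ op : DiffIdx n → Module.End ℂ M, IsRep ℓ χ op ∧ IsRestricted op ∧
      (∀ i j s p w, moduleField M ℓ ι i j s p w = op ⟨i, j, -p - 1, ℓ j + s⟩ w) ∧
      ∀ N : Submodule ℂ M, (∀ i j m s, ∀ w ∈ N, op ⟨i, j, m, ℓ j + s⟩ w ∈ N) → N = ⊥ ∨ N = ⊤ := by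
  obtain ⟨Λ, hΛ⟩ := exists_labelling hn ℓ ι hκ hfin
  have hr := Λ.isRep_op hκ hfin
  have hop : ∀ i j m s, repOp hr.toLieHom ⟨i, j, m, ℓ j + s⟩ = Λ.op χ hfin ⟨i, j, m, ℓ j + s⟩ :=
    fun i j m s => by rw [repOp_diffE, hr.toLieHom_diffE]
  refine ⟨repOp hr.toLieHom, isRep_repOp _ hr.toLieHom_kappa, fun i j r w => ?_,
    fun i j s p w => by rw [hΛ, hop], fun N h => Λ.eq_bot_or_eq_top hirr hκ hfin N
      fun i j m s w hw => by rw [← hop]; exact h i j m s w hw⟩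
  by_cases hr' : ℓ j ≤ r
  · obtain ⟨s, rfl⟩ := Nat.exists_eq_add_of_le hr'
    obtain ⟨N, hN⟩ := hlaurent i j s w
    exact ⟨N, fun p hp => by rw [hop, ← hΛ, hN p hp]⟩
  · exact ⟨0, fun p _ => by rw [repOp, dif_neg hr', LinearMap.zero_apply]⟩

end RestrictedRep

end

theorem theorem6p3 (n : ℕ) (hn : 0 < n) (ℓ : Fin n → ℕ) (χ ι : ℂ) (hχ : χ ≠ 0)
    (M : Type*) [AddCommGroup M] [Module ℂ M] [LieRingModule GlInf M] [LieModule ℂ GlInf M]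
    (hirr : LieModule.IsIrreducible ℂ GlInf M) (hwt : IsWeighted M) (hfin : IsFinitelyPlaced M)
    (hκ : ∀ w : M, ⁅kappa0, w⁆ = χ • w)
    (hlaurent : ∀ (i j : Fin n) (s : ℕ) (w : M),
      ∃ N : ℤ, ∀ p < N, moduleField M ℓ ι i j s p w = 0) :
    (∃! T : Vacuum ℓ χ →ₗ[ℂ] Vacuum ℓ χ, IsTranslation T) ∧
    (∃! Y : Vacuum ℓ χ →ₗ[ℂ] HVertexOperator ℤ ℂ (Vacuum ℓ χ) (Vacuum ℓ χ),
      IsInductiveMap (vacuumField ℓ χ) Y) ∧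
    (∃! YM : Vacuum ℓ χ →ₗ[ℂ] HVertexOperator ℤ ℂ M M,
      IsInductiveMap (moduleField M ℓ ι) YM) ∧
    ∀ (T : Vacuum ℓ χ →ₗ[ℂ] Vacuum ℓ χ)
      (Y : Vacuum ℓ χ →ₗ[ℂ] HVertexOperator ℤ ℂ (Vacuum ℓ χ) (Vacuum ℓ χ))
      (YM : Vacuum ℓ χ →ₗ[ℂ] HVertexOperator ℤ ℂ M M),
      IsTranslation T → IsInductiveMap (vacuumField ℓ χ) Y →
      IsInductiveMap (moduleField M ℓ ι) YM →
      IsVertexAlgebra Y T (vac ℓ χ) ∧ IsVertexModule Y T (vac ℓ χ) YM ∧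
        IsIrreducibleVertexModule YM := by
  obtain ⟨op, hrep, hres, hE, hN⟩ := exists_restricted_rep hn ℓ χ ι M hirr hfin hκ hlaurent
  obtain ⟨f, hf⟩ := exists_fieldMap isRestricted_actHom (isRep_actHom (ℓ := ℓ) (χ := χ))
  obtain ⟨g, hg⟩ := exists_fieldMap hres hrep
  have hY : IsInductiveMap (vacuumField ℓ χ) (Fld.toVertexOperator ∘ₗ f) :=
    hf.isInductiveMap fun i j s p w => by rw [repOp_diffE, actHom_apply]; rfl
  have hYM : IsInductiveMap (moduleField M ℓ ι) (Fld.toVertexOperator ∘ₗ g) :=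
    hg.isInductiveMap hE
  refine ⟨existsUnique_translation, ⟨_, hY, fun _ h => h.ext hY⟩, ⟨_, hYM, fun _ h => h.ext hYM⟩,
    fun T Y YM hT h h' => ?_⟩
  obtain rfl := h.ext hY
  obtain rfl := h'.ext hYM
  refine ⟨hf.isVertexAlgebra hT, hf.isVertexModule hg hrep hT,
    LieModule.nontrivial_of_isIrreducible ℂ GlInf M, fun N h0 => hN N fun i j m s w hw => ?_⟩
  have h1 := h0 (act (diffE ℓ i j (-1) s) (vac ℓ χ)) (-m - 1) w hw
  rw [LinearMap.comp_apply, hg.generator, Fld.coeff_toVertexOperator] at h1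
  dsimp only at h1
  rwa [hres.field_apply, show -(-m - 1) - 1 = m by ring] at h1
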